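/- Fix a finite relational schema $\sigma$ (each relation name having arity at least $1$) and an integer $d\ge 2$. A database is a finite $\sigma$-structure $\mathcal D$ with domain $D$, of size $|D|=n$; the domain is linearly ordered, so it may be taken to be an initial segment of the natural numbers. The degree of an element is the total number of tuples of $\mathcal D$ containing it, and the degree of $\mathcal D$ is the maximum degree of its elements. Let $\mathbf C$ be an isomorphism-closed class of databases of degree at most $d$, and let $\mathbf P\subseteq\mathbf C$ be an isomorphism-closed subclass (a property). **Definitions.** * *Closed under removing tuples*: every database obtained from a member of $\mathbf C$ by removing tuples, with the domain unchanged, is in $\mathbf C$. * *Hyperfinite*: $\mathbf P$ is hyperfinite on $\mathbf C$ if there is a function $\rho$ such that for every $\epsilon\in(0,1]$ and every $\mathcal D\in\mathbf P$ one can remove at most $\epsilon|D|$ tuples from $\mathcal D$ so that the result is in $\mathbf C$ and every connected component of its Gaifman graph has at most $\rho(\epsilon)$ elements. * *Histogram*: the $r$-type of $a\in D$ is the isomorphism class of the substructure induced by the elements at distance at most $r$ from $a$ in the Gaifman graph, with $a$ as distinguished centre. The $r$-histogram $\operatorname{h}_r(\mathcal D)$ is the vector, indexed by the finitely many $r$-types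 of degree at most $d$, that counts the elements of $\mathcal D$ of each $r$-type; $\operatorname{h}_r(\mathbf P)=\{\operatorname{h}_r(\mathcal D)\mid\mathcal D\in\mathbf P\}$. * *Semilinear*: a finite union of sets of the form $\{\bar v_0+a_1\bar v_1+\dots+a_k\bar v_k\mid a_1,\dots,a_k\in\mathbb N\}$, where $\bar v_0,\dots,\bar v_k$ are vectors of natural numbers. * *Distance in the $\mathrm{BDRD}_{+/ -}$ model*: $\operatorname{dist}_{+/ -}(\mathcal D,\mathcal D')$ is the minimum total number of modifications of $\mathcal D$ and $\mathcal D'$ that make them isomorphic. A modification is the insertion of a new element, the deletion of an element together with all tuples containing it, the insertion of a tuple, or the deletion of a tuple. The databases $\mathcal D,\mathcal D'$ are $\epsilon$-close if $\operatorname{dist}_{+/ -}(\mathcal D,\mathcal D')\le\epsilon d\min\{|D|,|D'|\}$; $\mathcal D$ is $\epsilon$-far from $\mathbf P$ if it is not $\epsilon$-close to any member of $\mathbf P$. * *Tester*: an $\epsilon$-tester for $\mathbf P$ on $\mathbf C$ is a probabilistic random access machine that gets $n=|D|$ as input and has access to $\mathcal D\in\mathbf C$ through oracle queries $(R,i,j)$,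 whose answer is the $j$-th tuple (in lexicographic order) of $R^{\mathcal D}$ containing the $i$-th element, or $\bot$ if there is none. It accepts with probability at least $2/3$ if $\mathcal D\in\mathbf P$, and rejects with probability at least $2/3$ if $\mathcal D\in\mathbf C$ is $\epsilon$-far from $\mathbf P$. Running time is measured by uniform cost: each arithmetic operation, memory access, comparison, uniform sampling of a number below a given number, and oracle query is one step. **Theorem.** Suppose that $\mathbf C$ is closed under removing tuples, that $\mathbf P$ is hyperfinite on $\mathbf C$, and that for every $r\in\mathbb N$ the set $\operatorname{h}_r(\mathbf P)$ is semilinear. Then $\mathbf P$ is uniformly testable on $\mathbf C$ in constant time in the $\mathrm{BDRD}_{+/ -}$ model: for every $\epsilon\in(0,1]$ there are a single $\epsilon$-tester for $\mathbf P$ on $\mathbf C$, working for inputs of all sizes, and constants $q$ and $T$ such that on every input $\mathcal D\in\mathbf C$ the tester makes at most $q$ oracle queries and halts after at most $T$ steps, for all outcomes of its random choices. -/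

import Mathlib

open scoped ENNReal

/-! ## Relational databases -/

/-- A finite relational schema: relation names `0, …, numRel - 1`, each of arity at least one. -/
structure Schema where
  numRel : ℕ
  arity : Fin numRel → ℕ
  arity_pos : ∀ R, 0 < arity R

/-- An interpretation of the relation names of `σ` on the set `V`. -/
@[ext]
structure RelStr (σ : Schema) (V : Type) where
  rel : (R : Fin σ.numRel) → Set (Fin (σ.arity R) → V)

namespace RelStr

variable {σ : Schema} {V W : Type}

/-- `A.IsSub B`: every tuple of `A` is a tuple of `B`, that is, `A` arises from `B` by removing
tuples (the domain stays the same). -/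
def IsSub (A B : RelStr σ V) : Prop := ∀ R, A.rel R ⊆ B.rel R

/-- The pull-back of a structure along `f`. For injective `f` this is the substructure induced
by the image of `f`. -/
def comap (f : V → W) (B : RelStr σ W) : RelStr σ V where
  rel R := {t | f ∘ t ∈ B.rel R}

/-- The image of a structure along `f`. -/
def map (f : V → W) (A : RelStr σ V) : RelStr σ W where
  rel R := (fun t => f ∘ t) '' A.rel R

/-- The substructure induced by a subset of the domain. -/
def induce (A : RelStr σ V) (M : Set V) : RelStr σ M := A.comap Subtype.val

/-- Insert the tuple `t` into the relation `R`. -/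
def insertTuple (A : RelStr σ V) (R : Fin σ.numRel) (t : Fin (σ.arity R) → V) : RelStr σ V where
  rel := Function.update A.rel R (insert t (A.rel R))

/-- Remove the tuple `t` from the relation `R`. -/
def removeTuple (A : RelStr σ V) (R : Fin σ.numRel) (t : Fin (σ.arity R) → V) : RelStr σ V where
  rel := Function.update A.rel R (A.rel R \ {t})

/-- `e` is an isomorphism from `A` to `B`. -/
def IsIso (A : RelStr σ V) (B : RelStr σ W) (e : V ≃ W) : Prop :=
  ∀ R (t : Fin (σ.arity R) → V), t ∈ A.rel R ↔ e ∘ t ∈ B.rel R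

/-- The Gaifman graph. -/
def gaifman (A : RelStr σ V) : SimpleGraph V where
  Adj a b := a ≠ b ∧ ∃ R, ∃ t ∈ A.rel R, a ∈ Set.range t ∧ b ∈ Set.range t
  symm := ⟨fun _ _ ⟨hne, R, t, ht, ha, hb⟩ => ⟨hne.symm, R, t, ht, hb, ha⟩⟩
  loopless := ⟨fun _ h => h.1 rfl⟩

/-- The degree of an element: the total number of tuples, in all relations, that contain it. -/
noncomputable def elementDegree (A : RelStr σ V) (a : V) : ℕ :=
  ∑ R, {t ∈ A.rel R | a ∈ Set.range t}.ncard

/-- The set of elements at distance at most `r` from `a` in the Gaifman graph. -/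
def ball (A : RelStr σ V) (r : ℕ) (a : V) : Set V := {b | A.gaifman.edist a b ≤ r}

theorem mem_ball_self (A : RelStr σ V) (r : ℕ) (a : V) : a ∈ A.ball r a := by
  simp [ball]

/-- The `r`-neighbourhoods of `a` in `A` and of `b` in `B` are isomorphic by an isomorphism that
maps the centre `a` to the centre `b`. -/
def SameNbhd (r : ℕ) (A : RelStr σ V) (a : V) (B : RelStr σ W) (b : W) : Prop :=
  ∃ e : A.ball r a ≃ B.ball r b,
    (A.induce (A.ball r a)).IsIso (B.induce (B.ball r b)) e ∧
      e ⟨a, A.mem_ball_self r a⟩ = ⟨b, B.mem_ball_self r b⟩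

end RelStr

/-- A database with schema `σ`. Databases are linearly ordered, so the domain is an initial segment
`{0, …, size - 1}` of the natural numbers. -/
structure Database (σ : Schema) where
  size : ℕ
  str : RelStr σ (Fin size)

namespace Database

variable {σ : Schema}

/-- Isomorphism of databases (the linear order is not part of the structure). -/
def Isomorphic (D E : Database σ) : Prop := ∃ e : Fin D.size ≃ Fin E.size, D.str.IsIso E.str e

/-- The degree of a database: the maximum degree of its elements. -/
noncomputable def degree (D : Database σ) : ℕ := Finset.univ.sup D.str.elementDegree

/-- The tuples of `R` that contain the `i`-th element, in lexicographic order. -/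
noncomputable def tuplesAt (D : Database σ) (R : Fin σ.numRel) (i : ℕ) :
    List (Lex (Fin (σ.arity R) → Fin D.size)) :=
  (Set.toFinite {t : Lex (Fin (σ.arity R) → Fin D.size) |
    ofLex t ∈ D.str.rel R ∧ ∃ k, (ofLex t k : ℕ) = i}).toFinset.sort (· ≤ ·)

/-- The answer to the oracle query `(R, i, j)`: the `j`-th tuple of `R` that contains the `i`-th
element, or `none` if there is no such tuple. Both `i` and `j` are counted from `0`. -/
noncomputable def answer (D : Database σ) (R : Fin σ.numRel) (i j : ℕ) :
    Option (Lex (Fin (σ.arity R) → Fin D.size)) :=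
  (D.tuplesAt R i)[j]?

end Database

/-! ## Classes of databases -/

section Classes

variable {σ : Schema}

/-- The class of all databases of degree at most `d`. -/
def boundedDegree (σ : Schema) (d : ℕ) : Set (Database σ) := {D | D.degree ≤ d}

def IsoClosed (C : Set (Database σ)) : Prop :=
  ∀ D E : Database σ, D.Isomorphic E → D ∈ C → E ∈ C

def ClosedUnderRemovingTuples (C : Set (Database σ)) : Prop :=
  ∀ (n : ℕ) (A B : RelStr σ (Fin n)), B.IsSub A → (⟨n, A⟩ : Database σ) ∈ C →
    (⟨n, B⟩ : Database σ) ∈ C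

/-- `B` is an `(ε, k)`-partition of `D`: it arises from `D` by removing at most `ε |D|` tuples, and
its connected components have at most `k` elements. -/
def IsPartition (ε : ℝ) (k : ℕ) (D : Database σ) (B : RelStr σ (Fin D.size)) : Prop :=
  B.IsSub D.str ∧
  ((∑ R, (D.str.rel R \ B.rel R).ncard : ℕ) : ℝ) ≤ ε * D.size ∧
  ∀ K : B.gaifman.ConnectedComponent, K.supp.ncard ≤ k

/-- `P` is hyperfinite on `C`. -/
def IsHyperfiniteOn (P C : Set (Database σ)) : Prop :=
  ∃ ρ : ℝ → ℕ, ∀ ε ∈ Set.Ioc (0 : ℝ) 1, ∀ D ∈ P, ∃ B : RelStr σ (Fin D.size),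
    IsPartition ε (ρ ε) D B ∧ (⟨D.size, B⟩ : Database σ) ∈ C

end Classes

/-! ## Neighbourhood types and histograms -/

section Histograms

variable {σ : Schema}

/-- A database of degree at most `d` with a distinguished element. -/
structure PointedDatabase (σ : Schema) (d : ℕ) where
  db : Database σ
  degree_le : db.degree ≤ d
  point : Fin db.size

/-- Isomorphism of `r`-neighbourhoods as an equivalence relation. -/
def nbhdSetoid (σ : Schema) (d r : ℕ) : Setoid (PointedDatabase σ d) where
  r x y := RelStr.SameNbhd r x.db.str x.point y.db.str y.point
  iseqv :=
    { refl := fun _ => ⟨Equiv.refl _, fun _ _ => Iff.rfl, rfl⟩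
      symm := by
        rintro x y ⟨e, he, hc⟩
        refine ⟨e.symm, fun R t => ?_, by rw [← hc, Equiv.symm_apply_apply]⟩
        have h := he R (e.symm ∘ t)
        rw [← Function.comp_assoc, Equiv.self_comp_symm, Function.id_comp] at h
        exact h.symm
      trans := by
        rintro x y z ⟨e, he, hc⟩ ⟨f, hf, hd⟩
        exact ⟨e.trans f, fun R t => (he R t).trans (hf R (e ∘ t)),
          by rw [Equiv.trans_apply, hc, hd]⟩ }

/-- The set of all `r`-types with degree at most `d`. -/
def NbhdType (σ : Schema) (d r : ℕ) : Type := Quotient (nbhdSetoid σ d r)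

/-- The element `a` of `D` has `r`-type `τ`. -/
def HasType {d r : ℕ} (D : Database σ) (a : Fin D.size) (τ : NbhdType σ d r) : Prop :=
  ∃ x : PointedDatabase σ d, (Quotient.mk (nbhdSetoid σ d r) x : NbhdType σ d r) = τ ∧
    RelStr.SameNbhd r D.str a x.db.str x.point

/-- The `r`-histogram of a database (of degree at most `d`): the component indexed by the
`r`-type `τ` is the number of elements of `r`-type `τ`. -/
noncomputable def histogram (d r : ℕ) (D : Database σ) : NbhdType σ d r → ℕ :=
  fun τ => {a : Fin D.size | HasType D a τ}.ncard

end Histograms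

/-! ## Distance by insertion and deletion of elements and of tuples -/

section Distance

variable {σ : Schema}

/-- A single modification of a database. Deleting an element deletes every tuple that contains it.
An injection `f` from an `n`-element domain to an `n + 1`-element one records how the elements are
renumbered when an element is inserted or deleted; the element outside its range is the new
element, or the deleted one. -/
inductive Modification : Database σ → Database σ → Prop
  | insertElement {n : ℕ} (A : RelStr σ (Fin n)) (f : Fin n ↪ Fin (n + 1)) :
      Modification ⟨n, A⟩ ⟨n + 1, A.map f⟩
  | deleteElement {n : ℕ} (A : RelStr σ (Fin (n + 1))) (f : Fin n ↪ Fin (n + 1)) :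
      Modification ⟨n + 1, A⟩ ⟨n, A.comap f⟩
  | insertTuple {n : ℕ} (A : RelStr σ (Fin n)) (R : Fin σ.numRel)
      (t : Fin (σ.arity R) → Fin n) : t ∉ A.rel R → Modification ⟨n, A⟩ ⟨n, A.insertTuple R t⟩
  | deleteTuple {n : ℕ} (A : RelStr σ (Fin n)) (R : Fin σ.numRel)
      (t : Fin (σ.arity R) → Fin n) : t ∈ A.rel R → Modification ⟨n, A⟩ ⟨n, A.removeTuple R t⟩

/-- `E` arises from `D` by a sequence of exactly `k` modifications. -/
def ModifiesIn : ℕ → Database σ → Database σ → Prop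
  | 0, D, E => D = E
  | k + 1, D, E => ∃ F, Modification D F ∧ ModifiesIn k F E

/-- The possible total numbers of modifications of `D` and `D'` that make them isomorphic. -/
def modificationCounts (D D' : Database σ) : Set ℕ :=
  {m | ∃ k l : ℕ, k + l = m ∧ ∃ E E' : Database σ,
    ModifiesIn k D E ∧ ModifiesIn l D' E' ∧ E.Isomorphic E'}

/-- The distance: the minimum number of modifications of `D` and `D'` that make them isomorphic. -/
noncomputable def distPM (D D' : Database σ) : ℕ := sInf (modificationCounts D D')

theorem exists_modifiesIn_empty (n : ℕ) (A : RelStr σ (Fin n)) :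
    ∃ B : RelStr σ (Fin 0), ModifiesIn n ⟨n, A⟩ ⟨0, B⟩ := by
  induction n with
  | zero => exact ⟨A, rfl⟩
  | succ n ih =>
    obtain ⟨B, hB⟩ := ih (A.comap (Fin.castSuccEmb : Fin n ↪ Fin (n + 1)))
    exact ⟨B, _, Modification.deleteElement A Fin.castSuccEmb, hB⟩

/-- The minimum in the definition of the distance is over a non-empty set. -/
theorem modificationCounts_nonempty (D D' : Database σ) : (modificationCounts D D').Nonempty := by
  obtain ⟨n, A⟩ := D
  obtain ⟨n', A'⟩ := D'
  obtain ⟨B, hB⟩ := exists_modifiesIn_empty n A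
  obtain ⟨B', hB'⟩ := exists_modifiesIn_empty n' A'
  exact ⟨n + n', n, n', rfl, _, _, hB, hB', Equiv.refl _,
    fun R t => (t ⟨0, σ.arity_pos R⟩).elim0⟩

/-- `D` and `D'`, of degree at most `d`, are `ε`-close. -/
def IsClose (d : ℕ) (ε : ℝ) (D D' : Database σ) : Prop :=
  (distPM D D' : ℝ) ≤ ε * d * (min D.size D'.size : ℕ)

/-- `D` is `ε`-far from the property `P`. -/
def IsFarFrom (d : ℕ) (ε : ℝ) (D : Database σ) (P : Set (Database σ)) : Prop :=
  ¬ ∃ D' ∈ P, IsClose d ε D D'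

end Distance

/-! ## Probabilistic random access machines with oracle access to a database -/

inductive ArithOp
  | add
  | sub
  | mul
  | div

/-- Arithmetic on natural numbers; subtraction is truncated, and division rounds down. -/
def ArithOp.eval : ArithOp → ℕ → ℕ → ℕ
  | add, x, y => x + y
  | sub, x, y => x - y
  | mul, x, y => x * y
  | div, x, y => x / y

/-- The instructions of a machine with label set `L`. Registers are indexed by natural numbers and
hold natural numbers; we write `r[a]` for the content of the register `a`. -/
inductive Instr (σ : Schema) (L : Type)
  /-- `r[dst] := c` -/
  | const (dst c : ℕ) (next : L)
  /-- `r[dst] := r[a] op r[b]` -/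
  | arith (op : ArithOp) (dst a b : ℕ) (next : L)
  /-- `r[dst] := r[r[a]]` -/
  | load (dst a : ℕ) (next : L)
  /-- `r[r[a]] := r[b]` -/
  | store (a b : ℕ) (next : L)
  /-- if `r[a] ≤ r[b]` go to `yes`, otherwise go to `no` -/
  | branch (a b : ℕ) (yes no : L)
  /-- `r[dst] :=` a uniformly random element of `{0, …, r[a] - 1}` (or `0` if `r[a] = 0`) -/
  | sample (dst a : ℕ) (next : L)
  /-- the oracle query `(R, r[i], r[j])`: if the answer is the tuple `(t₀, t₁, …)`, then
  `r[dst] := 1` and `r[dst + 1 + k] := tₖ` for all `k`; if there is no such tuple,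
  then `r[dst] := 0` -/
  | query (R : Fin σ.numRel) (i j dst : ℕ) (next : L)
  | accept
  | reject

/-- A machine: a finite program with labelled instructions. -/
structure RAM (σ : Schema) where
  Label : Type
  finite_label : Finite Label
  start : Label
  code : Label → Instr σ Label

namespace RAM

variable {σ : Schema}

/-- A configuration: the label of the next instruction, the contents of the registers, and the
number of oracle queries made so far. -/
structure Config (M : RAM σ) where
  label : M.Label
  reg : ℕ → ℕ
  queries : ℕ

/-- The content of the registers after the answer to an oracle query was written. -/
def writeAnswer {k n : ℕ} (reg : ℕ → ℕ) (dst : ℕ) : Option (Lex (Fin k → Fin n)) → ℕ → ℕ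
  | none => Function.update reg dst 0
  | some t => fun x =>
      if x = dst then 1
      else if h : dst < x ∧ x - dst - 1 < k then ofLex t ⟨x - dst - 1, h.2⟩
      else reg x

/-- The uniform distribution on `{0, …, m - 1}` (the point mass at `0` if `m = 0`). -/
noncomputable def uniformBelow (m : ℕ) : PMF ℕ :=
  if h : 0 < m then PMF.uniformOfFinset (Finset.range m) ⟨0, Finset.mem_range.2 h⟩ else PMF.pure 0

/-- One step of the machine with oracle access to `D`. Every instruction takes one step; a
configuration with an `accept` or `reject` instruction has halted. -/
noncomputable def step (M : RAM σ) (D : Database σ) (c : M.Config) : PMF M.Config :=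
  match M.code c.label with
  | .const dst x next => PMF.pure ⟨next, Function.update c.reg dst x, c.queries⟩
  | .arith op dst a b next =>
      PMF.pure ⟨next, Function.update c.reg dst (op.eval (c.reg a) (c.reg b)), c.queries⟩
  | .load dst a next => PMF.pure ⟨next, Function.update c.reg dst (c.reg (c.reg a)), c.queries⟩
  | .store a b next => PMF.pure ⟨next, Function.update c.reg (c.reg a) (c.reg b), c.queries⟩
  | .branch a b yes no =>
      PMF.pure ⟨if c.reg a ≤ c.reg b then yes else no, c.reg, c.queries⟩
  | .sample dst a next =>
      (uniformBelow (c.reg a)).map fun x => ⟨next, Function.update c.reg dst x, c.queries⟩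
  | .query R i j dst next =>
      PMF.pure ⟨next, writeAnswer c.reg dst (D.answer R (c.reg i) (c.reg j)), c.queries + 1⟩
  | .accept => PMF.pure c
  | .reject => PMF.pure c

/-- The initial configuration: register `0` holds the number of elements of the input, and all
other registers hold `0`. -/
def init (M : RAM σ) (D : Database σ) : M.Config :=
  ⟨M.start, Function.update (fun _ => 0) 0 D.size, 0⟩

/-- The distribution of the configuration after `k` steps. -/
noncomputable def run (M : RAM σ) (D : Database σ) : ℕ → PMF M.Config
  | 0 => PMF.pure (M.init D)
  | k + 1 => (M.run D k).bind (M.step D)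

/-- The configurations in which the machine has halted and accepted. -/
def accepting (M : RAM σ) : Set M.Config := {c | M.code c.label = .accept}

/-- The configurations in which the machine has halted and rejected. -/
def rejecting (M : RAM σ) : Set M.Config := {c | M.code c.label = .reject}

/-- The probability that `M` accepts. The probabilities increase with the number of steps. -/
noncomputable def acceptProb (M : RAM σ) (D : Database σ) : ℝ≥0∞ :=
  ⨆ k, (M.run D k).toOuterMeasure M.accepting

/-- The probability that `M` rejects. The probabilities increase with the number of steps. -/
noncomputable def rejectProb (M : RAM σ) (D : Database σ) : ℝ≥0∞ :=
  ⨆ k, (M.run D k).toOuterMeasure M.rejecting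

/-- On every input from `C`, all computations of `M` halt after at most `f n` steps, where `n` is
the number of elements of the input. -/
def RunsInTime (M : RAM σ) (C : Set (Database σ)) (f : ℕ → ℕ) : Prop :=
  ∀ D ∈ C, ∀ c ∈ (M.run D (f D.size)).support, c ∈ M.accepting ∪ M.rejecting

/-- On every input from `C`, all computations of `M` make at most `q` oracle queries. -/
def QueryComplexityLE (M : RAM σ) (C : Set (Database σ)) (q : ℕ) : Prop :=
  ∀ D ∈ C, ∀ k, ∀ c ∈ (M.run D k).support, c.queries ≤ q

end RAM

/-! ## Property testing -/

section Testing

variable {σ : Schema}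

/-- `M` is an `ε`-tester for `P` on `C` (for databases of degree at most `d`). -/
def IsTester (d : ℕ) (ε : ℝ) (P C : Set (Database σ)) (M : RAM σ) : Prop :=
  ∀ D ∈ C, (D ∈ P → 2 / 3 ≤ M.acceptProb D) ∧ (IsFarFrom d ε D P → 2 / 3 ≤ M.rejectProb D)

/-- `P` is uniformly testable on `C` in constant time: for every `ε` there is a single `ε`-tester,
for inputs of all sizes, whose query complexity and running time are bounded by constants that do
not depend on the input. -/
def UniformlyTestableInConstantTime (d : ℕ) (P C : Set (Database σ)) : Prop :=
  ∀ ε ∈ Set.Ioc (0 : ℝ) 1, ∃ M : RAM σ, IsTester d ε P C M ∧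
    (∃ q : ℕ, M.QueryComplexityLE C q) ∧ ∃ T : ℕ, M.RunsInTime C (fun _ => T)

end Testing

/-!
The tester samples constantly many elements, explores their `r`-neighbourhoods, and accepts if the
frequencies of the types it sees are close to a direction of the semilinear set `h_r(P)`. This is
correct because of a rigidity property of hyperfinite databases: there are `r` and `δ`, depending
only on `ε` and the hyperfiniteness function, such that every large database of bounded degree
whose `r`-histogram is `δ`-close to the histogram of a hyperfinite database is `ε`-close to this
database (`exists_isClose_of_histDist_le`).

*Rigidity.* Let `D'` be hyperfinite and let `D` have nearly the same histogram. Removing few tuples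
cuts `D'` into components, which are clusters, that is, sets of bounded diameter
(`RelStr.exists_isClusterPartition`). The partition into components need not be visible locally.
However, the fraction of components among all clusters of `D'` that look like a given cluster up to
distance `R` depends only on what the cluster looks like. These fractions form a local rule
(`RelStr.WeightRule`) that assigns weights to the clusters of every database. On `D'` the total
weight of the boundaries is the number of cut tuples, up to rounding. The weights of the clusters
through an element may add up to less than `1 / 2`; such bad elements receive an additional
singleton cluster. To make them rare, the radius is chosen by a pigeonhole argument
(`RelStr.exists_radius`): the sum of the squares of the fractions grows with `R` and is bounded, so
it hardly grows at some step from `R` to `R + k`, and since conditional averages are orthogonal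
projections (`sum_sq_classAvg_sub`), the fractions themselves hardly change at this step. As badness
at radius `R` is visible at radius `R + k`, the bad elements are few (`RelStr.sq_card_isBad_le`).
The result is a local fractional partition that cuts few tuples of `D'`
(`RelStr.exists_weightRule`); by locality it also cuts few tuples of `D`.

The fractional partition is rounded at random on `D` and on `D'` by the same local procedure. Every
copy of a cluster gets an independent random label, and every element joins the copy with the
smallest label among those that contain it. The elements that join the same copy form a cell. A
tuple is cut with a probability that is essentially at most proportional to the weight of the
clusters on whose boundary it lies (`expect_card_cut_le`). The number of elements in cells
of a given isomorphism type has an expectation that is determined by the histogram up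
to a small error, and a small variance, since distant elements are independent
(`exists_labels`). So there are partitions of `D` and of `D'` into
small cells with few cut tuples and nearly the same numbers of cells of each isomorphism type.
Deleting the cut tuples and matching isomorphic cells shows that `D` and `D'` are close
(`distPM_le_of_isCells`).

*Testing.* A linear set of vectors of natural numbers has bounded distance to the dilations of the
cone of its periods, hence semilinear sets are approximated by finite unions of cones
(`exists_coneApprox`), and membership in `h_r(P)` becomes, up to a bounded error, a condition on
frequencies that does not refer to the size of the database. By Chebyshev's inequality a sample of
constant size estimates all frequencies accurately with probability at least `2 / 3`
(`three_mul_card_sampleError_lt_le`). The machine is obtained from a loop-free program (`Prog`),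
which makes constantly many queries and then compares all its registers. The order pattern of the
registers determines the neighbourhoods of the sampled elements (`SamePattern.sameNbhd`), and it
determines small databases completely (`SamePattern.eq`). Therefore a program that answers according
to the order pattern accepts exactly the right samples, and decides small databases without error
(`Prog.exists_prog`, `exists_isTester`).
-/

section

open scoped Classical BigOperators

/-! ### Local isomorphisms and balls -/

namespace RelStr

variable {σ : Schema} {V W X : Type}

/-- `f` restricts to an isomorphism from the substructure of `A` induced by `M` to the substructure
of `B` induced by `N`. The values of `f` outside `M` are irrelevant. -/
def LocalIso (A : RelStr σ V) (B : RelStr σ W) (f : V → W) (M : Set V) (N : Set W) : Prop :=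
  Set.BijOn f M N ∧ ∀ R (t : Fin (σ.arity R) → V), (∀ i, t i ∈ M) → (t ∈ A.rel R ↔ f ∘ t ∈ B.rel R)

/-- The elements at distance at most `r` from the set `S`. -/
def nbhd (A : RelStr σ V) (r : ℕ) (S : Set V) : Set V := {b | ∃ a ∈ S, b ∈ A.ball r a}

/-- The pairs `(A, S)` and `(B, T)` look the same up to distance `r`: the `r`-neighbourhoods of
`S` and `T` are isomorphic by an isomorphism that maps `S` to `T`. -/
def SetIso (r : ℕ) (A : RelStr σ V) (S : Finset V) (B : RelStr σ W) (T : Finset W) : Prop :=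
  ∃ f : V → W, LocalIso A B f (A.nbhd r S) (B.nbhd r T) ∧ f '' S = T

variable {A : RelStr σ V} {B : RelStr σ W} {E : RelStr σ X}

namespace LocalIso

variable {f : V → W} {M : Set V} {N : Set W}

theorem refl (A : RelStr σ V) (M : Set V) : LocalIso A A id M M :=
  ⟨Set.bijOn_id M, fun _ _ _ => Iff.rfl⟩

theorem comp {g : W → X} {L : Set X} (hg : LocalIso B E g N L) (hf : LocalIso A B f M N) :
    LocalIso A E (g ∘ f) M L :=
  ⟨hg.1.comp hf.1, fun R t ht => (hf.2 R t ht).trans (hg.2 R _ fun i => hf.1.mapsTo (ht i))⟩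

theorem mono (h : LocalIso A B f M N) {M' : Set V} (hM : M' ⊆ M) :
    LocalIso A B f M' (f '' M') :=
  ⟨(h.1.injOn.mono hM).bijOn_image, fun R t ht => h.2 R t fun i => hM (ht i)⟩

theorem exists_symm [Nonempty V] (h : LocalIso A B f M N) :
    ∃ g, LocalIso B A g N M ∧ Set.InvOn g f M N := by
  have hinv : Set.InvOn (Function.invFunOn f M) f M N := h.1.invOn_invFunOn
  have hb : Set.BijOn (Function.invFunOn f M) N M :=
    (Set.bijOn_comm hinv.symm).1 h.1
  refine ⟨_, ⟨hb, fun R t ht => ?_⟩, hinv⟩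
  rw [h.2 R (Function.invFunOn f M ∘ t) fun i => hb.mapsTo (ht i)]
  have : f ∘ Function.invFunOn f M ∘ t = t := funext fun i => hinv.2 (ht i)
  rw [this]

end LocalIso

theorem sameNbhd_iff {r : ℕ} {a : V} {b : W} :
    SameNbhd r A a B b ↔ ∃ f, LocalIso A B f (A.ball r a) (B.ball r b) ∧ f a = b := by
  constructor
  · rintro ⟨e, he, hab⟩
    have hf : ∀ x (hx : x ∈ A.ball r a),
        (fun x => if hx : x ∈ A.ball r a then (e ⟨x, hx⟩ : W) else b) x = e ⟨x, hx⟩ := by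
      intro x hx
      simp [hx]
    refine ⟨fun x => if hx : x ∈ A.ball r a then (e ⟨x, hx⟩ : W) else b,
      ⟨⟨fun x hx => ?_, fun x hx y hy hxy => ?_, fun y hy => ?_⟩, fun R t ht => ?_⟩, ?_⟩
    · rw [hf x hx]; exact (e ⟨x, hx⟩).2
    · rw [hf x hx, hf y hy] at hxy
      exact congrArg Subtype.val (e.injective (Subtype.ext hxy))
    · refine ⟨e.symm ⟨y, hy⟩, (e.symm ⟨y, hy⟩).2, ?_⟩
      rw [hf _ (e.symm ⟨y, hy⟩).2]
      simp
    · have := he R fun i => ⟨t i, ht i⟩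
      refine this.trans (iff_of_eq (congrArg (· ∈ B.rel R) (funext fun i => ?_)))
      exact (hf (t i) (ht i)).symm
    · rw [hf a (A.mem_ball_self r a), hab]
  · rintro ⟨f, ⟨hb, hR⟩, rfl⟩
    exact ⟨hb.equiv f, fun R t => hR R (Subtype.val ∘ t) fun i => (t i).2, rfl⟩

theorem mem_ball_comm {r : ℕ} {a b : V} : b ∈ A.ball r a ↔ a ∈ A.ball r b := by
  simp [ball, SimpleGraph.edist_comm]

theorem mem_ball_trans {r s : ℕ} {a b c : V} (h : b ∈ A.ball r a) (h' : c ∈ A.ball s b) :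
    c ∈ A.ball (r + s) a := by
  have := (SimpleGraph.edist_triangle (G := A.gaifman) (u := a) (v := b) (w := c)).trans
    (add_le_add h h')
  simpa [ball] using this

theorem ball_mono {r s : ℕ} (h : r ≤ s) (a : V) : A.ball r a ⊆ A.ball s a := fun _ hx =>
  le_trans (Set.mem_ofPred.1 hx) (by exact_mod_cast h)

theorem mem_ball_iff_walk {r : ℕ} {a b : V} :
    b ∈ A.ball r a ↔ ∃ p : A.gaifman.Walk a b, p.length ≤ r := by
  constructor
  · intro h
    have hne : A.gaifman.edist a b ≠ ⊤ := ne_top_of_le_ne_top (ENat.natCast_ne_top r) h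
    obtain ⟨p, hp⟩ := SimpleGraph.exists_walk_of_edist_ne_top hne
    exact ⟨p, by exact_mod_cast hp.trans_le h⟩
  · rintro ⟨p, hp⟩
    exact (SimpleGraph.edist_le p).trans (by exact_mod_cast hp)

theorem mem_ball_zero {a b : V} : b ∈ A.ball 0 a ↔ b = a := by
  rw [ball, Set.mem_ofPred, Nat.cast_zero, nonpos_iff_eq_zero, SimpleGraph.edist_eq_zero_iff,
    eq_comm]

theorem mem_ball_succ {r : ℕ} {a b : V} :
    b ∈ A.ball (r + 1) a ↔ ∃ c ∈ A.ball r a, b = c ∨ A.gaifman.Adj c b := by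
  constructor
  · intro h
    rw [mem_ball_comm, mem_ball_iff_walk] at h
    obtain ⟨p, hp⟩ := h
    cases p with
    | nil => exact ⟨a, A.mem_ball_self r a, Or.inl rfl⟩
    | @cons _ c _ hadj q =>
      refine ⟨c, mem_ball_comm.1 (mem_ball_iff_walk.2 ⟨q, ?_⟩), Or.inr hadj.symm⟩
      simpa using hp
  · rintro ⟨c, hc, rfl | hadj⟩
    · exact ball_mono (Nat.le_succ r) _ hc
    · refine mem_ball_trans hc (mem_ball_iff_walk.2 ⟨hadj.toWalk, by simp⟩)

theorem mem_ball_one_of_mem_rel {R : Fin σ.numRel} {t : Fin (σ.arity R) → V} (ht : t ∈ A.rel R)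
    (i j : Fin (σ.arity R)) : t j ∈ A.ball 1 (t i) := by
  by_cases h : t i = t j
  · rw [h]; exact A.mem_ball_self 1 _
  · exact mem_ball_succ.2 ⟨t i, A.mem_ball_self 0 _, Or.inr ⟨h, R, t, ht, ⟨i, rfl⟩, ⟨j, rfl⟩⟩⟩

theorem LocalIso.mapsTo_ball {f : V → W} {M : Set V} {N : Set W} (h : LocalIso A B f M N) {t : ℕ}
    {b : V} (hM : A.ball t b ⊆ M) : Set.MapsTo f (A.ball t b) (B.ball t (f b)) := by
  induction t with
  | zero =>
    intro x hx
    rw [mem_ball_zero] at hx ⊢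
    rw [hx]
  | succ t ih =>
    intro x hx
    obtain ⟨c, hc, rfl | ⟨hne, R, s, hs, ⟨i, rfl⟩, ⟨j, rfl⟩⟩⟩ := mem_ball_succ.1 hx
    · exact ball_mono (Nat.le_succ t) _ (ih ((ball_mono (Nat.le_succ t) b).trans hM) hc)
    · have hs' : ∀ l, s l ∈ M := fun l => hM (mem_ball_trans hc (mem_ball_one_of_mem_rel hs i l))
      have := (h.2 R s hs').1 hs
      exact mem_ball_trans (ih ((ball_mono (Nat.le_succ t) b).trans hM) hc)
        (mem_ball_one_of_mem_rel this i j)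

theorem LocalIso.image_ball {f : V → W} {M : Set V} {N : Set W} (h : LocalIso A B f M N) {t : ℕ}
    {b : V} (hM : A.ball t b ⊆ M) (hN : B.ball t (f b) ⊆ N) :
    f '' A.ball t b = B.ball t (f b) := by
  have : Nonempty V := ⟨b⟩
  refine (h.mapsTo_ball hM).image_subset.antisymm fun y hy => ?_
  obtain ⟨g, hg, hinv⟩ := h.exists_symm
  have hb := hinv.1 (hM (A.mem_ball_self t b))
  have := hg.mapsTo_ball hN hy
  rw [hb] at this
  exact ⟨g y, this, hinv.2 (hN hy)⟩

theorem mem_nbhd {r : ℕ} {S : Set V} {b : V} : b ∈ A.nbhd r S ↔ ∃ a ∈ S, b ∈ A.ball r a := Iff.rfl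

theorem subset_nbhd (r : ℕ) (S : Set V) : S ⊆ A.nbhd r S := fun a ha => ⟨a, ha, A.mem_ball_self r a⟩

theorem nbhd_mono {r s : ℕ} (h : r ≤ s) (S : Set V) : A.nbhd r S ⊆ A.nbhd s S :=
  fun _ ⟨a, ha, hb⟩ => ⟨a, ha, ball_mono h a hb⟩

theorem nbhd_zero (S : Set V) : A.nbhd 0 S = S := by
  ext b
  simp [mem_nbhd, mem_ball_zero]

theorem ball_subset_nbhd {r : ℕ} {S : Set V} {a : V} (ha : a ∈ S) : A.ball r a ⊆ A.nbhd r S :=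
  fun _ hb => ⟨a, ha, hb⟩

theorem LocalIso.image_nbhd {f : V → W} {M : Set V} {N : Set W} (h : LocalIso A B f M N) {t : ℕ}
    {S : Set V} (hM : A.nbhd t S ⊆ M) (hN : B.nbhd t (f '' S) ⊆ N) :
    f '' A.nbhd t S = B.nbhd t (f '' S) := by
  have key : ∀ a ∈ S, f '' A.ball t a = B.ball t (f a) := fun a ha =>
    h.image_ball ((ball_subset_nbhd ha).trans hM)
      ((ball_subset_nbhd (Set.mem_image_of_mem f ha)).trans hN)
  ext y
  constructor
  · rintro ⟨x, ⟨a, ha, hx⟩, rfl⟩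
    exact ⟨f a, ⟨a, ha, rfl⟩, (key a ha).le ⟨x, hx, rfl⟩⟩
  · rintro ⟨_, ⟨a, ha, rfl⟩, hy⟩
    obtain ⟨x, hx, rfl⟩ := (key a ha).ge hy
    exact ⟨x, ⟨a, ha, hx⟩, rfl⟩

/-- A local isomorphism whose domain and codomain contain the relevant neighbourhoods witnesses
`SetIso`. -/
theorem LocalIso.setIso [DecidableEq W] {f : V → W} {M : Set V} {N : Set W}
    (h : LocalIso A B f M N) {t : ℕ} {S : Finset V} (hM : A.nbhd t S ⊆ M)
    (hN : B.nbhd t (f '' S) ⊆ N) :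
    SetIso t A S B (S.image f) := by
  refine ⟨f, ?_, by simp⟩
  rw [Finset.coe_image, ← h.image_nbhd hM hN]
  exact h.mono hM

theorem LocalIso.sameNbhd {f : V → W} {M : Set V} {N : Set W} (h : LocalIso A B f M N) {t : ℕ}
    {b : V} (hM : A.ball t b ⊆ M) (hN : B.ball t (f b) ⊆ N) : SameNbhd t A b B (f b) := by
  refine sameNbhd_iff.2 ⟨f, ?_, rfl⟩
  rw [← h.image_ball hM hN]
  exact h.mono hM

theorem SetIso.refl (r : ℕ) (A : RelStr σ V) (S : Finset V) : SetIso r A S A S :=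
  ⟨id, LocalIso.refl A _, by simp⟩

theorem SetIso.trans {r : ℕ} {S : Finset V} {T : Finset W} {U : Finset X}
    (h : SetIso r A S B T) (h' : SetIso r B T E U) : SetIso r A S E U := by
  obtain ⟨f, hf, hS⟩ := h
  obtain ⟨g, hg, hT⟩ := h'
  exact ⟨g ∘ f, hg.comp hf, by rw [Set.image_comp, hS, hT]⟩

theorem SetIso.symm [Nonempty V] {r : ℕ} {S : Finset V} {T : Finset W}
    (h : SetIso r A S B T) : SetIso r B T A S := by
  obtain ⟨f, hf, hS⟩ := h
  obtain ⟨g, hg, hinv⟩ := hf.exists_symm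
  refine ⟨g, hg, ?_⟩
  rw [← hS, ← Set.image_comp]
  exact (Set.image_congr fun x hx => hinv.1 (subset_nbhd r _ hx)).trans (Set.image_id' _)

theorem SetIso.mono {r s : ℕ} (hrs : r ≤ s) {S : Finset V} {T : Finset W}
    (h : SetIso s A S B T) : SetIso r A S B T := by
  obtain ⟨f, hf, hS⟩ := h
  have hT : T = S.image f := by
    apply Finset.coe_injective
    rw [Finset.coe_image, hS]
  rw [hT]
  refine hf.setIso (nbhd_mono hrs _) ?_
  rw [hS]
  exact nbhd_mono hrs _

theorem SameNbhd.symm {r : ℕ} {a : V} {b : W} (h : SameNbhd r A a B b) :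
    SameNbhd r B b A a := by
  obtain ⟨f, hf, rfl⟩ := sameNbhd_iff.1 h
  have : Nonempty V := ⟨a⟩
  obtain ⟨g, hg, hinv⟩ := hf.exists_symm
  exact sameNbhd_iff.2 ⟨g, hg, hinv.1 (A.mem_ball_self r a)⟩

theorem SameNbhd.refl (r : ℕ) (A : RelStr σ V) (a : V) : SameNbhd r A a A a :=
  ⟨Equiv.refl _, fun _ _ => Iff.rfl, rfl⟩

theorem card_eq_of_setIso {r : ℕ} {S : Finset V} {T : Finset W}
    (h : SetIso r A S B T) : S.card = T.card := by
  obtain ⟨f, hf, hS⟩ := h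
  have hT : T = S.image f := by
    apply Finset.coe_injective
    rw [Finset.coe_image, hS]
  rw [hT, Finset.card_image_of_injOn (hf.1.injOn.mono (subset_nbhd r _))]

/-! ### Clusters -/

/-- A non-empty set of diameter at most `k`. -/
def IsCluster (A : RelStr σ V) (k : ℕ) (S : Finset V) : Prop :=
  S.Nonempty ∧ ∀ u ∈ S, ∀ v ∈ S, v ∈ A.ball k u

theorem isCluster_singleton (A : RelStr σ V) (k : ℕ) (u : V) : A.IsCluster k {u} := by
  refine ⟨Finset.singleton_nonempty u, fun v hv w hw => ?_⟩
  rw [Finset.mem_singleton.1 hv, Finset.mem_singleton.1 hw]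
  exact A.mem_ball_self k u

theorem IsCluster.nbhd_subset {k : ℕ} {S : Finset V} (h : A.IsCluster k S) {u : V} (hu : u ∈ S)
    (r : ℕ) : A.nbhd r S ⊆ A.ball (k + r) u :=
  fun _ ⟨_, ha, hb⟩ => mem_ball_trans (h.2 u hu _ ha) hb

theorem IsCluster.subset_ball {k : ℕ} {S : Finset V} (h : A.IsCluster k S) {u : V} (hu : u ∈ S) :
    (S : Set V) ⊆ A.ball k u := fun _ hv => h.2 u hu _ hv

theorem LocalIso.isCluster [DecidableEq W] {f : V → W} {M : Set V} {N : Set W}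
    (h : LocalIso A B f M N) {k : ℕ} {S : Finset V} (hS : A.IsCluster k S) (hM : A.nbhd k S ⊆ M) :
    B.IsCluster k (S.image f) := by
  refine ⟨hS.1.image f, ?_⟩
  simp only [Finset.mem_image]
  rintro _ ⟨u, hu, rfl⟩ _ ⟨v, hv, rfl⟩
  exact h.mapsTo_ball ((ball_subset_nbhd (by exact_mod_cast hu)).trans hM) (hS.2 u hu v hv)

variable [Fintype V] [Fintype W]

/-- The finite set of all clusters. -/
noncomputable def clusters (A : RelStr σ V) (k : ℕ) : Finset (Finset V) :=
  Finset.univ.filter (A.IsCluster k)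

@[simp] theorem mem_clusters {k : ℕ} {S : Finset V} : S ∈ A.clusters k ↔ A.IsCluster k S := by
  simp [clusters]

/-! ### Tuples and boundaries -/

/-- The tuples of all relations. -/
noncomputable def tuples (A : RelStr σ V) : Finset (Σ R, Fin (σ.arity R) → V) :=
  Finset.univ.filter fun p => p.2 ∈ A.rel p.1

@[simp] theorem mem_tuples {p : Σ R, Fin (σ.arity R) → V} : p ∈ A.tuples ↔ p.2 ∈ A.rel p.1 := by
  simp [tuples]

/-- The tuples that meet `S` but are not contained in it. -/
noncomputable def boundary (A : RelStr σ V) (S : Finset V) : Finset (Σ R, Fin (σ.arity R) → V) :=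
  A.tuples.filter fun p => (∃ i, p.2 i ∈ S) ∧ ∃ i, p.2 i ∉ S

theorem mem_boundary {S : Finset V} {p : Σ R, Fin (σ.arity R) → V} :
    p ∈ A.boundary S ↔ p.2 ∈ A.rel p.1 ∧ (∃ i, p.2 i ∈ S) ∧ ∃ i, p.2 i ∉ S := by
  simp [boundary]

theorem sum_ncard_eq_card (Z : (R : Fin σ.numRel) → Set (Fin (σ.arity R) → V)) :
    ∑ R, (Z R).ncard =
      (Finset.univ.filter fun p : Σ R, Fin (σ.arity R) → V => p.2 ∈ Z p.1).card := by
  rw [Finset.card_filter, Fintype.sum_sigma]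
  refine Finset.sum_congr rfl fun R _ => ?_
  rw [Set.ncard_eq_toFinset_card', ← Finset.card_filter]
  congr 1
  ext; simp

theorem elementDegree_eq (A : RelStr σ V) (a : V) :
    A.elementDegree a = (A.tuples.filter fun p => ∃ i, p.2 i = a).card := by
  rw [elementDegree, sum_ncard_eq_card]
  congr 1
  ext p
  simp

theorem card_boundary_le {d : ℕ} (hA : ∀ a, A.elementDegree a ≤ d) (S : Finset V) :
    (A.boundary S).card ≤ d * S.card := by
  have : A.boundary S ⊆ S.biUnion fun a => A.tuples.filter fun p => ∃ i, p.2 i = a := by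
    intro p hp
    obtain ⟨hp, ⟨i, hi⟩, -⟩ := mem_boundary.1 hp
    simp only [Finset.mem_biUnion, Finset.mem_filter, mem_tuples]
    exact ⟨_, hi, hp, i, rfl⟩
  refine (Finset.card_le_card this).trans (Finset.card_biUnion_le.trans ?_)
  rw [mul_comm, ← smul_eq_mul]
  exact Finset.sum_le_card_nsmul _ _ _ fun a _ => (elementDegree_eq A a).symm.trans_le (hA a)

theorem card_boundary_le_of_setIso {r : ℕ} (hr : 1 ≤ r) {S : Finset V} {T : Finset W}
    (h : SetIso r A S B T) : (A.boundary S).card ≤ (B.boundary T).card := by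
  obtain ⟨f, hf, hS⟩ := h
  have hin : ∀ p ∈ A.boundary S, ∀ i, p.2 i ∈ A.nbhd r S := by
    intro p hp i
    obtain ⟨hp, ⟨j, hj⟩, -⟩ := mem_boundary.1 hp
    exact ⟨_, hj, ball_mono hr _ (mem_ball_one_of_mem_rel hp j i)⟩
  have hfS : ∀ v ∈ A.nbhd r S, f v ∈ T ↔ v ∈ S := by
    intro v hv
    have : f v ∈ (T : Set W) ↔ v ∈ S := by
      rw [← hS]
      exact hf.1.injOn.mem_image_iff (subset_nbhd r _) hv
    simpa using this
  refine Finset.card_le_card_of_injOn (fun p => ⟨p.1, f ∘ p.2⟩) (fun p hp => ?_) ?_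
  · have hp' := hin p hp
    obtain ⟨h1, ⟨i, hi⟩, ⟨j, hj⟩⟩ := mem_boundary.1 hp
    refine mem_boundary.2 ⟨(hf.2 p.1 p.2 hp').1 h1, ⟨i, ?_⟩, ⟨j, ?_⟩⟩
    · exact (hfS _ (hp' i)).2 hi
    · exact fun hc => hj ((hfS _ (hp' j)).1 hc)
  · rintro ⟨R, s⟩ hp ⟨R', s'⟩ hq heq
    have h1 := hin _ hp
    have h2 := hin _ hq
    simp only [Sigma.mk.injEq] at heq
    obtain ⟨rfl, heq⟩ := heq
    have heq := eq_of_heq heq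
    have : s = s' := funext fun i => hf.1.injOn (h1 i) (h2 i) (congrFun heq i)
    rw [this]

theorem card_boundary_eq_of_setIso {r : ℕ} (hr : 1 ≤ r) {S : Finset V} {T : Finset W}
    (h : SetIso r A S B T) : (A.boundary S).card = (B.boundary T).card := by
  cases isEmpty_or_nonempty V with
  | inl hV =>
    obtain ⟨f, hf, hS⟩ := h
    have hS0 : S = ∅ := Subsingleton.elim _ _
    have hT0 : T = ∅ := by
      apply Finset.coe_injective
      rw [← hS, hS0]
      simp
    subst hS0 hT0
    simp [boundary]
  | inr hV =>
    exact (card_boundary_le_of_setIso hr h).antisymm (card_boundary_le_of_setIso hr h.symm)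

/-! ### Bounds on the number of elements and clusters nearby -/

/-- The largest arity of a relation name. -/
def _root_.Schema.maxArity (σ : Schema) : ℕ := Finset.univ.sup σ.arity

theorem _root_.Schema.arity_le (R : Fin σ.numRel) : σ.arity R ≤ σ.maxArity :=
  Finset.le_sup (f := σ.arity) (Finset.mem_univ R)

/-- An upper bound for the number of elements of a ball of radius `r`, for degree at most `d`. -/
def _root_.Schema.ballBound (σ : Schema) (d r : ℕ) : ℕ := (d * σ.maxArity + 1) ^ r

theorem ncard_ball_le {d : ℕ} (hA : ∀ a, A.elementDegree a ≤ d) (r : ℕ) (a : V) :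
    (A.ball r a).ncard ≤ σ.ballBound d r := by
  rw [Set.ncard_eq_toFinset_card']
  induction r with
  | zero =>
    have : (A.ball 0 a).toFinset = {a} := by ext; simp [mem_ball_zero]
    rw [this]
    simp [Schema.ballBound]
  | succ r ih =>
    let N : V → Finset V := fun c => insert c
      ((A.tuples.filter fun p => ∃ i, p.2 i = c).biUnion fun p => Finset.univ.image p.2)
    have hN : ∀ c, (N c).card ≤ d * σ.maxArity + 1 := by
      intro c
      refine (Finset.card_insert_le _ _).trans (Nat.add_le_add_right ?_ 1)
      refine Finset.card_biUnion_le.trans ((Finset.sum_le_card_nsmul _ _ σ.maxArity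
        fun p _ => ?_).trans ?_)
      · exact (Finset.card_image_le.trans (by simp)).trans (Schema.arity_le p.1)
      · rw [smul_eq_mul, ← elementDegree_eq]
        exact Nat.mul_le_mul_right _ (hA c)
    have hsub : (A.ball (r + 1) a).toFinset ⊆ (A.ball r a).toFinset.biUnion N := by
      intro b hb
      obtain ⟨c, hc, h⟩ := mem_ball_succ.1 (Set.mem_toFinset.1 hb)
      simp only [Finset.mem_biUnion, Set.mem_toFinset]
      refine ⟨c, hc, ?_⟩
      rcases h with rfl | ⟨-, R, t, ht, hc', ⟨j, rfl⟩⟩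
      · exact Finset.mem_insert_self _ _
      · refine Finset.mem_insert_of_mem (Finset.mem_biUnion.2 ⟨⟨R, t⟩, ?_, ?_⟩)
        · simpa [ht] using hc'
        · simp
    refine (Finset.card_le_card hsub).trans (Finset.card_biUnion_le.trans
      ((Finset.sum_le_card_nsmul _ _ _ fun c _ => hN c).trans ?_))
    rw [smul_eq_mul, Schema.ballBound, pow_succ]
    exact Nat.mul_le_mul_right _ ih

theorem IsCluster.card_le {d k : ℕ} (hA : ∀ a, A.elementDegree a ≤ d) {S : Finset V}
    (hS : A.IsCluster k S) : S.card ≤ σ.ballBound d k := by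
  obtain ⟨u, hu⟩ := hS.1
  rw [← Set.ncard_coe_finset]
  exact (Set.ncard_le_ncard (hS.subset_ball hu) (Set.toFinite _)).trans (ncard_ball_le hA k u)

theorem card_clusters_mem_le [DecidableEq V] {d k : ℕ} (hA : ∀ a, A.elementDegree a ≤ d) (u : V) :
    ((A.clusters k).filter (u ∈ ·)).card ≤ 2 ^ σ.ballBound d k := by
  have hsub : (A.clusters k).filter (u ∈ ·) ⊆ (A.ball k u).toFinset.powerset := by
    intro S hS
    simp only [Finset.mem_filter, mem_clusters] at hS
    rw [Finset.mem_powerset]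
    intro v hv
    simpa using hS.1.subset_ball hS.2 hv
  refine (Finset.card_le_card hsub).trans ?_
  rw [Finset.card_powerset, ← Set.ncard_eq_toFinset_card']
  exact Nat.pow_le_pow_right two_pos (ncard_ball_le hA k u)

theorem card_clusters_le {d k : ℕ} (hA : ∀ a, A.elementDegree a ≤ d) :
    (A.clusters k).card ≤ Fintype.card V * 2 ^ σ.ballBound d k := by
  have hsub : A.clusters k ⊆ Finset.univ.biUnion fun u => (A.clusters k).filter (u ∈ ·) := by
    intro S hS
    obtain ⟨u, hu⟩ := (mem_clusters.1 hS).1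
    simp only [Finset.mem_biUnion, Finset.mem_univ, true_and, Finset.mem_filter]
    exact ⟨u, hS, hu⟩
  refine (Finset.card_le_card hsub).trans (Finset.card_biUnion_le.trans
    ((Finset.sum_le_card_nsmul _ _ _ fun u _ => card_clusters_mem_le hA u).trans ?_))
  simp

/-- Summation over clusters containing an element is a local operation. -/
theorem sum_clusters_le_of_sameNbhd [DecidableEq V] [DecidableEq W] {r k Q : ℕ}
    (hQ : k + Q ≤ r) (hk : k ≤ Q) {u : V} {u' : W} (h : SameNbhd r A u B u')
    {F : Finset V → ℝ} {G : Finset W → ℝ} (hG : ∀ T, 0 ≤ G T)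
    (hFG : ∀ S T, SetIso Q A S B T → F S ≤ G T) :
    ∑ S ∈ (A.clusters k).filter (u ∈ ·), F S ≤ ∑ T ∈ (B.clusters k).filter (u' ∈ ·), G T := by
  obtain ⟨f, hf, rfl⟩ := sameNbhd_iff.1 h
  have hball : ∀ S ∈ (A.clusters k).filter (u ∈ ·), A.nbhd Q S ⊆ A.ball r u := by
    intro S hS
    simp only [Finset.mem_filter, mem_clusters] at hS
    exact (hS.1.nbhd_subset hS.2 Q).trans (ball_mono hQ u)
  have hmem : ∀ S ∈ (A.clusters k).filter (u ∈ ·),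
      S.image f ∈ (B.clusters k).filter (f u ∈ ·) := by
    intro S hS
    have hS' := hball S hS
    simp only [Finset.mem_filter, mem_clusters] at hS ⊢
    exact ⟨hf.isCluster hS.1 ((nbhd_mono hk _).trans hS'), Finset.mem_image_of_mem f hS.2⟩
  have hball' : ∀ S ∈ (A.clusters k).filter (u ∈ ·), B.nbhd Q (f '' S) ⊆ B.ball r (f u) := by
    intro S hS
    have hS' := hmem S hS
    simp only [Finset.mem_filter, mem_clusters] at hS'
    have := (hS'.1.nbhd_subset hS'.2 Q).trans (ball_mono hQ _)
    rwa [Finset.coe_image] at this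
  have hinj : Set.InjOn (fun S : Finset V => S.image f)
      ((A.clusters k).filter (u ∈ ·) : Finset (Finset V)) := by
    intro S hS T hT hST
    have h1 := (subset_nbhd Q _).trans (hball S hS)
    have h2 := (subset_nbhd Q _).trans (hball T hT)
    have hST : f '' S = f '' T := by
      rw [← Finset.coe_image, ← Finset.coe_image]
      exact congrArg _ hST
    exact_mod_cast (hf.1.injOn.image_eq_image_iff h1 h2).1 hST
  calc ∑ S ∈ (A.clusters k).filter (u ∈ ·), F S
      ≤ ∑ S ∈ (A.clusters k).filter (u ∈ ·), G (S.image f) :=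
        Finset.sum_le_sum fun S hS => hFG S _ (hf.setIso (hball S hS) (hball' S hS))
    _ = ∑ T ∈ ((A.clusters k).filter (u ∈ ·)).image (fun S => S.image f), G T :=
        (Finset.sum_image hinj).symm
    _ ≤ _ := Finset.sum_le_sum_of_subset_of_nonneg
        (Finset.image_subset_iff.2 hmem) fun T _ _ => hG T

theorem sum_clusters_eq_of_sameNbhd [DecidableEq V] [DecidableEq W] {r k Q : ℕ}
    (hQ : k + Q ≤ r) (hk : k ≤ Q) {u : V} {u' : W} (h : SameNbhd r A u B u')
    {F : Finset V → ℝ} {G : Finset W → ℝ} (hF : ∀ S, 0 ≤ F S)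
    (hG : ∀ T, 0 ≤ G T) (hFG : ∀ S T, SetIso Q A S B T → F S = G T) :
    ∑ S ∈ (A.clusters k).filter (u ∈ ·), F S = ∑ T ∈ (B.clusters k).filter (u' ∈ ·), G T := by
  have : Nonempty V := ⟨u⟩
  have : Nonempty W := ⟨u'⟩
  exact (sum_clusters_le_of_sameNbhd hQ hk h hG fun S T hST => (hFG S T hST).le).antisymm
    (sum_clusters_le_of_sameNbhd hQ hk h.symm hF fun T S hTS => (hFG S T hTS.symm).ge)

end RelStr

/-! ### Finiteness of the set of types -/

namespace RelStr

variable {σ : Schema} {V W : Type}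

instance finite_relStr [Finite V] : Finite (RelStr σ V) :=
  Finite.of_injective (fun A : RelStr σ V => A.rel) fun _ _ h => RelStr.ext h

/-- Structures with domain `Fin m` for some `m ≤ K`; they serve as names for the isomorphism types
of structures with at most `K` elements. -/
def Code (σ : Schema) (K : ℕ) : Type := Σ m : Fin (K + 1), RelStr σ (Fin m)

instance (σ : Schema) (K : ℕ) : Finite (Code σ K) :=
  inferInstanceAs (Finite (Σ m : Fin (K + 1), RelStr σ (Fin m)))

noncomputable instance (σ : Schema) (K : ℕ) : Fintype (Code σ K) := Fintype.ofFinite _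

instance (σ : Schema) (K : ℕ) : Nonempty (Code σ K) := ⟨⟨0, ⟨fun _ => ∅⟩⟩⟩

/-- A code for the isomorphism type of the substructure of `A` induced by `S`. The choice operator
is applied to a predicate that depends on the isomorphism type only, so that isomorphic
substructures have equal codes. -/
noncomputable def code (K : ℕ) (A : RelStr σ V) (S : Finset V) : Code σ K :=
  Classical.epsilon fun c : Code σ K => SetIso 0 c.2 Finset.univ A S

theorem setIso_code {K : ℕ} (A : RelStr σ V) {S : Finset V} (hK : S.card ≤ K) :
    SetIso 0 (code K A S).2 Finset.univ A S := by
  refine Classical.epsilon_spec (p := fun c : Code σ K => SetIso 0 c.2 Finset.univ A S) ?_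
  have e : Fin S.card ≃ S := S.equivFin.symm
  refine ⟨⟨⟨S.card, Nat.lt_succ_of_le hK⟩, A.comap fun i => (e i : V)⟩, fun i => (e i : V), ?_, ?_⟩
  · simp only [nbhd_zero]
    refine ⟨⟨fun i _ => (e i).2, fun i _ j _ h => e.injective (Subtype.ext h), fun v hv => ?_⟩,
      fun R t _ => Iff.rfl⟩
    exact ⟨e.symm ⟨v, hv⟩, by simp, by simp⟩
  · ext v
    simp only [Finset.coe_univ, Set.image_univ, Set.mem_range, Finset.mem_coe]
    exact ⟨fun ⟨i, hi⟩ => hi ▸ (e i).2, fun hv => ⟨e.symm ⟨v, hv⟩, by simp⟩⟩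

theorem code_eq_of_setIso {K : ℕ} {A : RelStr σ V} {B : RelStr σ W} {S : Finset V} {T : Finset W}
    (hS : S.Nonempty) (h : SetIso 0 A S B T) : code K A S = code K B T := by
  have : Nonempty V := ⟨hS.choose⟩
  unfold code
  congr 1
  ext c
  exact ⟨fun hc => hc.trans h, fun hc => hc.trans h.symm⟩

theorem card_code {K : ℕ} (A : RelStr σ V) {S : Finset V} (hK : S.card ≤ K) :
    ((code K A S).1 : ℕ) = S.card := by
  have := card_eq_of_setIso (setIso_code A hK)
  simpa using this

theorem setIso_of_code_eq {K : ℕ} {A : RelStr σ V} {B : RelStr σ W} {S : Finset V} {T : Finset W}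
    (hS : S.Nonempty) (hSK : S.card ≤ K) (hTK : T.card ≤ K)
    (h : code K A S = code K B T) : SetIso 0 A S B T := by
  have : Nonempty (Fin (code K A S).1) := by
    rw [← Fin.pos_iff_nonempty, card_code A hSK]
    exact hS.card_pos
  have h1 := setIso_code B hTK
  rw [← h] at h1
  exact (setIso_code A hSK).symm.trans h1

end RelStr

namespace Database

variable {σ : Schema} {d r : ℕ}

theorem elementDegree_le {D : Database σ} (hD : D.degree ≤ d) (a : Fin D.size) :
    D.str.elementDegree a ≤ d :=
  (Finset.le_sup (f := D.str.elementDegree) (Finset.mem_univ a)).trans hD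

/-- The `r`-type of an element. -/
def typeOf (r : ℕ) (D : Database σ) (hD : D.degree ≤ d) (a : Fin D.size) : NbhdType σ d r :=
  Quotient.mk (nbhdSetoid σ d r) ⟨D, hD, a⟩

theorem typeOf_eq_iff {D E : Database σ} (hD : D.degree ≤ d) (hE : E.degree ≤ d) {a : Fin D.size}
    {b : Fin E.size} :
    D.typeOf r hD a = E.typeOf r hE b ↔ RelStr.SameNbhd r D.str a E.str b :=
  Quotient.eq (r := nbhdSetoid σ d r)

theorem hasType_iff {D : Database σ} (hD : D.degree ≤ d) {a : Fin D.size} {τ : NbhdType σ d r} :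
    HasType D a τ ↔ D.typeOf r hD a = τ := by
  constructor
  · rintro ⟨x, rfl, hx⟩
    exact Quotient.sound (s := nbhdSetoid σ d r) hx
  · rintro rfl
    exact ⟨⟨D, hD, a⟩, rfl, RelStr.SameNbhd.refl r _ a⟩

end Database

instance finite_nbhdType (σ : Schema) (d r : ℕ) : Finite (NbhdType σ d r) := by
  -- Pointed structures on an initial segment of bounded length name all types.
  let C := Σ m : Fin (σ.ballBound d r + 1), RelStr σ (Fin m) × Fin m
  have hex : ∀ x : PointedDatabase σ d, ∃ c : C,
      ∃ e : Fin c.1 ≃ x.db.str.ball r x.point,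
        c.2.1.IsIso (x.db.str.induce _) e ∧ e c.2.2 = ⟨x.point, RelStr.mem_ball_self _ _ _⟩ := by
    intro x
    have hcard : Nat.card (x.db.str.ball r x.point) ≤ σ.ballBound d r :=
      RelStr.ncard_ball_le (Database.elementDegree_le x.degree_le) r x.point
    let e := (Finite.equivFin (x.db.str.ball r x.point)).symm
    exact ⟨⟨⟨_, Nat.lt_succ_of_le hcard⟩, (x.db.str.induce _).comap e,
      e.symm ⟨x.point, RelStr.mem_ball_self _ _ _⟩⟩, e, fun _ _ => Iff.rfl, e.apply_symm_apply _⟩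
  choose c hc using hex
  refine Finite.of_injective (fun q : NbhdType σ d r => c (Quotient.out q)) fun p q hpq => ?_
  obtain ⟨e, he, hep⟩ := hc (Quotient.out p)
  have hq := hc (Quotient.out q)
  rw [← (show c (Quotient.out p) = c (Quotient.out q) from hpq)] at hq
  obtain ⟨f, hf, hfq⟩ := hq
  rw [← Quotient.out_eq p, ← Quotient.out_eq q]
  refine Quotient.sound (s := nbhdSetoid σ d r) ⟨e.symm.trans f, fun R t => ?_, ?_⟩
  · have h1 := he R (e.symm ∘ t)
    rw [← Function.comp_assoc, Equiv.self_comp_symm, Function.id_comp] at h1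
    exact h1.symm.trans (hf R _)
  · rw [Equiv.trans_apply, ← hep, Equiv.symm_apply_apply, hfq]

noncomputable instance (σ : Schema) (d r : ℕ) : Fintype (NbhdType σ d r) := Fintype.ofFinite _

section Transfer

variable {σ : Schema} {d r : ℕ}

theorem histogram_eq {D : Database σ} (hD : D.degree ≤ d) (τ : NbhdType σ d r) :
    histogram d r D τ = (Finset.univ.filter fun a => D.typeOf r hD a = τ).card := by
  rw [histogram, Set.ncard_eq_toFinset_card']
  congr 1
  ext a
  simp [Database.hasType_iff hD]

theorem sum_typeOf {D : Database σ} (hD : D.degree ≤ d) (g : NbhdType σ d r → ℝ) :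
    ∑ a, g (D.typeOf r hD a) = ∑ τ, histogram d r D τ * g τ := by
  simp_rw [histogram_eq hD]
  rw [← Finset.sum_fiberwise (s := Finset.univ) (g := fun a => D.typeOf r hD a)]
  refine Finset.sum_congr rfl fun τ _ => ?_
  rw [Finset.sum_congr rfl (g := fun _ => g τ) (fun a ha => by rw [(Finset.mem_filter.1 ha).2])]
  simp

/-- The `ℓ¹`-distance of the `r`-histograms. -/
noncomputable def histDist (d r : ℕ) (D E : Database σ) : ℝ :=
  ∑ τ : NbhdType σ d r, |(histogram d r D τ : ℝ) - histogram d r E τ|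

/-- Sums of bounded local quantities are determined by the histogram up to a small error. -/
theorem abs_sum_sub_sum_le {D E : Database σ} (hD : D.degree ≤ d) (hE : E.degree ≤ d)
    (Ψ : ∀ F : Database σ, Fin F.size → ℝ) {c : ℝ}
    (hΨ : ∀ F F' : Database σ, F.degree ≤ d → F'.degree ≤ d → ∀ a b,
      RelStr.SameNbhd r F.str a F'.str b → Ψ F a = Ψ F' b)
    (hc : ∀ F : Database σ, F.degree ≤ d → ∀ a, |Ψ F a| ≤ c) :
    |∑ a, Ψ D a - ∑ b, Ψ E b| ≤ c * histDist d r D E := by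
  let g : NbhdType σ d r → ℝ := Quotient.lift (s := nbhdSetoid σ d r)
    (fun x : PointedDatabase σ d => Ψ x.db x.point)
    fun x y hxy => hΨ _ _ x.degree_le y.degree_le _ _ hxy
  have hg : ∀ τ, |g τ| ≤ c := fun τ => Quotient.ind (s := nbhdSetoid σ d r)
    (motive := fun τ => |g τ| ≤ c) (fun x => hc _ x.degree_le _) τ
  have h1 : ∑ a, Ψ D a = ∑ τ, histogram d r D τ * g τ := sum_typeOf hD g
  have h2 : ∑ a, Ψ E a = ∑ τ, histogram d r E τ * g τ := sum_typeOf hE g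
  rw [h1, h2, ← Finset.sum_sub_distrib, histDist, Finset.mul_sum]
  refine (Finset.abs_sum_le_sum_abs _ _).trans (Finset.sum_le_sum fun τ _ => ?_)
  rw [← sub_mul, abs_mul, mul_comm]
  exact mul_le_mul_of_nonneg_right (hg τ) (abs_nonneg _)

theorem sum_histogram {D : Database σ} (hD : D.degree ≤ d) :
    ∑ τ : NbhdType σ d r, (histogram d r D τ : ℝ) = D.size := by
  have := sum_typeOf (r := r) hD fun _ => 1
  simpa using this.symm

theorem abs_size_sub_size_le {D E : Database σ} (hD : D.degree ≤ d) (hE : E.degree ≤ d) :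
    |(D.size : ℝ) - E.size| ≤ histDist d r D E := by
  rw [← sum_histogram (r := r) hD, ← sum_histogram (r := r) hE, ← Finset.sum_sub_distrib]
  exact Finset.abs_sum_le_sum_abs _ _

end Transfer

/-! ### Bounding the distance of two databases -/

section DistBound

variable {σ : Schema}

theorem ModifiesIn.trans {k l : ℕ} {D E F : Database σ} (h : ModifiesIn k D E)
    (h' : ModifiesIn l E F) : ModifiesIn (k + l) D F := by
  induction k generalizing D with
  | zero =>
    obtain rfl : D = E := h
    rwa [Nat.zero_add]
  | succ k ih =>
    obtain ⟨G, hG, hGE⟩ := h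
    rw [Nat.succ_add]
    exact ⟨G, hG, ih hGE⟩

namespace RelStr

/-- Remove the tuples in `X`. -/
def eraseTuples {V : Type} (A : RelStr σ V) (X : Finset (Σ R, Fin (σ.arity R) → V)) :
    RelStr σ V where
  rel R := {t ∈ A.rel R | (⟨R, t⟩ : Σ R, Fin (σ.arity R) → V) ∉ X}

theorem modifiesIn_eraseTuples {n : ℕ} (A : RelStr σ (Fin n))
    (X : Finset (Σ R, Fin (σ.arity R) → Fin n)) (hX : X ⊆ A.tuples) :
    ModifiesIn X.card (⟨n, A⟩ : Database σ) ⟨n, A.eraseTuples X⟩ := by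
  induction X using Finset.induction_on with
  | empty =>
    have : A.eraseTuples ∅ = A := by ext; simp [eraseTuples]
    rw [this]
    rfl
  | insert p X hp ih =>
    rw [Finset.card_insert_of_notMem hp]
    refine (ih ((Finset.subset_insert _ _).trans hX)).trans ?_
    have hmem : p.2 ∈ (A.eraseTuples X).rel p.1 :=
      ⟨mem_tuples.1 (hX (Finset.mem_insert_self p X)), hp⟩
    refine ⟨_, Modification.deleteTuple (A.eraseTuples X) p.1 p.2 hmem, ?_⟩
    have : (A.eraseTuples X).removeTuple p.1 p.2 = A.eraseTuples (insert p X) := by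
      obtain ⟨R, s⟩ := p
      ext R' t
      by_cases hR : R' = R
      · subst hR
        simp [removeTuple, eraseTuples, and_assoc, and_comm]
      · simp [removeTuple, eraseTuples, hR]
    rw [this]
    rfl

theorem exists_modifiesIn_comap {n : ℕ} (A : RelStr σ (Fin n)) (U : Finset (Fin n)) :
    ∃ (m : ℕ) (h : Fin m ↪ Fin n), Set.range h = U ∧
      ModifiesIn Uᶜ.card (⟨n, A⟩ : Database σ) ⟨m, A.comap h⟩ := by
  induction hj : Uᶜ.card generalizing n with
  | zero =>
    rw [Finset.card_eq_zero, Finset.compl_eq_empty_iff] at hj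
    exact ⟨n, Function.Embedding.refl _, by rw [hj, Finset.coe_univ]; exact Set.range_id, rfl⟩
  | succ j ih =>
    obtain ⟨x, hx⟩ : Uᶜ.Nonempty := by
      rw [← Finset.card_pos]
      omega
    obtain ⟨n, rfl⟩ : ∃ n', n = n' + 1 := ⟨n - 1, by have := x.pos; omega⟩
    have hxU : x ∉ U := Finset.mem_compl.1 hx
    let f : Fin n ↪ Fin (n + 1) := x.succAboveEmb
    have hfx : ∀ y, y ≠ x → ∃ i, f i = y := fun y hy => Fin.exists_succAbove_eq hy
    let U₀ : Finset (Fin n) := Finset.univ.filter fun i => f i ∈ U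
    have hU : U₀.map f = U := by
      ext y
      simp only [U₀, Finset.mem_map, Finset.mem_filter, Finset.mem_univ, true_and]
      constructor
      · rintro ⟨i, hi, rfl⟩; exact hi
      · intro hy
        obtain ⟨i, rfl⟩ := hfx y (fun h => hxU (h ▸ hy))
        exact ⟨i, hy, rfl⟩
    have hc : U₀ᶜ.card = j := by
      have h1 : U₀.card = U.card := by rw [← hU, Finset.card_map]
      have h2 := Finset.card_add_card_compl U
      have h3 := Finset.card_add_card_compl U₀
      simp only [Fintype.card_fin] at h2 h3
      omega
    obtain ⟨m, h, hh, hmod⟩ := ih (A.comap f) U₀ hc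
    refine ⟨m, h.trans f, ?_, ?_⟩
    · rw [Function.Embedding.coe_trans, Set.range_comp, hh, ← hU, Finset.coe_map]
    · exact ⟨_, Modification.deleteElement A f, hmod⟩

end RelStr

open RelStr in
/-- A partial bijection between two databases that preserves and reflects all tuples outside `X`
and `Y` bounds their distance. -/
theorem distPM_le {D E : Database σ} {f : Fin D.size → Fin E.size} {U : Finset (Fin D.size)}
    {U' : Finset (Fin E.size)} (hf : Set.BijOn f U U')
    {X : Finset (Σ R, Fin (σ.arity R) → Fin D.size)}
    {Y : Finset (Σ R, Fin (σ.arity R) → Fin E.size)} (hX : X ⊆ D.str.tuples)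
    (hY : Y ⊆ E.str.tuples)
    (h : ∀ R (t : Fin (σ.arity R) → Fin D.size), (∀ i, t i ∈ U) →
      (t ∈ (D.str.eraseTuples X).rel R ↔ f ∘ t ∈ (E.str.eraseTuples Y).rel R)) :
    distPM D E ≤ (X.card + Uᶜ.card) + (Y.card + U'ᶜ.card) := by
  obtain ⟨m, g, hg, hD⟩ := exists_modifiesIn_comap (D.str.eraseTuples X) U
  obtain ⟨m', g', hg', hE⟩ := exists_modifiesIn_comap (E.str.eraseTuples Y) U'
  refine Nat.sInf_le ⟨_, _, rfl, _, _, (modifiesIn_eraseTuples D.str X hX).trans hD,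
    (modifiesIn_eraseTuples E.str Y hY).trans hE, ?_⟩
  have hgU : ∀ i, g i ∈ U := fun i => by
    have : g i ∈ Set.range g := ⟨i, rfl⟩
    rw [hg] at this
    exact this
  have hgU' : ∀ i, g' i ∈ U' := fun i => by
    have : g' i ∈ Set.range g' := ⟨i, rfl⟩
    rw [hg'] at this
    exact this
  have hex : ∀ i, ∃ j, g' j = f (g i) := fun i => by
    have : f (g i) ∈ (U' : Set _) := hf.mapsTo (hgU i)
    rwa [← hg'] at this
  choose e he using hex
  have hbij : Function.Bijective e := by
    constructor
    · intro i j hij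
      have : f (g i) = f (g j) := by rw [← he, ← he, hij]
      exact g.injective (hf.injOn (hgU i) (hgU j) this)
    · intro j
      obtain ⟨u, hu, huj⟩ := hf.surjOn (hgU' j)
      rw [← hg] at hu
      obtain ⟨i, rfl⟩ := hu
      exact ⟨i, g'.injective ((he i).trans huj)⟩
  refine ⟨Equiv.ofBijective e hbij, fun R t => ?_⟩
  refine (h R (g ∘ t) fun i => hgU _).trans (iff_of_eq (congrArg (· ∈ _) ?_))
  funext i
  exact (he (t i)).symm

end DistBound

/-! ### Averages over classes -/

section ClassAvg

variable {X : Type*}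

/-- The average of `f` over the elements of `s` that satisfy `p` (and `0` if there are none). -/
noncomputable def classAvg (s : Finset X) (p : X → Prop) (f : X → ℝ) : ℝ :=
  (∑ y ∈ s.filter p, f y) / (s.filter p).card

theorem classAvg_nonneg {s : Finset X} {p : X → Prop} {f : X → ℝ} (hf : ∀ x, 0 ≤ f x) :
    0 ≤ classAvg s p f :=
  div_nonneg (Finset.sum_nonneg fun _ _ => hf _) (Nat.cast_nonneg _)

theorem classAvg_le_one {s : Finset X} {p : X → Prop} {f : X → ℝ} (hf : ∀ x, f x ≤ 1) :
    classAvg s p f ≤ 1 := by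
  refine div_le_one_of_le₀ ((Finset.sum_le_card_nsmul _ _ 1 fun x _ => hf x).trans ?_)
    (Nat.cast_nonneg _)
  simp

/-- `r` is an equivalence relation on `s`. -/
structure EquivOn (s : Finset X) (r : X → X → Prop) : Prop where
  refl : ∀ x ∈ s, r x x
  symm : ∀ x ∈ s, ∀ y ∈ s, r x y → r y x
  trans : ∀ x ∈ s, ∀ y ∈ s, ∀ z ∈ s, r x y → r y z → r x z

variable {s : Finset X} {r : X → X → Prop} {f : X → ℝ}

theorem EquivOn.filter_eq (h : EquivOn s r) {x y : X} (hx : x ∈ s) (hy : y ∈ s) (hxy : r x y) :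
    s.filter (r x) = s.filter (r y) := by
  ext z
  simp only [Finset.mem_filter, and_congr_right_iff]
  exact fun hz => ⟨fun hxz => h.trans y hy x hx z hz (h.symm x hx y hy hxy) hxz,
    fun hyz => h.trans x hx y hy z hz hxy hyz⟩

/-- Averaging over the classes of `r` does not change the inner product with a function that is
constant on these classes: it is the orthogonal projection to the space of such functions. -/
theorem sum_classAvg_mul (h : EquivOn s r) {g : X → ℝ}
    (hg : ∀ x ∈ s, ∀ y ∈ s, r x y → g x = g y) :
    ∑ x ∈ s, classAvg s (r x) f * g x = ∑ x ∈ s, f x * g x := by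
  have h1 : ∀ x ∈ s, classAvg s (r x) f * g x =
      ∑ y ∈ s, if r x y then f y * g y / (s.filter (r y)).card else 0 := by
    intro x hx
    rw [← Finset.sum_filter, classAvg, div_mul_eq_mul_div, Finset.sum_mul, Finset.sum_div]
    refine Finset.sum_congr rfl fun y hy => ?_
    obtain ⟨hy, hxy⟩ := Finset.mem_filter.1 hy
    rw [hg x hx y hy hxy, h.filter_eq hx hy hxy]
  rw [Finset.sum_congr rfl h1, Finset.sum_comm]
  refine Finset.sum_congr rfl fun y hy => ?_
  have h2 : s.filter (fun x => r x y) = s.filter (r y) := by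
    ext z
    simp only [Finset.mem_filter, and_congr_right_iff]
    exact fun hz => ⟨h.symm z hz y hy, h.symm y hy z hz⟩
  rw [← Finset.sum_filter, h2, Finset.sum_const, nsmul_eq_mul, mul_div_cancel₀]
  rw [Nat.cast_ne_zero, ← Nat.pos_iff_ne_zero, Finset.card_pos]
  exact ⟨y, Finset.mem_filter.2 ⟨hy, h.refl y hy⟩⟩

theorem classAvg_congr (h : EquivOn s r) : ∀ x ∈ s, ∀ y ∈ s, r x y →
    classAvg s (r x) f = classAvg s (r y) f := fun x hx y hy hxy => by
  rw [classAvg, h.filter_eq hx hy hxy, classAvg]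

/-- Orthogonality of the averages over the classes of two nested equivalence relations. -/
theorem sum_sq_classAvg_sub {r' : X → X → Prop} (h : EquivOn s r) (h' : EquivOn s r')
    (hrr' : ∀ x y, r' x y → r x y) :
    ∑ x ∈ s, (classAvg s (r' x) f - classAvg s (r x) f) ^ 2 =
      ∑ x ∈ s, classAvg s (r' x) f ^ 2 - ∑ x ∈ s, classAvg s (r x) f ^ 2 := by
  have h1 : ∑ x ∈ s, classAvg s (r' x) f * classAvg s (r x) f =
      ∑ x ∈ s, f x * classAvg s (r x) f :=
    sum_classAvg_mul h' fun x hx y hy hxy => classAvg_congr h x hx y hy (hrr' x y hxy)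
  have h2 : ∑ x ∈ s, classAvg s (r x) f * classAvg s (r x) f =
      ∑ x ∈ s, f x * classAvg s (r x) f :=
    sum_classAvg_mul h (classAvg_congr h)
  have h3 : ∀ x, (classAvg s (r' x) f - classAvg s (r x) f) ^ 2 = classAvg s (r' x) f ^ 2 -
      2 * (classAvg s (r' x) f * classAvg s (r x) f) +
      classAvg s (r x) f * classAvg s (r x) f := fun x => by ring
  simp only [h3, Finset.sum_add_distrib, Finset.sum_sub_distrib, ← Finset.mul_sum, h1, h2]
  simp only [pow_two, h2]
  ring

theorem sum_sq_classAvg_le (h : EquivOn s r) (hf0 : ∀ x, 0 ≤ f x) (hf1 : ∀ x, f x ≤ 1) :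
    ∑ x ∈ s, classAvg s (r x) f ^ 2 ≤ ∑ x ∈ s, f x := by
  simp only [pow_two]
  rw [sum_classAvg_mul h (classAvg_congr h)]
  exact Finset.sum_le_sum fun x _ => mul_le_of_le_one_right (hf0 x) (classAvg_le_one hf1)

/-- A bounded sequence makes a small step. -/
theorem exists_small_increment {e : ℕ → ℝ} {c η : ℝ} (J : ℕ) (h0 : 0 ≤ e 0) (hJ : e J ≤ c)
    (hc : c ≤ J * η) (hpos : 0 < J) : ∃ j < J, e (j + 1) - e j ≤ η := by
  by_contra! hcon
  have h1 : ∑ j ∈ Finset.range J, η < ∑ j ∈ Finset.range J, (e (j + 1) - e j) :=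
    Finset.sum_lt_sum_of_nonempty (Finset.nonempty_range_iff.2 hpos.ne')
      fun j hj => hcon j (Finset.mem_range.1 hj)
  rw [Finset.sum_range_sub, Finset.sum_const, Finset.card_range, nsmul_eq_mul] at h1
  linarith

end ClassAvg

/-! ### Uniformly random labels -/

section RandomLabels

open Finset

variable {I J X : Type*} [Fintype I] [Fintype J] [Fintype X] [DecidableEq I] [DecidableEq J]

/-- `x` is the strict minimum of the labelling `ω` on `L`. -/
def StrictMin {I X : Type*} [LinearOrder X] (L : Finset I) (ω : I → X) (x : I) : Prop :=
  x ∈ L ∧ ∀ y ∈ L, y ≠ x → ω x < ω y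

theorem StrictMin.unique {I X : Type*} [LinearOrder X] {L : Finset I} {ω : I → X} {x y : I}
    (hx : StrictMin L ω x) (hy : StrictMin L ω y) : x = y := by
  by_contra h
  exact lt_asymm (hx.2 y hy.1 (Ne.symm h)) (hy.2 x hx.1 h)

/-- The variance of a sum of `[0, 1]`-valued variables is at most the number of dependent pairs. -/
theorem expect_sq_sub_le {Ω ι : Type*} [Fintype Ω] [Nonempty Ω] [Fintype ι] (Y : ι → Ω → ℝ)
    (dep : ι → ι → Prop) (h0 : ∀ i ω, 0 ≤ Y i ω) (h1 : ∀ i ω, Y i ω ≤ 1)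
    (hdep : ∀ i j, ¬ dep i j → 𝔼 ω, Y i ω * Y j ω = (𝔼 ω, Y i ω) * 𝔼 ω, Y j ω) :
    𝔼 ω, (∑ i, Y i ω - ∑ i, 𝔼 ω', Y i ω') ^ 2 ≤
      ∑ i, ((univ.filter (dep i)).card : ℝ) := by
  have hμ : ∀ i, 0 ≤ 𝔼 ω, Y i ω := fun i => expect_nonneg fun ω _ => h0 i ω
  have hsq : ∀ ω, (∑ i, Y i ω - ∑ i, 𝔼 ω', Y i ω') ^ 2 =
      ∑ i, ∑ j, (Y i ω - 𝔼 ω', Y i ω') * (Y j ω - 𝔼 ω', Y j ω') := fun ω => by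
    rw [← sum_sub_distrib, pow_two, sum_mul_sum]
  simp only [hsq]
  rw [expect_sum_comm]
  refine sum_le_sum fun i _ => ?_
  rw [expect_sum_comm, card_filter, Nat.cast_sum]
  refine sum_le_sum fun j _ => ?_
  have hcov : 𝔼 ω, (Y i ω - 𝔼 ω', Y i ω') * (Y j ω - 𝔼 ω', Y j ω') =
      𝔼 ω, Y i ω * Y j ω - (𝔼 ω, Y i ω) * 𝔼 ω, Y j ω := by
    have : ∀ ω, (Y i ω - 𝔼 ω', Y i ω') * (Y j ω - 𝔼 ω', Y j ω') =
        Y i ω * Y j ω - (Y i ω * 𝔼 ω', Y j ω') - (𝔼 ω', Y i ω') * Y j ω +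
          (𝔼 ω', Y i ω') * 𝔼 ω', Y j ω' := fun ω => by ring
    simp only [this, expect_add_distrib, expect_sub_distrib, ← expect_mul, ← mul_expect,
      Fintype.expect_const]
    ring
  rw [hcov]
  split_ifs with hij
  · have : 𝔼 ω, Y i ω * Y j ω ≤ 𝔼 _ω : Ω, (1 : ℝ) :=
      expect_le_expect fun ω _ => mul_le_one₀ (h1 i ω) (h0 j ω) (h1 j ω)
    rw [Fintype.expect_const] at this
    have := mul_nonneg (hμ i) (hμ j)
    push_cast
    linarith
  · rw [hdep i j hij]
    simp

/-- The labelling that is given by `a` where `p` holds, and by `b` elsewhere. -/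
noncomputable def glue {I X : Type*} (p : I → Prop) (a : {i // p i} → X) (b : {i // ¬ p i} → X)
    (i : I) : X :=
  if h : p i then a ⟨i, h⟩ else b ⟨i, h⟩

theorem glue_pos {I X : Type*} {p : I → Prop} (a : {i // p i} → X) (b : {i // ¬ p i} → X) {i : I}
    (hi : p i) : glue p a b i = a ⟨i, hi⟩ := by
  simp [glue, hi]

theorem glue_neg {I X : Type*} {p : I → Prop} (a : {i // p i} → X) (b : {i // ¬ p i} → X) {i : I}
    (hi : ¬ p i) : glue p a b i = b ⟨i, hi⟩ := by
  simp [glue, hi]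

theorem expect_split (p : I → Prop) (H : (I → X) → ℝ) :
    𝔼 ω, H ω = 𝔼 a : {i // p i} → X, 𝔼 b : {i // ¬ p i} → X, H (glue p a b) := by
  rw [Fintype.expect_equiv (Equiv.piEquivPiSubtypeProd p fun _ => X) H
    (fun ab => H (glue p ab.1 ab.2)) (fun ω => ?_), ← univ_product_univ, expect_product]
  congr 1
  funext i
  by_cases hi : p i
  · rw [glue_pos _ _ hi]; rfl
  · rw [glue_neg _ _ hi]; rfl

variable [Nonempty X]

/-- Functions of the labels on disjoint index sets are uncorrelated. -/
theorem expect_mul_of_disjoint {F G : (I → X) → ℝ} {L L' : Set I} (hL : Disjoint L L')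
    (hF : DependsOn F L) (hG : DependsOn G L') :
    𝔼 ω, F ω * G ω = (𝔼 ω, F ω) * 𝔼 ω, G ω := by
  obtain ⟨x⟩ := ‹Nonempty X›
  let e := glue (X := X) fun i : I => i ∈ L
  have h1 : ∀ a b, F (e a b) = F (e a fun _ => x) := fun a b =>
    hF fun i hi => (glue_pos (p := fun i => i ∈ L) _ _ hi).trans
      (glue_pos (p := fun i => i ∈ L) _ _ hi).symm
  have h2 : ∀ a b, G (e a b) = G (e (fun _ => x) b) := fun a b =>
    hG fun i hi => by
      have hi : i ∉ L := fun h => Set.disjoint_left.1 hL h hi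
      exact (glue_neg (p := fun i => i ∈ L) _ _ hi).trans
        (glue_neg (p := fun i => i ∈ L) _ _ hi).symm
  rw [expect_split (fun i => i ∈ L), expect_split (fun i => i ∈ L) F,
    expect_split (fun i => i ∈ L) G]
  change 𝔼 a, 𝔼 b, F (e a b) * G (e a b) = (𝔼 a, 𝔼 b, F (e a b)) * 𝔼 a, 𝔼 b, G (e a b)
  have : Nonempty X := ⟨x⟩
  simp only [h1, h2, Fintype.expect_const]
  rw [Fintype.expect_mul_expect]

/-- The labels at distinct indices are again uniformly distributed. -/
theorem expect_comp_injective {ι : I → J} (hι : Function.Injective ι) (F : (I → X) → ℝ) :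
    𝔼 ω : J → X, F (ω ∘ ι) = 𝔼 ω, F ω := by
  have h1 : ∀ (a : {j // j ∈ Set.range ι} → X) (b : {j // j ∉ Set.range ι} → X),
      F (glue (fun j => j ∈ Set.range ι) a b ∘ ι) = F (fun i => a ⟨ι i, i, rfl⟩) := by
    intro a b
    congr 1
    funext i
    exact glue_pos (p := fun j => j ∈ Set.range ι) a b ⟨i, rfl⟩
  rw [expect_split fun j => j ∈ Set.range ι]
  simp only [h1, Fintype.expect_const]
  convert Fintype.expect_equiv (M := ℝ) ((Equiv.ofInjective ι hι).symm.arrowCongr (Equiv.refl X))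
    (fun a : {j // j ∈ Set.range ι} → X => F fun i => a ⟨ι i, i, rfl⟩) F fun a => by congr 1

/-- For a function that depends only on the labels in `L`, it does not matter if these labels are
read through a map that is injective on `L`. -/
theorem expect_comp_injOn {F : (I → X) → ℝ} {L : Set I} (hF : DependsOn F L) {g : I → J}
    (hg : Set.InjOn g L) : 𝔼 ω : J → X, F (ω ∘ g) = 𝔼 ω, F ω := by
  obtain ⟨x⟩ := ‹Nonempty X›
  let F' : (L → X) → ℝ := fun a => F fun i => if h : i ∈ L then a ⟨i, h⟩ else x
  have h1 : ∀ ω : I → X, F ω = F' (ω ∘ Subtype.val) := fun ω => hF fun i hi => by simp [hi]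
  have : Nonempty X := ⟨x⟩
  simp only [h1]
  rw [expect_comp_injective Subtype.val_injective F', ← expect_comp_injective (J := J)
    (ι := fun i : L => g i) (fun i j h => Subtype.ext (hg i.2 j.2 h)) F']
  rfl

theorem expect_label_eq [DecidableEq X] {x y : I} (hxy : x ≠ y) :
    𝔼 ω : I → X, (if ω x = ω y then 1 else 0 : ℝ) = 1 / Fintype.card X := by
  have hinj : Function.Injective fun b : Bool => if b then x else y := by
    intro a b
    cases a <;> cases b <;> simp [hxy, hxy.symm]
  have := expect_comp_injective (X := X) hinj
    fun a : Bool → X => if a true = a false then (1 : ℝ) else 0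
  simp only [Function.comp_apply, if_true, Bool.false_eq_true, if_false] at this
  have h2 := Fintype.expect_equiv (Equiv.boolArrowEquivProd X)
    (fun a => if a true = a false then (1 : ℝ) else 0)
    (fun p => if p.2 = p.1 then (1 : ℝ) else 0) (fun a => rfl)
  rw [this, h2, ← univ_product_univ, expect_product]
  simp

variable [LinearOrder X]

/-- By symmetry, each element of `L` is equally likely to be the strict minimum. -/
theorem expect_strictMin_mul_card_le (L : Finset I) (x : I) :
    (𝔼 ω : I → X, (if StrictMin L ω x then 1 else 0 : ℝ)) * L.card ≤ 1 := by
  by_cases hx : x ∈ L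
  swap
  · simp [StrictMin, hx]
  have hsymm : ∀ y ∈ L, 𝔼 ω : I → X, (if StrictMin L ω y then 1 else 0 : ℝ) =
      𝔼 ω : I → X, (if StrictMin L ω x then 1 else 0 : ℝ) := by
    intro y hy
    have hsw : ∀ z, Equiv.swap x y z ∈ L ↔ z ∈ L := by
      intro z
      rw [Equiv.swap_apply_def]
      split_ifs with h1 h2
      · simp [h1, hx, hy]
      · simp [h2, hx, hy]
      · rfl
    refine Fintype.expect_equiv ((Equiv.swap x y).arrowCongr (Equiv.refl X)) _ _ fun ω => ?_
    refine if_congr ?_ rfl rfl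
    simp only [StrictMin, hx, hy, true_and, Equiv.arrowCongr_apply, Equiv.coe_refl,
      Function.comp_apply, id, Equiv.symm_swap, Equiv.swap_apply_left]
    constructor
    · exact fun h z hz hzx => h _ ((hsw z).2 hz) fun hzy =>
        hzx (by simpa using (Equiv.swap_apply_eq_iff.1 hzy))
    · intro h z hz hzy
      have := h _ ((hsw z).2 hz) fun hzx => hzy (by simpa using (Equiv.swap_apply_eq_iff.1 hzx))
      rwa [Equiv.swap_apply_self] at this
  have hsum : ∑ y ∈ L, 𝔼 ω : I → X, (if StrictMin L ω y then 1 else 0 : ℝ) ≤ 1 := by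
    rw [← expect_sum_comm]
    refine (expect_le_expect (g := fun _ => (1 : ℝ)) fun ω _ => ?_).trans
      (Fintype.expect_const _).le
    rw [sum_boole]
    have : (L.filter fun y => StrictMin L ω y).card ≤ 1 := Finset.card_le_one.2 fun a ha b hb =>
      (mem_filter.1 ha).2.unique (mem_filter.1 hb).2
    exact_mod_cast this
  rw [sum_congr rfl hsymm, sum_const, nsmul_eq_mul] at hsum
  linarith

/-- If there is no strict minimum, then two elements of `L` have the same label; this is unlikely by
the union bound over all pairs. -/
theorem expect_no_strictMin_le {L : Finset I} (hL : L.Nonempty) :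
    𝔼 ω : I → X, (if ∃ x, StrictMin L ω x then 0 else 1 : ℝ) ≤
      (L.card : ℝ) ^ 2 / Fintype.card X := by
  have hle : ∀ ω : I → X, (if ∃ x, StrictMin L ω x then 0 else 1 : ℝ) ≤
      ∑ x ∈ L, ∑ y ∈ L, if x ≠ y ∧ ω x = ω y then 1 else 0 := by
    intro ω
    have hnn : ∀ x ∈ L, (0 : ℝ) ≤ ∑ y ∈ L, if x ≠ y ∧ ω x = ω y then 1 else 0 := fun x _ =>
      sum_nonneg fun y _ => by split_ifs <;> norm_num
    split_ifs with h
    · exact sum_nonneg hnn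
    · obtain ⟨x, hx, hmin⟩ := L.exists_min_image ω hL
      have : ∃ y ∈ L, y ≠ x ∧ ω y ≤ ω x := by
        by_contra! hcon
        exact h ⟨x, hx, hcon⟩
      obtain ⟨y, hy, hyx, hle⟩ := this
      have hxy : ω x = ω y := (hmin y hy).antisymm hle
      refine le_trans ?_ (single_le_sum hnn hx)
      refine le_trans ?_ (single_le_sum (fun y _ => by split_ifs <;> norm_num) hy)
      simp [hyx.symm, hxy]
  refine (expect_le_expect (s := univ) fun ω _ => hle ω).trans ?_
  rw [expect_sum_comm]
  have hterm : ∀ x ∈ L, 𝔼 ω : I → X, ∑ y ∈ L, (if x ≠ y ∧ ω x = ω y then 1 else 0 : ℝ) ≤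
      L.card * (1 / Fintype.card X) := by
    intro x _
    rw [expect_sum_comm, ← nsmul_eq_mul]
    refine sum_le_card_nsmul _ _ _ fun y _ => ?_
    by_cases hxy : x = y
    · simp [hxy]
    · simp only [ne_eq, hxy, not_false_eq_true, true_and]
      exact (expect_label_eq (X := X) hxy).le
  refine (sum_le_card_nsmul _ _ _ hterm).trans (le_of_eq ?_)
  rw [nsmul_eq_mul]
  ring

end RandomLabels

/-! ### Partitions of hyperfinite structures -/

namespace RelStr

variable {σ : Schema}

/-- A partition of the domain of `A` into clusters, that is, into sets that are small in the metric
of `A` (but not necessarily connected). -/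
structure IsClusterPartition {V : Type} (A : RelStr σ V) (k : ℕ) (P : Finset (Finset V)) :
    Prop where
  isCluster : ∀ S ∈ P, A.IsCluster k S
  existsUnique : ∀ u, ∃! S, S ∈ P ∧ u ∈ S

theorem gaifman_mono {V : Type} {A B : RelStr σ V} (h : B.IsSub A) : B.gaifman ≤ A.gaifman :=
  fun _ _ ⟨hne, R, t, ht, ha, hb⟩ => ⟨hne, R, t, h R ht, ha, hb⟩

/-- If the removal of some tuples leaves components with at most `k` elements, then the components
form a partition into clusters: any two of their elements are joined by a path with at most `k`
vertices. Only removed tuples are on the boundary of a component, and each of them on the boundaries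
of at most as many components as it has entries. -/
theorem exists_isClusterPartition {V : Type} [Fintype V] [DecidableEq V] {A B : RelStr σ V}
    (hB : B.IsSub A) {k : ℕ} (hk : ∀ K : B.gaifman.ConnectedComponent, K.supp.ncard ≤ k) :
    ∃ P : Finset (Finset V), A.IsClusterPartition k P ∧
      ∑ S ∈ P, (A.boundary S).card ≤ σ.maxArity * (A.tuples \ B.tuples).card := by
  let c : V → Finset V := fun u => Finset.univ.filter fun v => B.gaifman.Reachable u v
  have hc : ∀ u v, v ∈ c u ↔ B.gaifman.Reachable u v := fun u v => by simp [c]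
  have hceq : ∀ u v, v ∈ c u → c u = c v := by
    intro u v huv
    rw [hc] at huv
    ext w
    rw [hc, hc]
    exact ⟨fun h => huv.symm.trans h, fun h => huv.trans h⟩
  have hP : ∀ S ∈ Finset.univ.image c, ∀ u ∈ S, S = c u := by
    intro S hS u hu
    obtain ⟨w, -, rfl⟩ := Finset.mem_image.1 hS
    exact hceq w u hu
  refine ⟨Finset.univ.image c, ⟨?_, fun u => ⟨c u, ⟨Finset.mem_image_of_mem c (Finset.mem_univ u),
    (hc u u).2 (SimpleGraph.Reachable.refl u)⟩, fun S hS => hP S hS.1 u hS.2⟩⟩, ?_⟩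
  · intro S hS
    obtain ⟨w, -, rfl⟩ := Finset.mem_image.1 hS
    refine ⟨⟨w, (hc w w).2 (SimpleGraph.Reachable.refl w)⟩, fun u hu v hv => ?_⟩
    have huv : B.gaifman.Reachable u v := ((hc w u).1 hu).symm.trans ((hc w v).1 hv)
    obtain ⟨p, hp⟩ := huv.exists_isPath
    refine mem_ball_iff_walk.2 ⟨p.mapLe (gaifman_mono hB), ?_⟩
    rw [SimpleGraph.Walk.length_mapLe]
    have hsub : (p.support.toFinset : Set V) ⊆ (B.gaifman.connectedComponentMk u).supp := by
      intro x hx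
      simp only [List.coe_toFinset, Set.mem_ofPred] at hx
      rw [SimpleGraph.ConnectedComponent.mem_supp_iff, SimpleGraph.ConnectedComponent.eq]
      exact (p.takeUntil x hx).reachable.symm
    have h1 := (Set.ncard_le_ncard hsub (Set.toFinite _)).trans (hk _)
    rw [Set.ncard_coe_finset, List.toFinset_card_of_nodup hp.support_nodup,
      SimpleGraph.Walk.length_support] at h1
    omega
  · have h1 : ∀ S ∈ Finset.univ.image c, A.boundary S =
        (A.tuples \ B.tuples).filter fun p => p ∈ A.boundary S := by
      intro S hS
      ext p
      simp only [Finset.mem_filter, Finset.mem_sdiff, mem_tuples]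
      refine ⟨fun hp => ⟨⟨(mem_boundary.1 hp).1, fun hpB => ?_⟩, hp⟩, fun hp => hp.2⟩
      obtain ⟨-, ⟨i, hi⟩, ⟨j, hj⟩⟩ := mem_boundary.1 hp
      rw [hP S hS _ hi, hc] at hj
      obtain ⟨q, -⟩ := mem_ball_iff_walk.1 (mem_ball_one_of_mem_rel hpB i j)
      exact hj ⟨q⟩
    have h2 : ∀ S ∈ Finset.univ.image c, (A.boundary S).card =
        ∑ p ∈ A.tuples \ B.tuples, if p ∈ A.boundary S then 1 else 0 := by
      intro S hS
      rw [← Finset.card_filter, ← h1 S hS]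
    rw [Finset.sum_congr rfl h2, Finset.sum_comm, mul_comm, ← smul_eq_mul]
    refine Finset.sum_le_card_nsmul _ _ _ fun p _ => ?_
    rw [← Finset.card_filter]
    have hsub : ((Finset.univ.image c).filter fun S => p ∈ A.boundary S) ⊆
        Finset.univ.image fun i => c (p.2 i) := by
      intro S hS
      obtain ⟨hS, hp⟩ := Finset.mem_filter.1 hS
      obtain ⟨-, ⟨i, hi⟩, -⟩ := mem_boundary.1 hp
      exact Finset.mem_image.2 ⟨i, Finset.mem_univ _, (hP S hS _ hi).symm⟩
    exact (Finset.card_le_card hsub).trans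
      (Finset.card_image_le.trans (by simpa using Schema.arity_le p.1))

/-! ### Local weights on clusters -/

/-- A local rule that assigns an integer weight to each cluster of each structure. Clusters that
look the same up to distance `Q` get the same weight, and the weights of the clusters through any
element add up to at least `M / 2`. Up to scaling, a rule is a locally defined fractional partition
of structures of degree at most `d`. -/
structure WeightRule (σ : Schema) (d k Q M : ℕ) where
  weight : ∀ {n : ℕ}, RelStr σ (Fin n) → Finset (Fin n) → ℕ
  weight_le : ∀ {n : ℕ} (A : RelStr σ (Fin n)) S, weight A S ≤ M
  isCluster : ∀ {n : ℕ} (A : RelStr σ (Fin n)) S, weight A S ≠ 0 → A.IsCluster k S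
  weight_eq : ∀ {n n' : ℕ} (A : RelStr σ (Fin n)) (B : RelStr σ (Fin n')) S T,
    SetIso Q A S B T → weight A S = weight B T
  le_sum : ∀ {n : ℕ} (A : RelStr σ (Fin n)), (∀ a, A.elementDegree a ≤ d) → ∀ u,
    M ≤ 2 * ∑ S ∈ (A.clusters k).filter (u ∈ ·), weight A S

theorem SetIso.isCluster {V W : Type} {A : RelStr σ V} {B : RelStr σ W} {Q k : ℕ} (hk : k ≤ Q)
    {S : Finset V} {T : Finset W} (h : SetIso Q A S B T) (hS : A.IsCluster k S) :
    B.IsCluster k T := by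
  obtain ⟨f, hf, hT⟩ := h
  have hT : T = S.image f := by
    apply Finset.coe_injective
    rw [Finset.coe_image, hT]
  rw [hT]
  exact hf.isCluster hS (nbhd_mono hk _)

theorem SetIso.isCluster_iff {V W : Type} {A : RelStr σ V} {B : RelStr σ W} {Q k : ℕ} (hk : k ≤ Q)
    {S : Finset V} {T : Finset W} (h : SetIso Q A S B T) :
    A.IsCluster k S ↔ B.IsCluster k T := by
  refine ⟨h.isCluster hk, fun hT => ?_⟩
  obtain ⟨f, -, hf⟩ := id h
  obtain ⟨t, ht⟩ := hT.1
  have ht : t ∈ (T : Set W) := ht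
  rw [← hf] at ht
  obtain ⟨v, -, -⟩ := ht
  have : Nonempty V := ⟨v⟩
  exact h.symm.isCluster hk hT

theorem SetIso.exists_eq_singleton {V W : Type} {A : RelStr σ V} {B : RelStr σ W} {Q : ℕ} {u : V}
    {T : Finset W} (h : SetIso Q A {u} B T) : ∃ u', T = {u'} ∧ SameNbhd Q A u B u' := by
  obtain ⟨f, hf, hT⟩ := h
  rw [Finset.coe_singleton, Set.image_singleton] at hT
  have hT : T = {f u} := by
    apply Finset.coe_injective
    rw [Finset.coe_singleton, hT]
  subst hT
  refine ⟨f u, rfl, hf.sameNbhd (ball_subset_nbhd (by simp)) (ball_subset_nbhd (by simp))⟩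

theorem SetIso.card_filter_eq {V W : Type} {A : RelStr σ V} {B : RelStr σ W} {Q : ℕ}
    {S : Finset V} {T : Finset W} (h : SetIso Q A S B T) {p : V → Prop} {q : W → Prop}
    [DecidablePred p] [DecidablePred q] (hpq : ∀ u u', SameNbhd Q A u B u' → (p u ↔ q u')) :
    (S.filter p).card = (T.filter q).card := by
  obtain ⟨f, hf, hT⟩ := h
  have hT' : T = S.image f := by
    apply Finset.coe_injective
    rw [Finset.coe_image, hT]
  have hiff : ∀ u ∈ S, p u ↔ q (f u) := fun u hu => hpq u _ (hf.sameNbhd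
    (ball_subset_nbhd (by exact_mod_cast hu))
    (ball_subset_nbhd (by rw [← hT]; exact Set.mem_image_of_mem f (by exact_mod_cast hu))))
  rw [hT', Finset.filter_image, Finset.card_image_of_injOn]
  · congr 1
    ext u
    simp only [Finset.mem_filter, and_congr_right_iff]
    exact hiff u
  · exact hf.1.injOn.mono ((Finset.coe_subset.2 (Finset.filter_subset _ _)).trans
      (subset_nbhd Q _))

section TransferWeights

variable {d k : ℕ} {n' : ℕ} (A' : RelStr σ (Fin n')) (P : Finset (Finset (Fin n')))

/-- The fraction of parts among the clusters of `A'` that look like `S` up to distance `R`. -/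
noncomputable def partFreq (k R : ℕ) {n : ℕ} (A : RelStr σ (Fin n)) (S : Finset (Fin n)) : ℝ :=
  classAvg (A'.clusters k) (fun T => SetIso R A S A' T) fun T => if T ∈ P then 1 else 0

/-- The frequencies of parts, scaled by `M` and rounded up. -/
noncomputable def preWeight (k R M : ℕ) {n : ℕ} (A : RelStr σ (Fin n)) (S : Finset (Fin n)) : ℕ :=
  if A.IsCluster k S then ⌈M * partFreq A' P k R A S⌉₊ else 0

/-- An element that is not sufficiently covered by the weights. -/
def IsBad (k R M : ℕ) {n : ℕ} (A : RelStr σ (Fin n)) (u : Fin n) : Prop :=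
  2 * ∑ S ∈ (A.clusters k).filter (u ∈ ·), (preWeight A' P k R M A S : ℝ) < M

variable {A' P} {R M n m : ℕ} {A : RelStr σ (Fin n)} {B : RelStr σ (Fin m)}

theorem partFreq_nonneg (S : Finset (Fin n)) : 0 ≤ partFreq A' P k R A S :=
  classAvg_nonneg fun T => by split_ifs <;> norm_num

theorem partFreq_le_one (S : Finset (Fin n)) : partFreq A' P k R A S ≤ 1 :=
  classAvg_le_one fun T => by split_ifs <;> norm_num

theorem preWeight_le (S : Finset (Fin n)) : preWeight A' P k R M A S ≤ M := by
  unfold preWeight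
  split_ifs
  · exact Nat.ceil_le.2 (mul_le_of_le_one_right (Nat.cast_nonneg _) (partFreq_le_one S))
  · exact Nat.zero_le _

theorem preWeight_eq (hk : k ≤ R) {S : Finset (Fin n)} {T : Finset (Fin m)}
    (h : SetIso R A S B T) : preWeight A' P k R M A S = preWeight A' P k R M B T := by
  unfold preWeight
  by_cases hS : A.IsCluster k S
  · have : Nonempty (Fin n) := ⟨hS.1.choose⟩
    rw [if_pos hS, if_pos (h.isCluster hk hS)]
    have heq : partFreq A' P k R A S = partFreq A' P k R B T := by
      unfold partFreq
      congr 1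
      ext U
      exact ⟨fun hU => h.symm.trans hU, fun hU => h.trans hU⟩
    rw [heq]
  · rw [if_neg hS, if_neg fun hT => hS ((h.isCluster_iff hk).2 hT)]

theorem isBad_iff (hk : k ≤ R) {u : Fin n} {u' : Fin m} (h : SameNbhd (R + k) A u B u') :
    IsBad A' P k R M A u ↔ IsBad A' P k R M B u' := by
  unfold IsBad
  rw [sum_clusters_eq_of_sameNbhd (k := k) (Q := R) (by omega) hk h
    (F := fun S => (preWeight A' P k R M A S : ℝ))
    (G := fun T => (preWeight A' P k R M B T : ℝ)) (fun _ => Nat.cast_nonneg _)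
    (fun _ => Nat.cast_nonneg _) fun S T hST => ?_]
  rw [preWeight_eq hk hST]

variable (A' P M) in
/-- The rule that gives to a cluster the frequency of parts of `A'` among the clusters that look
alike, and the full weight to singletons that would not be covered otherwise. -/
noncomputable def partRule (d : ℕ) {Q : ℕ} (hk : k ≤ R) (hQ : R + k ≤ Q) :
    WeightRule σ d k Q M where
  weight A S := if ∃ u, S = {u} ∧ IsBad A' P k R M A u then M else preWeight A' P k R M A S
  weight_le A S := by
    split_ifs
    · exact le_rfl
    · exact preWeight_le S
  isCluster A S h := by
    split_ifs at h with h1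
    · obtain ⟨u, rfl, -⟩ := h1
      exact isCluster_singleton A k u
    · by_contra hS
      exact h (if_neg hS)
  weight_eq {n n'} A B S T h := by
    have h' : SetIso (R + k) A S B T := h.mono hQ
    have key : ∀ {n m : ℕ} (A : RelStr σ (Fin n)) (B : RelStr σ (Fin m)) S T,
        SetIso (R + k) A S B T → (∃ u, S = {u} ∧ IsBad A' P k R M A u) →
          ∃ u, T = {u} ∧ IsBad A' P k R M B u := by
      rintro n m A B S T hST ⟨u, rfl, hu⟩
      obtain ⟨u', rfl, huu'⟩ := hST.exists_eq_singleton
      exact ⟨u', rfl, (isBad_iff hk huu').1 hu⟩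
    have hpre := preWeight_eq (A' := A') (P := P) (M := M) hk (h'.mono (Nat.le_add_right R k))
    by_cases h1 : ∃ u, S = {u} ∧ IsBad A' P k R M A u
    · rw [if_pos h1, if_pos (key A B S T h' h1)]
    · rw [if_neg h1, if_neg, hpre]
      intro h2
      refine h1 (key B A T S ?_ h2)
      obtain ⟨f, -, hf⟩ := h'
      obtain ⟨u', rfl, -⟩ := h2
      have hu' : u' ∈ (({u'} : Finset (Fin n')) : Set (Fin n')) := by simp
      rw [← hf] at hu'
      obtain ⟨v, -, -⟩ := hu'
      have : Nonempty (Fin n) := ⟨v⟩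
      exact (h.mono hQ).symm
  le_sum A _ u := by
    by_cases hu : IsBad A' P k R M A u
    · have hmem : ({u} : Finset _) ∈ (A.clusters k).filter (u ∈ ·) := by
        simp [isCluster_singleton]
      have := Finset.single_le_sum (f := fun S => if ∃ u, S = {u} ∧ IsBad A' P k R M A u then M
        else preWeight A' P k R M A S) (fun _ _ => Nat.zero_le _) hmem
      rw [if_pos ⟨u, rfl, hu⟩] at this
      omega
    · unfold IsBad at hu
      rw [not_lt] at hu
      have hu' : M ≤ 2 * ∑ S ∈ (A.clusters k).filter (u ∈ ·), preWeight A' P k R M A S := by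
        exact_mod_cast hu
      refine hu'.trans (Nat.mul_le_mul_left 2 (Finset.sum_le_sum fun S _ => ?_))
      split_ifs
      · exact preWeight_le S
      · exact le_rfl

theorem equivOn_setIso : EquivOn (A'.clusters k) fun S T => SetIso R A' S A' T where
  refl S _ := SetIso.refl R A' S
  symm S hS T _ h := by
    have : Nonempty (Fin n') := ⟨(mem_clusters.1 hS).1.choose⟩
    exact h.symm
  trans S _ T _ U _ h h' := h.trans h'

theorem sum_sum_clusters_mem (s : Finset (Fin n)) (F : Finset (Fin n) → ℝ) :
    ∑ u ∈ s, ∑ S ∈ (A.clusters k).filter (u ∈ ·), F S =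
      ∑ S ∈ A.clusters k, F S * (S.filter (· ∈ s)).card := by
  simp_rw [Finset.sum_filter]
  rw [Finset.sum_comm]
  refine Finset.sum_congr rfl fun S _ => ?_
  rw [← Finset.sum_filter, Finset.sum_const, nsmul_eq_mul, mul_comm]
  congr 3
  ext u
  simp [and_comm]

/-- If the part frequencies hardly change when the radius grows from `R` to `R + k`, then few
elements are bad. This is where the pigeonhole argument on radii pays off. -/
theorem sq_card_isBad_le (hA' : ∀ a, A'.elementDegree a ≤ d) (hP : A'.IsClusterPartition k P)
    (hk : k ≤ R) {η : ℝ}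
    (hη : ∑ S ∈ A'.clusters k, (partFreq A' P k (R + k) A' S - partFreq A' P k R A' S) ^ 2 ≤ η) :
    ((Finset.univ.filter (IsBad A' P k R M A')).card : ℝ) ^ 2 ≤
      4 * (η * (n' * 2 ^ σ.ballBound d k * (σ.ballBound d k : ℝ) ^ 2)) := by
  set bad := Finset.univ.filter (IsBad A' P k R M A') with hbad
  have hbadmem : ∀ u, u ∈ bad ↔ IsBad A' P k R M A' u := fun u => by simp [hbad]
  let G : Finset (Fin n') → ℝ := fun S => (S.filter (· ∈ bad)).card
  have hG : ∀ S T, SetIso (R + k) A' S A' T → G S = G T := by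
    intro S T hST
    exact congrArg Nat.cast (hST.card_filter_eq (p := (· ∈ bad)) (q := (· ∈ bad))
      fun u u' huu' => by rw [hbadmem, hbadmem, isBad_iff hk huu'])
  -- every element is covered by exactly one part
  have h1 : (bad.card : ℝ) = ∑ S ∈ A'.clusters k, (if S ∈ P then 1 else 0) * G S := by
    rw [← sum_sum_clusters_mem bad fun S => if S ∈ P then 1 else 0, Finset.card_eq_sum_ones,
      Nat.cast_sum]
    refine Finset.sum_congr rfl fun u _ => ?_
    obtain ⟨S, ⟨hS, huS⟩, huniq⟩ := hP.existsUnique u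
    rw [Finset.sum_eq_single S]
    · simp [hS]
    · intro T hT hTS
      refine if_neg fun hTP => hTS (huniq T ⟨hTP, (Finset.mem_filter.1 hT).2⟩)
    · intro h
      exact absurd (Finset.mem_filter.2 ⟨mem_clusters.2 (hP.isCluster S hS), huS⟩) h
  -- badness is visible at radius `R + k`, hence averaging at this radius does not change the sum
  have h2 : (bad.card : ℝ) = ∑ S ∈ A'.clusters k, partFreq A' P k (R + k) A' S * G S := by
    rw [h1]
    exact (sum_classAvg_mul equivOn_setIso fun S _ T _ hST => hG S T hST).symm
  -- by definition, the frequencies at radius `R` cover a bad element by less than one half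
  have h3 : 2 * ∑ S ∈ A'.clusters k, partFreq A' P k R A' S * G S ≤ bad.card := by
    rw [← sum_sum_clusters_mem bad, Finset.mul_sum, Finset.card_eq_sum_ones, Nat.cast_sum]
    refine Finset.sum_le_sum fun u hu => ?_
    have hu := (hbadmem u).1 hu
    unfold IsBad at hu
    have hM : (0 : ℝ) < M := lt_of_le_of_lt
      (mul_nonneg two_pos.le (Finset.sum_nonneg fun _ _ => Nat.cast_nonneg _)) hu
    have hle : M * ∑ S ∈ (A'.clusters k).filter (u ∈ ·), partFreq A' P k R A' S ≤
        ∑ S ∈ (A'.clusters k).filter (u ∈ ·), (preWeight A' P k R M A' S : ℝ) := by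
      rw [Finset.mul_sum]
      refine Finset.sum_le_sum fun S hS => ?_
      rw [preWeight, if_pos (mem_clusters.1 (Finset.mem_filter.1 hS).1)]
      exact Nat.le_ceil _
    rw [Nat.cast_one]
    by_contra! hcon
    have := mul_lt_mul_of_pos_left hcon hM
    linarith
  have h4 : (bad.card : ℝ) ≤ 2 * ∑ S ∈ A'.clusters k,
      (partFreq A' P k (R + k) A' S - partFreq A' P k R A' S) * G S := by
    simp only [sub_mul, Finset.sum_sub_distrib]
    linarith
  have h5 : ∑ S ∈ A'.clusters k, G S ^ 2 ≤
      n' * 2 ^ σ.ballBound d k * (σ.ballBound d k : ℝ) ^ 2 := by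
    refine (Finset.sum_le_card_nsmul _ _ ((σ.ballBound d k : ℝ) ^ 2) fun S hS => ?_).trans ?_
    · refine pow_le_pow_left₀ (Nat.cast_nonneg _) ?_ 2
      exact Nat.cast_le.2 ((Finset.card_filter_le _ _).trans ((mem_clusters.1 hS).card_le hA'))
    · rw [nsmul_eq_mul]
      refine mul_le_mul_of_nonneg_right ?_ (by positivity)
      have := card_clusters_le (k := k) hA'
      rw [Fintype.card_fin] at this
      exact_mod_cast this
  -- the Cauchy-Schwarz inequality
  calc (bad.card : ℝ) ^ 2 ≤ (2 * ∑ S ∈ A'.clusters k,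
        (partFreq A' P k (R + k) A' S - partFreq A' P k R A' S) * G S) ^ 2 :=
        pow_le_pow_left₀ (Nat.cast_nonneg _) h4 2
    _ = 4 * (∑ S ∈ A'.clusters k,
        (partFreq A' P k (R + k) A' S - partFreq A' P k R A' S) * G S) ^ 2 := by ring
    _ ≤ 4 * ((∑ S ∈ A'.clusters k,
        (partFreq A' P k (R + k) A' S - partFreq A' P k R A' S) ^ 2) *
          ∑ S ∈ A'.clusters k, G S ^ 2) :=
        mul_le_mul_of_nonneg_left (Finset.sum_mul_sq_le_sq_mul_sq _ _ _) (by norm_num)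
    _ ≤ _ := by
        refine mul_le_mul_of_nonneg_left ?_ (by norm_num)
        exact mul_le_mul hη h5 (Finset.sum_nonneg fun _ _ => sq_nonneg _)
          ((Finset.sum_nonneg fun _ _ => sq_nonneg _).trans hη)

/-- The total weight of the boundaries of the clusters of `A'` is hardly larger than the number of
tuples cut by the partition. -/
theorem sum_partRule_boundary_le (hA' : ∀ a, A'.elementDegree a ≤ d)
    (hP : A'.IsClusterPartition k P) (hk : k ≤ R) (hR : 1 ≤ R) {Q : ℕ} (hQ : R + k ≤ Q) :
    ∑ S ∈ A'.clusters k, ((partRule A' P M d hk hQ).weight A' S : ℝ) * (A'.boundary S).card ≤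
      M * ∑ S ∈ P, ((A'.boundary S).card : ℝ) +
        n' * 2 ^ σ.ballBound d k * (d * σ.ballBound d k) +
        M * (d * (Finset.univ.filter (IsBad A' P k R M A')).card) := by
  have hPsub : P ⊆ A'.clusters k := fun S hS => mem_clusters.2 (hP.isCluster S hS)
  have h1 : ∀ S ∈ A'.clusters k,
      ((partRule A' P M d hk hQ).weight A' S : ℝ) * (A'.boundary S).card ≤
        M * (partFreq A' P k R A' S * (A'.boundary S).card) + d * σ.ballBound d k +
          if ∃ u, S = {u} ∧ IsBad A' P k R M A' u then (M * d : ℝ) else 0 := by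
    intro S hS
    have hS := mem_clusters.1 hS
    have hb : ((A'.boundary S).card : ℝ) ≤ d * S.card := by
      exact_mod_cast card_boundary_le hA' S
    have hb' : ((A'.boundary S).card : ℝ) ≤ d * σ.ballBound d k := by
      exact_mod_cast (card_boundary_le hA' S).trans (Nat.mul_le_mul_left _ (hS.card_le hA'))
    have hn : 0 ≤ partFreq A' P k R A' S * (A'.boundary S).card :=
      mul_nonneg (partFreq_nonneg S) (Nat.cast_nonneg _)
    simp only [partRule]
    split_ifs with h
    · obtain ⟨u, rfl, -⟩ := h
      rw [Finset.card_singleton, Nat.cast_one, mul_one] at hb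
      have : (M : ℝ) * (A'.boundary {u}).card ≤ M * d :=
        mul_le_mul_of_nonneg_left hb (Nat.cast_nonneg _)
      have h2 : 0 ≤ (M : ℝ) * (partFreq A' P k R A' {u} * (A'.boundary {u}).card) :=
        mul_nonneg (Nat.cast_nonneg _) hn
      have h3 : (0 : ℝ) ≤ d * σ.ballBound d k := by positivity
      linarith
    · have : (preWeight A' P k R M A' S : ℝ) ≤ M * partFreq A' P k R A' S + 1 := by
        rw [preWeight, if_pos hS]
        exact (Nat.ceil_lt_add_one (mul_nonneg (Nat.cast_nonneg _) (partFreq_nonneg S))).le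
      have := mul_le_mul_of_nonneg_right this (Nat.cast_nonneg (A'.boundary S).card)
      linarith
  refine (Finset.sum_le_sum h1).trans ?_
  rw [Finset.sum_add_distrib, Finset.sum_add_distrib, ← Finset.mul_sum]
  refine add_le_add (add_le_add (le_of_eq ?_) ?_) ?_
  · congr 1
    have := sum_classAvg_mul (s := A'.clusters k) (f := fun T => if T ∈ P then (1 : ℝ) else 0)
      (equivOn_setIso (R := R)) (g := fun S => ((A'.boundary S).card : ℝ))
      fun S _ T _ hST => congrArg Nat.cast (card_boundary_eq_of_setIso hR hST)
    refine this.trans ?_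
    simp only [ite_mul, one_mul, zero_mul]
    rw [← Finset.sum_filter, Finset.filter_mem_eq_inter, Finset.inter_eq_right.2 hPsub]
  · rw [Finset.sum_const, nsmul_eq_mul]
    refine mul_le_mul_of_nonneg_right ?_ (by positivity)
    have := card_clusters_le (k := k) hA'
    rw [Fintype.card_fin] at this
    exact_mod_cast this
  · rw [← Finset.sum_filter, Finset.sum_const, nsmul_eq_mul]
    have hsub : (A'.clusters k).filter (fun S => ∃ u, S = {u} ∧ IsBad A' P k R M A' u) ⊆
        (Finset.univ.filter (IsBad A' P k R M A')).image fun u => {u} := by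
      intro S hS
      obtain ⟨u, rfl, hu⟩ := (Finset.mem_filter.1 hS).2
      exact Finset.mem_image_of_mem _ (by simpa using hu)
    have hcard : (((A'.clusters k).filter
        (fun S => ∃ u, S = {u} ∧ IsBad A' P k R M A' u)).card : ℝ) ≤
        (Finset.univ.filter (IsBad A' P k R M A')).card := by
      exact_mod_cast (Finset.card_le_card hsub).trans Finset.card_image_le
    have := mul_le_mul_of_nonneg_right hcard (show (0 : ℝ) ≤ M * d by positivity)
    linarith

theorem IsClusterPartition.card_le (hP : A'.IsClusterPartition k P) : P.card ≤ n' := by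
  have h : P ⊆ Finset.univ.image fun u => (hP.existsUnique u).choose := by
    intro S hS
    obtain ⟨u, hu⟩ := (hP.isCluster S hS).1
    refine Finset.mem_image.2 ⟨u, Finset.mem_univ u, ?_⟩
    exact ((hP.existsUnique u).choose_spec.2 S ⟨hS, hu⟩).symm
  exact (Finset.card_le_card h).trans (Finset.card_image_le.trans (by simp))

/-- The sum of the squares of the part frequencies grows with the radius and never exceeds the
number of parts, which is at most `n'`. Hence one of `J` steps of length `k` increases it by little,
and by orthogonality the increase is the squared distance of the frequencies before and after the
step. -/
theorem exists_radius (hP : A'.IsClusterPartition k P) {η : ℝ} {J : ℕ} (hJ : 1 ≤ J * η)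
    (hJ0 : 0 < J) : ∃ j < J, ∑ S ∈ A'.clusters k,
      (partFreq A' P k ((j + 1) * k + k) A' S - partFreq A' P k ((j + 1) * k) A' S) ^ 2 ≤
        η * n' := by
  let e : ℕ → ℝ := fun j => ∑ S ∈ A'.clusters k, partFreq A' P k ((j + 1) * k) A' S ^ 2
  have hPsub : P ⊆ A'.clusters k := fun S hS => mem_clusters.2 (hP.isCluster S hS)
  obtain ⟨j, hj, hle⟩ := exists_small_increment (e := e) (c := n') (η := η * n') J
    (Finset.sum_nonneg fun _ _ => sq_nonneg _)
    ((sum_sq_classAvg_le equivOn_setIso (fun T => by split_ifs <;> norm_num)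
      (fun T => by split_ifs <;> norm_num)).trans (by
        rw [← Finset.sum_filter, Finset.filter_mem_eq_inter, Finset.inter_eq_right.2 hPsub]
        simpa using hP.card_le))
    (by
      have := mul_le_mul_of_nonneg_right hJ (Nat.cast_nonneg n' : (0 : ℝ) ≤ n')
      linarith) hJ0
  refine ⟨j, hj, le_of_eq_of_le ?_ hle⟩
  have := sum_sq_classAvg_sub (s := A'.clusters k) (f := fun T => if T ∈ P then (1 : ℝ) else 0)
    (equivOn_setIso (R := (j + 1) * k)) (equivOn_setIso (R := (j + 1) * k + k))
    fun S T h => h.mono (Nat.le_add_right _ _)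
  refine this.trans ?_
  simp only [e, partFreq]
  congr 3
  ring_nf

end TransferWeights

/-- Hyperfinite databases admit local fractional partitions that cut few tuples; the radius and
the scale of the rule do not depend on the database. -/
theorem exists_weightRule (σ : Schema) (d : ℕ) (ρ : ℝ → ℕ) {ε : ℝ} (hε : 0 < ε) :
    ∃ k Q M : ℕ, 0 < k ∧ k ≤ Q ∧ 0 < M ∧ ∀ D : Database σ, D.degree ≤ d →
      (∀ ε ∈ Set.Ioc (0 : ℝ) 1, ∃ B, IsPartition ε (ρ ε) D B) →
      ∃ W : WeightRule σ d k Q M, ∑ S ∈ D.str.clusters k,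
        (W.weight D.str S : ℝ) * (D.str.boundary S).card ≤ ε * M * D.size := by
  obtain ⟨ε', hε'0, hε'1, hε'⟩ : ∃ ε' : ℝ, 0 < ε' ∧ ε' ≤ 1 ∧ σ.maxArity * ε' ≤ ε / 3 := by
    refine ⟨min 1 (ε / 3 / (σ.maxArity + 1)), lt_min one_pos (by positivity), min_le_left _ _, ?_⟩
    calc (σ.maxArity : ℝ) * min 1 (ε / 3 / (σ.maxArity + 1))
        ≤ (σ.maxArity + 1) * (ε / 3 / (σ.maxArity + 1)) := by
          gcongr
          · linarith
          · exact min_le_right _ _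
      _ = ε / 3 := by field_simp
  set k := ρ ε' + 1 with hk
  set K : ℝ := ((σ.ballBound d k : ℕ) : ℝ) with hK
  set Λ : ℝ := 2 ^ σ.ballBound d k with hΛ
  have hΛ0 : 0 < Λ := by positivity
  have hK0 : 0 ≤ K := Nat.cast_nonneg _
  obtain ⟨M, hM⟩ := exists_nat_ge (Λ * (d * K) / (ε / 3) + 1)
  have hM0 : (0 : ℝ) < M := lt_of_lt_of_le (by positivity) hM
  have hMΛ : Λ * (d * K) ≤ ε / 3 * M := by
    have : Λ * (d * K) / (ε / 3) ≤ M := by linarith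
    rw [div_le_iff₀ (by positivity)] at this
    linarith
  set c : ℝ := d ^ 2 * (4 * (Λ * K ^ 2)) with hc
  have hc0 : 0 ≤ c := by positivity
  obtain ⟨η, hη0, hη⟩ : ∃ η : ℝ, 0 < η ∧ c * η ≤ (ε / 3) ^ 2 := by
    refine ⟨(ε / 3) ^ 2 / (c + 1), by positivity, ?_⟩
    rw [← mul_div_assoc, div_le_iff₀ (by positivity)]
    nlinarith [sq_nonneg (ε / 3)]
  obtain ⟨J, hJ⟩ := exists_nat_ge (1 / η)
  have hJη : 1 ≤ J * η := by
    rwa [div_le_iff₀ hη0] at hJ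
  have hJ0 : 0 < J := by
    rw [Nat.pos_iff_ne_zero]
    rintro rfl
    norm_num at hJη
  -- `ε / 3` each for the tuples cut by the partition, for rounding up, and for the bad elements
  refine ⟨k, (J + 1) * k, M, by omega, Nat.le_mul_of_pos_left k (by omega), by exact_mod_cast hM0,
    fun D hD hyp => ?_⟩
  obtain ⟨B, hBsub, hBcard, hBk⟩ := hyp ε' ⟨hε'0, hε'1⟩
  obtain ⟨P, hP, hPcost⟩ := exists_isClusterPartition hBsub
    (k := k) fun K => (hBk K).trans (Nat.le_succ _)
  obtain ⟨j, hj, hjη⟩ := exists_radius hP hJη hJ0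
  have hkR : k ≤ (j + 1) * k := Nat.le_mul_of_pos_left k (by omega)
  have hdeg := Database.elementDegree_le hD
  have hQ : (j + 1) * k + k ≤ (J + 1) * k := by
    rw [← Nat.succ_mul]
    exact Nat.mul_le_mul_right k (by omega)
  refine ⟨partRule D.str P M d hkR hQ,
    (sum_partRule_boundary_le hdeg hP hkR (by omega) hQ).trans ?_⟩
  have hbad := sq_card_isBad_le (M := M) hdeg hP hkR hjη
  set b : ℝ := (((Finset.univ.filter (IsBad D.str P k ((j + 1) * k) M D.str)).card : ℕ) : ℝ)
    with hb
  have hb0 : 0 ≤ b := Nat.cast_nonneg _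
  have hn0 : (0 : ℝ) ≤ D.size := Nat.cast_nonneg _
  have h1 : ∑ S ∈ P, ((D.str.boundary S).card : ℝ) ≤ ε / 3 * D.size := by
    have heq : (∑ R, (D.str.rel R \ B.rel R).ncard) = (D.str.tuples \ B.tuples).card := by
      rw [sum_ncard_eq_card]
      congr 1
      ext p
      simp
    rw [heq] at hBcard
    have h2 : ∑ S ∈ P, ((D.str.boundary S).card : ℝ) ≤
        σ.maxArity * ((D.str.tuples \ B.tuples).card : ℝ) := by exact_mod_cast hPcost
    refine h2.trans ?_
    calc (σ.maxArity : ℝ) * ((D.str.tuples \ B.tuples).card : ℝ)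
        ≤ σ.maxArity * (ε' * D.size) := by gcongr
      _ = σ.maxArity * ε' * D.size := by ring
      _ ≤ ε / 3 * D.size := by gcongr
  have h3 : d * b ≤ ε / 3 * D.size := by
    refine (abs_le_of_sq_le_sq' ?_ (by positivity)).2
    calc ((d : ℝ) * b) ^ 2 = d ^ 2 * b ^ 2 := by ring
      _ ≤ d ^ 2 * (4 * (η * D.size * (D.size * Λ * K ^ 2))) := by gcongr
      _ = c * η * D.size ^ 2 := by rw [hc]; ring
      _ ≤ (ε / 3) ^ 2 * D.size ^ 2 := by gcongr
      _ = (ε / 3 * D.size) ^ 2 := by ring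
  calc (M : ℝ) * ∑ S ∈ P, ((D.str.boundary S).card : ℝ) + D.size * Λ * (d * K) + M * (d * b)
      = M * ∑ S ∈ P, ((D.str.boundary S).card : ℝ) + D.size * (Λ * (d * K)) + M * (d * b) := by
        ring
    _ ≤ M * (ε / 3 * D.size) + D.size * (ε / 3 * M) + M * (ε / 3 * D.size) := by gcongr
    _ = ε * M * D.size := by ring

end RelStr

/-! ### Random rounding of fractional partitions -/

section Rounding

open Finset RelStr

/-- `M` copies of every set of elements. -/
abbrev Copies (V : Type) (M : ℕ) : Type := Finset V × Fin M

/-- The active copies (`m S` copies of each set `S`) of the sets that meet `T`. -/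
noncomputable def copiesAt {V : Type} [Fintype V] {M : ℕ} (m : Finset V → ℕ) (T : Set V) :
    Finset (Copies V M) :=
  univ.filter fun x => (x.2 : ℕ) < m x.1 ∧ ∃ u ∈ T, u ∈ x.1

/-- Every element joins the active copy with the smallest label among the copies that contain it.
The cell of `u` consists of the elements that join the same copy as `u`, or of `u` alone if there
is no strict minimum. -/
noncomputable def cell {V : Type} [Fintype V] {M N : ℕ} (m : Finset V → ℕ)
    (ω : Copies V M → Fin N) (u : V) : Finset V :=
  univ.filter fun v => v = u ∨ ∃ x, StrictMin (copiesAt m {u}) ω x ∧ StrictMin (copiesAt m {v}) ω x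

theorem strictMin_congr {I X : Type*} [LinearOrder X] {L : Finset I} {ω ω' : I → X}
    (h : ∀ x ∈ L, ω x = ω' x) {x : I} : StrictMin L ω x ↔ StrictMin L ω' x := by
  unfold StrictMin
  refine and_congr_right fun hx => forall₂_congr fun y hy => ?_
  rw [h x hx, h y hy]

variable {σ : Schema} {V : Type} [Fintype V] {M N : ℕ} {m : Finset V → ℕ}

theorem mem_copiesAt {T : Set V} {x : Copies V M} :
    x ∈ copiesAt m T ↔ (x.2 : ℕ) < m x.1 ∧ ∃ u ∈ T, u ∈ x.1 := by
  simp [copiesAt]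

theorem mem_copiesAt_singleton {u : V} {x : Copies V M} :
    x ∈ copiesAt m {u} ↔ (x.2 : ℕ) < m x.1 ∧ u ∈ x.1 := by
  simp [mem_copiesAt]

theorem copiesAt_mono {T T' : Set V} (h : T ⊆ T') :
    copiesAt (M := M) m T ⊆ copiesAt m T' := fun _ hx => by
  rw [mem_copiesAt] at hx ⊢
  obtain ⟨h1, u, hu, hux⟩ := hx
  exact ⟨h1, u, h hu, hux⟩

theorem card_filter_copies [DecidableEq V] (hm : ∀ S, m S ≤ M) (p : Finset V → Prop)
    [DecidablePred p] :
    (univ.filter fun x : Copies V M => (x.2 : ℕ) < m x.1 ∧ p x.1).card =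
      ∑ S ∈ univ.filter p, m S := by
  rw [card_filter, Fintype.sum_prod_type, sum_filter]
  refine sum_congr rfl fun S _ => ?_
  split_ifs with hS
  · simp only [hS, and_true]
    rw [← card_filter]
    have := Fin.card_filter_val_lt (n := M) (m := m S)
    rw [min_eq_right (hm S)] at this
    simpa using this
  · simp [hS]

variable {ω ω' : Copies V M → Fin N} {u v w : V}

theorem mem_cell :
    v ∈ cell m ω u ↔ v = u ∨ ∃ x, StrictMin (copiesAt m {u}) ω x ∧
      StrictMin (copiesAt m {v}) ω x := by
  simp [cell]

theorem mem_cell_self (ω : Copies V M → Fin N) (u : V) : u ∈ cell m ω u := mem_cell.2 (Or.inl rfl)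

theorem mem_cell_symm (h : v ∈ cell m ω u) : u ∈ cell m ω v := by
  rw [mem_cell] at h ⊢
  exact h.imp Eq.symm fun ⟨x, h1, h2⟩ => ⟨x, h2, h1⟩

theorem mem_cell_trans (h : v ∈ cell m ω u) (h' : w ∈ cell m ω v) : w ∈ cell m ω u := by
  rw [mem_cell] at h h'
  obtain rfl | ⟨x, h1, h2⟩ := h
  · exact mem_cell.2 h'
  · obtain rfl | ⟨y, h3, h4⟩ := h'
    · exact mem_cell.2 (Or.inr ⟨x, h1, h2⟩)
    · obtain rfl := h2.unique h3
      exact mem_cell.2 (Or.inr ⟨x, h1, h4⟩)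

theorem cell_eq_of_mem (h : v ∈ cell m ω u) : cell m ω v = cell m ω u := by
  ext w
  exact ⟨fun hw => mem_cell_trans h hw, fun hw => mem_cell_trans (mem_cell_symm h) hw⟩

variable {A : RelStr σ V} {k : ℕ}

theorem cell_subset_ball (hm : ∀ S, m S ≠ 0 → A.IsCluster k S) :
    (cell m ω u : Set V) ⊆ A.ball k u := by
  intro v hv
  obtain rfl | ⟨x, h1, h2⟩ := mem_cell.1 (mem_coe.1 hv)
  · exact A.mem_ball_self k _
  · have h1 := mem_copiesAt_singleton.1 h1.1
    have h2 := mem_copiesAt_singleton.1 h2.1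
    exact (hm x.1 (by omega)).2 u h1.2 v h2.2

theorem isCluster_cell (hm : ∀ S, m S ≠ 0 → A.IsCluster k S) : A.IsCluster k (cell m ω u) := by
  refine ⟨⟨u, mem_cell_self ω u⟩, fun v hv w hw => cell_subset_ball (ω := ω) hm ?_⟩
  rw [cell_eq_of_mem hv]
  exact hw

/-- The cell of `u` depends only on the labels of the copies that meet the `k`-ball of `u`. -/
theorem dependsOn_cell (hm : ∀ S, m S ≠ 0 → A.IsCluster k S) (u : V) :
    DependsOn (fun ω : Copies V M → Fin N => cell m ω u)
      (copiesAt m (A.ball k u) : Finset (Copies V M)) := by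
  have key : ∀ ω ω' : Copies V M → Fin N, (∀ x ∈ copiesAt m (A.ball k u), ω x = ω' x) →
      cell m ω u ⊆ cell m ω' u := by
    intro ω ω' h v hv
    have hvb := cell_subset_ball hm (mem_coe.2 hv)
    rw [mem_cell] at hv ⊢
    refine hv.imp_right fun ⟨x, h1, h2⟩ => ⟨x, ?_, ?_⟩
    · refine (strictMin_congr fun y hy => h y (copiesAt_mono ?_ hy)).1 h1
      exact Set.singleton_subset_iff.2 (A.mem_ball_self k u)
    · exact (strictMin_congr fun y hy => h y (copiesAt_mono
        (Set.singleton_subset_iff.2 hvb) hy)).1 h2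
  intro ω ω' h
  exact (key ω ω' fun x hx => h x hx).antisymm (key ω' ω fun x hx => (h x hx).symm)

theorem disjoint_copiesAt (hm : ∀ S, m S ≠ 0 → A.IsCluster k S) (huv : v ∉ A.ball (3 * k) u) :
    Disjoint ((copiesAt m (A.ball k u) : Finset (Copies V M)) : Set (Copies V M))
      (copiesAt m (A.ball k v) : Finset (Copies V M)) := by
  rw [Finset.disjoint_coe, Finset.disjoint_left]
  intro x hx hx'
  obtain ⟨h1, a, ha, hax⟩ := mem_copiesAt.1 hx
  obtain ⟨-, b, hb, hbx⟩ := mem_copiesAt.1 hx'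
  have hab := (hm x.1 (by omega)).2 a hax b hbx
  have := mem_ball_trans (mem_ball_trans ha hab) (mem_ball_comm.1 hb)
  exact huv (by rwa [show 3 * k = k + k + k by ring])

/-! ### Cut tuples -/

/-- The tuples that are not contained in a single cell. -/
noncomputable def cutTuples (A : RelStr σ V) (m : Finset V → ℕ) (ω : Copies V M → Fin N) :
    Finset (Σ R, Fin (σ.arity R) → V) :=
  A.tuples.filter fun p => ¬ ∃ u, ∀ i, p.2 i ∈ cell m ω u

theorem mem_cutTuples {p : Σ R, Fin (σ.arity R) → V} :
    p ∈ cutTuples A m ω ↔ p ∈ A.tuples ∧ ¬ ∃ u, ∀ i, p.2 i ∈ cell m ω u := by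
  simp [cutTuples]

theorem card_tuples_le {d : ℕ} (hA : ∀ a, A.elementDegree a ≤ d) :
    A.tuples.card ≤ Fintype.card V * d := by
  have hsub : A.tuples ⊆ univ.biUnion fun a => A.tuples.filter fun p => ∃ i, p.2 i = a := by
    intro p hp
    exact mem_biUnion.2 ⟨p.2 ⟨0, σ.arity_pos p.1⟩, mem_univ _, mem_filter.2 ⟨hp, _, rfl⟩⟩
  refine (card_le_card hsub).trans (card_biUnion_le.trans ((sum_le_card_nsmul _ _ d
    fun a _ => ?_).trans (by simp)))
  rw [← elementDegree_eq]
  exact hA a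

theorem mem_cell_of_strictMin {T : Set V} {x : Copies V M} (hx : StrictMin (copiesAt m T) ω x)
    (hT : ∀ v ∈ T, v ∈ x.1) (hu : u ∈ T) (hv : v ∈ T) : v ∈ cell m ω u := by
  have h1 : ∀ w ∈ T, StrictMin (copiesAt m {w}) ω x := fun w hw =>
    ⟨mem_copiesAt_singleton.2 ⟨(mem_copiesAt.1 hx.1).1, hT w hw⟩, fun y hy =>
      hx.2 y (copiesAt_mono (Set.singleton_subset_iff.2 hw) hy)⟩
  exact mem_cell.2 (Or.inr ⟨x, h1 u hu, h1 v hv⟩)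

variable [DecidableEq V]

theorem card_copiesAt_singleton (hm : ∀ S, m S ≤ M) (hc : ∀ S, m S ≠ 0 → A.IsCluster k S)
    (u : V) : (copiesAt (M := M) m {u}).card = ∑ S ∈ (A.clusters k).filter (u ∈ ·), m S := by
  have h := card_filter_copies hm (u ∈ ·)
  have h' : copiesAt (M := M) m {u} =
      univ.filter fun x : Copies V M => (x.2 : ℕ) < m x.1 ∧ u ∈ x.1 := by
    ext x
    simp [mem_copiesAt_singleton]
  rw [h', h]
  refine (sum_subset (fun S hS => ?_) fun S hS hS' => ?_).symm
  · simpa using (mem_filter.1 hS).2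
  · by_contra h0
    exact hS' (mem_filter.2 ⟨mem_clusters.2 (hc S h0), (mem_filter.1 hS).2⟩)

/-- The probability that a tuple is cut. -/
theorem expect_cut_le {d : ℕ} (hA : ∀ a, A.elementDegree a ≤ d) (hM : 0 < M)
    (hm : ∀ S, m S ≤ M) (hc : ∀ S, m S ≠ 0 → A.IsCluster k S)
    (hcov : ∀ u, M ≤ 2 * ∑ S ∈ (A.clusters k).filter (u ∈ ·), m S) (hN : 0 < N)
    {p : Σ R, Fin (σ.arity R) → V} (hp : p ∈ A.tuples) :
    𝔼 ω : Copies V M → Fin N, (if p ∈ cutTuples A m ω then 1 else 0 : ℝ) ≤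
      2 / M * ∑ S ∈ A.clusters k, (if p ∈ A.boundary S then (m S : ℝ) else 0) +
        (σ.maxArity * (2 ^ σ.ballBound d k * M) : ℝ) ^ 2 / N := by
  have : Nonempty (Fin N) := ⟨⟨0, hN⟩⟩
  set L : Finset (Copies V M) := copiesAt m (Set.range p.2) with hL
  let i₀ : Fin (σ.arity p.1) := ⟨0, σ.arity_pos p.1⟩
  have hMR : (0 : ℝ) < M := by exact_mod_cast hM
  have hLM : (M : ℝ) ≤ 2 * L.card := by
    have h1 : copiesAt (M := M) m {p.2 i₀} ⊆ L :=
      copiesAt_mono (Set.singleton_subset_iff.2 ⟨i₀, rfl⟩)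
    have h2 := Finset.card_le_card h1
    rw [card_copiesAt_singleton hm hc] at h2
    exact_mod_cast (hcov (p.2 i₀)).trans (Nat.mul_le_mul_left 2 h2)
  have hLpos : (0 : ℝ) < L.card := by linarith
  have hLne : L.Nonempty := Finset.card_pos.1 (by exact_mod_cast hLpos)
  have hLle : (L.card : ℝ) ≤ σ.maxArity * (2 ^ σ.ballBound d k * M) := by
    have h1 : L ⊆ univ.biUnion fun i => copiesAt m {p.2 i} := by
      intro x hx
      obtain ⟨h1, _, ⟨i, rfl⟩, hi⟩ := mem_copiesAt.1 hx
      exact mem_biUnion.2 ⟨i, mem_univ i, mem_copiesAt_singleton.2 ⟨h1, hi⟩⟩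
    have h2 : ∀ i ∈ (univ : Finset (Fin (σ.arity p.1))),
        (copiesAt (M := M) m {p.2 i}).card ≤ 2 ^ σ.ballBound d k * M := by
      intro i _
      rw [card_copiesAt_singleton hm hc]
      refine (sum_le_card_nsmul _ _ M fun S _ => hm S).trans ?_
      rw [smul_eq_mul]
      exact Nat.mul_le_mul_right _ (card_clusters_mem_le hA _)
    have h3 := (Finset.card_le_card h1).trans
      (card_biUnion_le.trans (sum_le_card_nsmul _ _ _ h2))
    rw [card_univ, Fintype.card_fin, smul_eq_mul] at h3
    exact_mod_cast h3.trans (Nat.mul_le_mul_right _ (Schema.arity_le p.1))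
  let Z := L.filter fun x => ¬ ∀ i, p.2 i ∈ x.1
  have hcut : ∀ ω : Copies V M → Fin N, (if p ∈ cutTuples A m ω then 1 else 0 : ℝ) ≤
      ∑ x ∈ Z, (if StrictMin L ω x then 1 else 0) + if ∃ x, StrictMin L ω x then 0 else 1 := by
    intro ω
    have h0 : (0 : ℝ) ≤ ∑ x ∈ Z, (if StrictMin L ω x then 1 else 0) :=
      sum_nonneg fun x _ => by split_ifs <;> norm_num
    by_cases hpc : p ∈ cutTuples A m ω
    · rw [if_pos hpc]
      by_cases hex : ∃ x, StrictMin L ω x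
      · obtain ⟨x, hx⟩ := hex
        have hxZ : x ∈ Z := by
          refine mem_filter.2 ⟨hx.1, fun hall => ?_⟩
          refine (mem_cutTuples.1 hpc).2 ⟨p.2 i₀, fun i => ?_⟩
          refine mem_cell_of_strictMin hx ?_ ⟨i₀, rfl⟩ ⟨i, rfl⟩
          rintro _ ⟨j, rfl⟩
          exact hall j
        rw [if_pos ⟨x, hx⟩, add_zero]
        refine le_trans ?_ (single_le_sum (f := fun x => if StrictMin L ω x then (1 : ℝ) else 0)
          (fun x _ => by split_ifs <;> norm_num) hxZ)
        simp [hx]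
      · rw [if_neg hex]
        linarith
    · rw [if_neg hpc]
      refine add_nonneg h0 (by split_ifs <;> norm_num)
  refine (expect_le_expect (s := univ) fun ω _ => hcut ω).trans ?_
  rw [expect_add_distrib, expect_sum_comm]
  refine add_le_add ?_ ?_
  · have h1 : ∀ x ∈ Z, 𝔼 ω : Copies V M → Fin N, (if StrictMin L ω x then 1 else 0 : ℝ) ≤
        2 / M := by
      intro x _
      have h2 := expect_strictMin_mul_card_le (X := Fin N) L x
      rw [le_div_iff₀ hMR]
      have h3 : 0 ≤ 𝔼 ω : Copies V M → Fin N, (if StrictMin L ω x then 1 else 0 : ℝ) :=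
        expect_nonneg fun ω _ => by split_ifs <;> norm_num
      nlinarith
    refine (sum_le_card_nsmul _ _ _ h1).trans ?_
    rw [nsmul_eq_mul, mul_comm]
    refine mul_le_mul_of_nonneg_left ?_ (by positivity)
    have hZ : Z = univ.filter fun x : Copies V M => (x.2 : ℕ) < m x.1 ∧ p ∈ A.boundary x.1 := by
      ext x
      simp only [Z, L, mem_filter, mem_copiesAt, mem_boundary, mem_univ, true_and,
        Set.exists_range_iff, not_forall, mem_tuples.1 hp]
      tauto
    rw [hZ, card_filter_copies hm (fun S => p ∈ A.boundary S), ← sum_filter]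
    push_cast
    refine (sum_subset (fun S hS => ?_) fun S hS hS' => ?_).ge
    · simpa using (mem_filter.1 hS).2
    · by_contra h0
      exact hS' (mem_filter.2 ⟨mem_clusters.2 (hc S (by exact_mod_cast h0)), (mem_filter.1 hS).2⟩)
  · refine (expect_no_strictMin_le (X := Fin N) hLne).trans ?_
    rw [Fintype.card_fin]
    gcongr

/-- The expected number of cut tuples. -/
theorem expect_card_cut_le {d : ℕ} (hA : ∀ a, A.elementDegree a ≤ d) (hM : 0 < M)
    (hm : ∀ S, m S ≤ M) (hc : ∀ S, m S ≠ 0 → A.IsCluster k S)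
    (hcov : ∀ u, M ≤ 2 * ∑ S ∈ (A.clusters k).filter (u ∈ ·), m S) (hN : 0 < N) :
    𝔼 ω : Copies V M → Fin N, ((cutTuples A m ω).card : ℝ) ≤
      2 / M * ∑ S ∈ A.clusters k, (m S : ℝ) * (A.boundary S).card +
        Fintype.card V * (d * (σ.maxArity * (2 ^ σ.ballBound d k * M) : ℝ) ^ 2 / N) := by
  have h1 : ∀ ω : Copies V M → Fin N, ((cutTuples A m ω).card : ℝ) =
      ∑ p ∈ A.tuples, if p ∈ cutTuples A m ω then 1 else 0 := by
    intro ω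
    rw [← sum_filter, filter_mem_eq_inter, inter_eq_right.2 fun p hp => (mem_cutTuples.1 hp).1]
    simp
  simp only [h1]
  rw [expect_sum_comm]
  refine (sum_le_sum fun p hp => expect_cut_le hA hM hm hc hcov hN hp).trans ?_
  rw [sum_add_distrib, ← mul_sum, sum_comm]
  refine add_le_add (le_of_eq ?_) ?_
  · congr 1
    refine sum_congr rfl fun S _ => ?_
    rw [← sum_filter, sum_const, nsmul_eq_mul, mul_comm]
    congr 3
    ext p
    simp only [mem_filter, mem_tuples, mem_boundary]
    tauto
  · rw [sum_const, nsmul_eq_mul]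
    have h2 : (A.tuples.card : ℝ) ≤ Fintype.card V * d := by exact_mod_cast card_tuples_le hA
    calc (A.tuples.card : ℝ) * ((σ.maxArity * (2 ^ σ.ballBound d k * M) : ℝ) ^ 2 / N)
        ≤ Fintype.card V * d * ((σ.maxArity * (2 ^ σ.ballBound d k * M) : ℝ) ^ 2 / N) := by gcongr
      _ = _ := by ring

end Rounding

section CellStatistics

open Finset RelStr

variable {σ : Schema}

/-! ### Cells are local -/

section Transport

variable {V W : Type} [Fintype V] [Fintype W] [DecidableEq W] {M N k Q r : ℕ}
  {A : RelStr σ V} {B : RelStr σ W} {mA : Finset V → ℕ} {mB : Finset W → ℕ}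

/-- The action of a map on copies of sets. -/
def copyMap (f : V → W) (x : Copies V M) : Copies W M := (x.1.image f, x.2)

theorem copyMap_mem (hk : k ≤ Q) (hr : 2 * k + Q ≤ r)
    (hA : ∀ S, mA S ≠ 0 → A.IsCluster k S) (hm : ∀ S T, SetIso Q A S B T → mA S = mB T)
    {f : V → W} {u : V} (hf : LocalIso A B f (A.ball r u) (B.ball r (f u))) {v : V}
    (hv : v ∈ A.ball k u) {x : Copies V M} (hx : x ∈ copiesAt mA {v}) :
    (x.1 : Set V) ⊆ A.ball r u ∧ copyMap f x ∈ copiesAt mB {f v} := by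
  obtain ⟨h1, h2⟩ := mem_copiesAt_singleton.1 hx
  have hc := hA x.1 (by omega)
  have h3 : A.nbhd Q x.1 ⊆ A.ball r u := fun w hw =>
    ball_mono (show k + (k + Q) ≤ r by omega) u (mem_ball_trans hv (hc.nbhd_subset h2 Q hw))
  have h4 := hf.isCluster hc ((nbhd_mono hk _).trans h3)
  have hfv : f v ∈ B.ball k (f u) := hf.mapsTo_ball (ball_mono (by omega) u) hv
  have h5 : B.nbhd Q (f '' x.1) ⊆ B.ball r (f u) := fun w hw => by
    have := h4.nbhd_subset (mem_image_of_mem f h2) Q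
    rw [coe_image] at this
    exact ball_mono (show k + (k + Q) ≤ r by omega) _ (mem_ball_trans hfv (this hw))
  refine ⟨(subset_nbhd Q _).trans h3, mem_copiesAt_singleton.2 ⟨?_, mem_image_of_mem f h2⟩⟩
  have := hm _ _ (hf.setIso h3 h5)
  rw [copyMap, ← this]
  exact h1

theorem copyMap_injOn {V W : Type} [DecidableEq W] {f : V → W} {L : Set V} (hf : Set.InjOn f L) :
    Set.InjOn (copyMap (M := M) f) {x | (x.1 : Set V) ⊆ L} := by
  rintro ⟨S, i⟩ hS ⟨T, j⟩ hT hST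
  obtain ⟨h1, rfl⟩ := Prod.mk.inj hST
  have h1 : f '' S = f '' T := by
    rw [← coe_image, ← coe_image, h1]
  have := (hf.image_eq_image_iff hS hT).1 h1
  exact Prod.ext (Finset.coe_inj.1 this) rfl

variable [DecidableEq V]

/-- The cells of corresponding elements correspond to each other. -/
theorem image_cell (hk : k ≤ Q) (hr : 2 * k + Q ≤ r)
    (hA : ∀ S, mA S ≠ 0 → A.IsCluster k S) (hB : ∀ S, mB S ≠ 0 → B.IsCluster k S)
    (hm : ∀ S T, SetIso Q A S B T → mA S = mB T)
    {f : V → W} {u : V} (hf : LocalIso A B f (A.ball r u) (B.ball r (f u)))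
    (ω : Copies W M → Fin N) :
    (cell mA (ω ∘ copyMap f) u).image f = cell mB ω (f u) := by
  have : Nonempty V := ⟨u⟩
  have hinj := copyMap_injOn (M := M) hf.1.injOn
  -- corresponding elements are contained in corresponding copies
  have hcopies : ∀ v ∈ A.ball k u,
      copiesAt mB {f v} = (copiesAt mA {v}).image (copyMap (M := M) f) := by
    intro v hv
    refine Finset.Subset.antisymm (fun y hy => ?_) ?_
    · obtain ⟨g, hg, hinv⟩ := hf.exists_symm
      have hgu : g (f u) = u := hinv.1 (A.mem_ball_self r u)
      have hgv : g (f v) = v := hinv.1 (ball_mono (by omega) u hv)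
      have hfv : f v ∈ B.ball k (f u) := hf.mapsTo_ball (ball_mono (by omega) u) hv
      have hg' : LocalIso B A g (B.ball r (f u)) (A.ball r (g (f u))) := by rwa [hgu]
      have := copyMap_mem (mA := mB) (mB := mA) hk hr hB
        (fun S T hST => (hm T S (by
          by_cases hS : Nonempty W
          · exact hST.symm
          · exact absurd ⟨f u⟩ hS)).symm) hg' hfv hy
      refine mem_image.2 ⟨copyMap g y, ?_, ?_⟩
      · rw [← hgv]; exact this.2
      · refine Prod.ext ?_ rfl
        apply Finset.coe_injective
        simp only [copyMap, coe_image, ← Set.image_comp]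
        exact (Set.image_congr fun w hw => hinv.2 (this.1 hw)).trans (Set.image_id' _)
    · exact image_subset_iff.2 fun x hx => (copyMap_mem hk hr hA hm hf hv hx).2
  have hmin : ∀ v ∈ A.ball k u, ∀ x, x ∈ copiesAt mA {v} →
      (StrictMin (copiesAt mB {f v}) ω (copyMap f x) ↔
        StrictMin (copiesAt mA {v}) (ω ∘ copyMap f) x) := by
    intro v hv x hx
    have hsub : ∀ y ∈ copiesAt (M := M) mA {v}, (y.1 : Set V) ⊆ A.ball r u := fun y hy =>
      (copyMap_mem hk hr hA hm hf hv hy).1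
    rw [hcopies v hv]
    unfold StrictMin
    simp only [mem_image_of_mem _ hx, hx, true_and, forall_mem_image, Function.comp_apply]
    refine forall₂_congr fun y hy => ?_
    rw [ne_eq, hinj.eq_iff (hsub y hy) (hsub x hx)]
  ext w
  rw [mem_image, mem_cell]
  have hu : u ∈ A.ball k u := A.mem_ball_self k u
  constructor
  · rintro ⟨v, hv, rfl⟩
    have hvb := cell_subset_ball hA (mem_coe.2 hv)
    refine (mem_cell.1 hv).imp (congrArg f) fun ⟨x, h1, h2⟩ => ⟨copyMap f x, ?_, ?_⟩
    · exact (hmin u hu x h1.1).2 h1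
    · exact (hmin v hvb x h2.1).2 h2
  · rintro (rfl | ⟨y, h1, h2⟩)
    · exact ⟨u, mem_cell_self _ u, rfl⟩
    · have hw : w ∈ B.ball k (f u) :=
        cell_subset_ball hB (mem_coe.2 (mem_cell.2 (Or.inr ⟨y, h1, h2⟩)))
      rw [← hf.image_ball (ball_mono (by omega) u) (ball_mono (by omega) _)] at hw
      obtain ⟨v, hv, rfl⟩ := hw
      have hy1 := h1.1
      have hy2 := h2.1
      rw [hcopies u hu] at hy1
      rw [hcopies v hv] at hy2
      obtain ⟨x, hx, rfl⟩ := mem_image.1 hy1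
      obtain ⟨x', hx', hxx'⟩ := mem_image.1 hy2
      obtain rfl := hinj (copyMap_mem hk hr hA hm hf hv hx').1
        (copyMap_mem hk hr hA hm hf hu hx).1 hxx'
      exact ⟨v, mem_cell.2 (Or.inr ⟨x', (hmin u hu x' hx).1 h1, (hmin v hv x' hx').1 h2⟩), rfl⟩

end Transport

/-! ### Statistics of cells -/

variable {d k Q M : ℕ} (W : WeightRule σ d k Q M)

/-- The probability that the cell of `u` has code `c`. -/
noncomputable def cellProb (N K : ℕ) (c : Code σ K) (D : Database σ) (u : Fin D.size) : ℝ :=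
  𝔼 ω : Copies (Fin D.size) M → Fin N,
    if code K D.str (cell (W.weight D.str) ω u) = c then 1 else 0

theorem cellProb_eq {N K : ℕ} (hN : 0 < N) (hk : k ≤ Q) (c : Code σ K) {D E : Database σ}
    {u : Fin D.size} {u' : Fin E.size} (h : SameNbhd (2 * k + Q) D.str u E.str u') :
    cellProb W N K c D u = cellProb W N K c E u' := by
  have : Nonempty (Fin N) := ⟨⟨0, hN⟩⟩
  obtain ⟨f, hf, rfl⟩ := sameNbhd_iff.1 h
  have hA := W.isCluster D.str
  have hB := W.isCluster E.str
  have hdep : DependsOn (fun ω : Copies (Fin D.size) M → Fin N =>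
      if code K D.str (cell (W.weight D.str) ω u) = c then (1 : ℝ) else 0)
      (copiesAt (W.weight D.str) (D.str.ball k u) : Finset (Copies (Fin D.size) M)) := by
    intro ω ω' hω
    have := dependsOn_cell hA u hω
    simp only at this
    simp only [this]
  have hinj : Set.InjOn (copyMap (M := M) f)
      (copiesAt (W.weight D.str) (D.str.ball k u) : Finset (Copies (Fin D.size) M)) := by
    refine (copyMap_injOn hf.1.injOn).mono fun x hx => ?_
    obtain ⟨h1, v, hv, hvx⟩ := mem_copiesAt.1 (mem_coe.1 hx)
    exact (copyMap_mem (mB := W.weight E.str) hk le_rfl hA (fun S T => W.weight_eq _ _ S T) hf hv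
      (mem_copiesAt_singleton.2 ⟨h1, hvx⟩)).1
  unfold cellProb
  rw [← expect_comp_injOn hdep hinj]
  refine expect_congr rfl fun ω _ => ?_
  have him := image_cell hk le_rfl hA hB (fun S T => W.weight_eq _ _ S T) hf ω
  have hball : (cell (W.weight D.str) (ω ∘ copyMap f) u : Set _) ⊆
      D.str.ball (2 * k + Q) u := (cell_subset_ball hA).trans (ball_mono (by omega) u)
  have hball' : (cell (W.weight E.str) ω (f u) : Set _) ⊆
      E.str.ball (2 * k + Q) (f u) := (cell_subset_ball hB).trans (ball_mono (by omega) _)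
  have hiso := hf.setIso (t := 0) (S := cell (W.weight D.str) (ω ∘ copyMap f) u)
    (by rwa [nbhd_zero]) (by rwa [nbhd_zero, ← coe_image, him])
  rw [him] at hiso
  rw [code_eq_of_setIso ⟨u, mem_cell_self _ u⟩ hiso]

theorem cellProb_mem {N K : ℕ} (hN : 0 < N) (c : Code σ K) (D : Database σ) (u : Fin D.size) :
    0 ≤ cellProb W N K c D u ∧ cellProb W N K c D u ≤ 1 := by
  have : Nonempty (Fin N) := ⟨⟨0, hN⟩⟩
  refine ⟨expect_nonneg fun ω _ => by split_ifs <;> norm_num, ?_⟩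
  refine (expect_le_expect (g := fun _ => (1 : ℝ)) fun ω _ => ?_).trans
    (Fintype.expect_const _).le
  split_ifs <;> norm_num

/-- The number of elements in cells with code `c`. -/
noncomputable def cellCount {N K : ℕ} (c : Code σ K) (D : Database σ)
    (ω : Copies (Fin D.size) M → Fin N) : ℕ :=
  (univ.filter fun u => code K D.str (cell (W.weight D.str) ω u) = c).card

/-- The numbers of elements in cells of the various codes have small variance. -/
theorem expect_sq_cellCount_le {N K : ℕ} (hN : 0 < N) (c : Code σ K) {D : Database σ}
    (hD : D.degree ≤ d) :
    𝔼 ω : Copies (Fin D.size) M → Fin N,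
      ((cellCount W c D ω : ℝ) - ∑ u, cellProb W N K c D u) ^ 2 ≤
        D.size * σ.ballBound d (3 * k) := by
  have : Nonempty (Fin N) := ⟨⟨0, hN⟩⟩
  let Y : Fin D.size → (Copies (Fin D.size) M → Fin N) → ℝ := fun u ω =>
    if code K D.str (cell (W.weight D.str) ω u) = c then 1 else 0
  have hY : ∀ ω, (cellCount W c D ω : ℝ) = ∑ u, Y u ω := by
    intro ω
    simp [cellCount, Y]
  have hdepY : ∀ u, DependsOn (Y u) (copiesAt (W.weight D.str) (D.str.ball k u) :
      Finset (Copies (Fin D.size) M)) := by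
    intro u ω ω' hω
    have := dependsOn_cell (W.isCluster D.str) u hω
    simp only at this
    simp only [Y, this]
  have h := expect_sq_sub_le Y (fun u v => v ∈ D.str.ball (3 * k) u)
    (fun u ω => by simp only [Y]; split_ifs <;> norm_num)
    (fun u ω => by simp only [Y]; split_ifs <;> norm_num)
    (fun u v huv => expect_mul_of_disjoint (disjoint_copiesAt (W.isCluster D.str) huv)
      (hdepY u) (hdepY v))
  simp only [hY]
  refine h.trans ((sum_le_card_nsmul _ _ (σ.ballBound d (3 * k) : ℝ) fun u _ => ?_).trans ?_)
  · have := ncard_ball_le (Database.elementDegree_le hD) (3 * k) u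
    rw [Set.ncard_eq_toFinset_card'] at this
    refine Nat.cast_le.2 (le_of_eq_of_le ?_ this)
    congr 1
    ext v
    simp
  · simp

/-- By Markov's inequality, two non-negative functions are simultaneously at most twice their
means. -/
theorem exists_le_of_expect_le {Ω : Type*} [Fintype Ω] [Nonempty Ω] {f g : Ω → ℝ} {a b : ℝ}
    (hf : ∀ ω, 0 ≤ f ω) (hg : ∀ ω, 0 ≤ g ω) (ha : 0 < a) (hb : 0 < b) (hfa : 𝔼 ω, f ω ≤ a)
    (hgb : 𝔼 ω, g ω ≤ b) : ∃ ω, f ω ≤ 2 * a ∧ g ω ≤ 2 * b := by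
  by_contra! hcon
  have h1 : ∀ ω, 1 < f ω / (2 * a) + g ω / (2 * b) := by
    intro ω
    have hf' := hf ω
    have hg' := hg ω
    by_cases h : f ω ≤ 2 * a
    · have := hcon ω h
      have h2 : 1 < g ω / (2 * b) := by rwa [lt_div_iff₀ (by positivity), one_mul]
      have h3 : 0 ≤ f ω / (2 * a) := by positivity
      linarith
    · have h2 : 1 < f ω / (2 * a) := by
        rw [lt_div_iff₀ (by positivity), one_mul]
        linarith
      have h3 : 0 ≤ g ω / (2 * b) := by positivity
      linarith
  have h2 : 𝔼 _ω : Ω, (1 : ℝ) < 𝔼 ω, (f ω / (2 * a) + g ω / (2 * b)) :=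
    expect_lt_expect (fun ω _ => (h1 ω).le) ⟨Classical.arbitrary Ω, mem_univ _, h1 _⟩
  rw [Fintype.expect_const, expect_add_distrib, ← expect_div, ← expect_div] at h2
  have h3 : (𝔼 ω, f ω) / (2 * a) ≤ 1 / 2 := by
    rw [div_le_div_iff₀ (by positivity) two_pos]
    linarith
  have h4 : (𝔼 ω, g ω) / (2 * b) ≤ 1 / 2 := by
    rw [div_le_div_iff₀ (by positivity) two_pos]
    linarith
  linarith

/-- Some choice of the labels cuts few tuples and has nearly the expected number of elements in
cells of every code. -/
theorem exists_labels {N K : ℕ} (hN : 0 < N) {D : Database σ} (hD : D.degree ≤ d)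
    (hpos : 0 < D.size) {α : ℝ} (hα : 0 < α)
    (hcut : 𝔼 ω : Copies (Fin D.size) M → Fin N,
      ((cutTuples D.str (W.weight D.str) ω).card : ℝ) ≤ α) :
    ∃ ω : Copies (Fin D.size) M → Fin N,
      ((cutTuples D.str (W.weight D.str) ω).card : ℝ) ≤ 2 * α ∧
      (∑ c : Code σ K, |(cellCount W c D ω : ℝ) - ∑ u, cellProb W N K c D u|) ^ 2 ≤
        2 * (Fintype.card (Code σ K)) ^ 2 * σ.ballBound d (3 * k) * D.size := by
  have : Nonempty (Fin N) := ⟨⟨0, hN⟩⟩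
  set T : ℝ := (Fintype.card (Code σ K) : ℝ) with hT
  have hT0 : 0 < T := by
    rw [hT]
    exact_mod_cast Fintype.card_pos
  have hb : (0 : ℝ) < σ.ballBound d (3 * k) := by
    unfold Schema.ballBound
    positivity
  have hn : (0 : ℝ) < D.size := by exact_mod_cast hpos
  obtain ⟨ω, h1, h2⟩ := exists_le_of_expect_le (b := T * (D.size * σ.ballBound d (3 * k)))
    (g := fun ω : Copies (Fin D.size) M → Fin N => ∑ c : Code σ K,
      ((cellCount W c D ω : ℝ) - ∑ u, cellProb W N K c D u) ^ 2)
    (fun ω => Nat.cast_nonneg _) (fun ω => sum_nonneg fun _ _ => sq_nonneg _) hα (by positivity)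
    hcut (by
      rw [expect_sum_comm]
      refine (sum_le_card_nsmul _ _ _ fun c _ => expect_sq_cellCount_le W hN c hD).trans ?_
      rw [nsmul_eq_mul, card_univ])
  refine ⟨ω, h1, ?_⟩
  have h3 := sum_mul_sq_le_sq_mul_sq univ (fun _ : Code σ K => (1 : ℝ))
    fun c => |(cellCount W c D ω : ℝ) - ∑ u, cellProb W N K c D u|
  simp only [one_mul, one_pow, sum_const, card_univ, nsmul_eq_mul, mul_one, sq_abs] at h3
  calc _ ≤ T * _ := h3
    _ ≤ T * (2 * (T * (D.size * σ.ballBound d (3 * k)))) := by gcongr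
    _ = _ := by ring

end CellStatistics

/-! ### Matching the cells of two databases -/

section Matching

open Finset RelStr

/-- Two finite coloured sets can be matched so that, for every colour, the number of unmatched
elements is the surplus over the other set. -/
theorem exists_matching {P P' C : Type*} [DecidableEq P] [DecidableEq P'] (s : Finset P)
    (t : Finset P') (c : P → C) (c' : P' → C) :
    ∃ s' ⊆ s, ∃ t' ⊆ t, (∃ g : s' ≃ t', ∀ p, c' (g p) = c p) ∧
      (∀ a, ((s \ s').filter (c · = a)).card =
        (s.filter (c · = a)).card - (t.filter (c' · = a)).card) ∧
      ∀ a, ((t \ t').filter (c' · = a)).card =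
        (t.filter (c' · = a)).card - (s.filter (c · = a)).card := by
  have h1 : ∀ a, ∃ S ⊆ s.filter (c · = a), S.card =
      min (s.filter (c · = a)).card (t.filter (c' · = a)).card := fun a =>
    exists_subset_card_eq (min_le_left _ _)
  have h2 : ∀ a, ∃ S ⊆ t.filter (c' · = a), S.card =
      min (s.filter (c · = a)).card (t.filter (c' · = a)).card := fun a =>
    exists_subset_card_eq (min_le_right _ _)
  choose S hS hSc using h1
  choose T hT hTc using h2
  have hSmem : ∀ a p, p ∈ S a → c p = a := fun a p hp => (mem_filter.1 (hS a hp)).2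
  have hTmem : ∀ a p, p ∈ T a → c' p = a := fun a p hp => (mem_filter.1 (hT a hp)).2
  have e : ∀ a, S a ≃ T a := fun a => Finset.equivOfCardEq ((hSc a).trans (hTc a).symm)
  refine ⟨s.filter fun p => p ∈ S (c p), filter_subset _ _, t.filter fun q => q ∈ T (c' q),
    filter_subset _ _, ⟨⟨fun p => ⟨e (c p) ⟨p, (mem_filter.1 p.2).2⟩, ?_⟩,
      fun q => ⟨(e (c' q)).symm ⟨q, (mem_filter.1 q.2).2⟩, ?_⟩, fun p => ?_, fun q => ?_⟩,
      fun p => ?_⟩, fun a => ?_, fun a => ?_⟩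
  · have h := (e (c p) ⟨p, (mem_filter.1 p.2).2⟩).2
    refine mem_filter.2 ⟨(mem_filter.1 (hT _ h)).1, ?_⟩
    rwa [hTmem _ _ h]
  · have h := ((e (c' q)).symm ⟨q, (mem_filter.1 q.2).2⟩).2
    refine mem_filter.2 ⟨(mem_filter.1 (hS _ h)).1, ?_⟩
    rwa [hSmem _ _ h]
  · have h := (e (c p) ⟨p, (mem_filter.1 p.2).2⟩).2
    have hc := hTmem _ _ h
    have key : ∀ a (ha : a = c p) (h' : ((e (c p) ⟨p, (mem_filter.1 p.2).2⟩ : T (c p)) : P') ∈ T a),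
        ((e a).symm ⟨_, h'⟩ : P) = p := by
      rintro _ rfl h'
      simp
    exact Subtype.ext (key _ hc _)
  · have h := ((e (c' q)).symm ⟨q, (mem_filter.1 q.2).2⟩).2
    have hc := hSmem _ _ h
    have key : ∀ a (ha : a = c' q)
        (h' : (((e (c' q)).symm ⟨q, (mem_filter.1 q.2).2⟩ : S (c' q)) : P) ∈ S a),
        ((e a) ⟨_, h'⟩ : P') = q := by
      rintro _ rfl h'
      simp
    exact Subtype.ext (key _ hc _)
  · exact hTmem _ _ (e (c p) ⟨p, (mem_filter.1 p.2).2⟩).2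
  · have h : (s \ s.filter fun p => p ∈ S (c p)).filter (c · = a) = s.filter (c · = a) \ S a := by
      ext p
      simp only [mem_filter, mem_sdiff]
      constructor
      · rintro ⟨⟨h1, h2⟩, rfl⟩
        exact ⟨⟨h1, rfl⟩, fun h => h2 ⟨h1, h⟩⟩
      · rintro ⟨⟨h1, rfl⟩, h2⟩
        exact ⟨⟨h1, fun h => h2 h.2⟩, rfl⟩
    rw [h, card_sdiff_of_subset (hS a), hSc]
    omega
  · have h : (t \ t.filter fun p => p ∈ T (c' p)).filter (c' · = a) =
        t.filter (c' · = a) \ T a := by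
      ext p
      simp only [mem_filter, mem_sdiff]
      constructor
      · rintro ⟨⟨h1, h2⟩, rfl⟩
        exact ⟨⟨h1, rfl⟩, fun h => h2 ⟨h1, h⟩⟩
      · rintro ⟨⟨h1, rfl⟩, h2⟩
        exact ⟨⟨h1, fun h => h2 h.2⟩, rfl⟩
    rw [h, card_sdiff_of_subset (hT a), hTc]
    omega

/-- `p` assigns to every element the class of a partition that contains it. -/
structure IsCells {V : Type} (p : V → Finset V) : Prop where
  mem_self : ∀ u, u ∈ p u
  eq_of_mem : ∀ u v, v ∈ p u → p v = p u

theorem isCells_cell {V : Type} [Fintype V] {M N : ℕ} {m : Finset V → ℕ}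
    (ω : Copies V M → Fin N) : IsCells (cell m ω) :=
  ⟨mem_cell_self ω, fun _ _ => cell_eq_of_mem⟩

variable {σ : Schema}

/-- The number of elements in classes with code `c` is the size of `c` times the number of such
classes. -/
theorem IsCells.card_filter_code {V : Type} [Fintype V] [DecidableEq V] {p : V → Finset V}
    (hp : IsCells p) (A : RelStr σ V) {K : ℕ} (hK : ∀ u, (p u).card ≤ K) (c : Code σ K) :
    (univ.filter fun u => code K A (p u) = c).card =
      c.1 * ((univ.image p).filter fun S => code K A S = c).card := by
  have h : (univ.filter fun u => code K A (p u) = c) =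
      ((univ.image p).filter fun S => code K A S = c).biUnion id := by
    ext u
    simp only [mem_filter, mem_univ, true_and, mem_biUnion, mem_image, id]
    constructor
    · exact fun hu => ⟨p u, ⟨⟨u, rfl⟩, hu⟩, hp.mem_self u⟩
    · rintro ⟨_, ⟨⟨v, rfl⟩, hv⟩, hu⟩
      rwa [hp.eq_of_mem v u hu]
  rw [h, card_biUnion]
  · rw [sum_const_nat (m := (c.1 : ℕ)), mul_comm]
    intro S hS
    obtain ⟨hS', rfl⟩ := mem_filter.1 hS
    obtain ⟨u, -, rfl⟩ := mem_image.1 hS'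
    exact (card_code A (hK u)).symm
  · intro S hS T hT hST
    obtain ⟨u, -, rfl⟩ := mem_image.1 (mem_filter.1 hS).1
    obtain ⟨v, -, rfl⟩ := mem_image.1 (mem_filter.1 hT).1
    refine disjoint_left.2 fun w hw hw' => hST ?_
    rw [← hp.eq_of_mem u w hw, hp.eq_of_mem v w hw']

/-- The number of elements outside the classes in `s`, counted by the codes of their classes. -/
theorem IsCells.card_compl_le {V : Type} [Fintype V] [DecidableEq V] {p : V → Finset V}
    (hp : IsCells p) (A : RelStr σ V) {K : ℕ} (hK : ∀ u, (p u).card ≤ K) {s : Finset (Finset V)} :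
    ((univ.filter fun u => p u ∈ s)ᶜ).card ≤ ∑ c : Code σ K,
      c.1 * (((univ.image p) \ s).filter fun S => code K A S = c).card := by
  have h : (univ.filter fun u => p u ∈ s)ᶜ = univ.filter fun u => p u ∉ s := by
    ext u; simp
  rw [h, card_eq_sum_card_fiberwise (f := fun u => code K A (p u)) (t := univ)
    fun _ _ => mem_coe.2 (mem_univ _)]
  refine sum_le_sum fun c _ => ?_
  have h2 : ((univ.filter fun u => p u ∉ s).filter fun u => code K A (p u) = c) ⊆
      (((univ.image p) \ s).filter fun S => code K A S = c).biUnion id := by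
    intro u hu
    simp only [mem_filter, mem_univ, true_and] at hu
    simp only [mem_biUnion, mem_filter, mem_sdiff, mem_image, mem_univ, true_and, id]
    exact ⟨p u, ⟨⟨⟨u, rfl⟩, hu.1⟩, hu.2⟩, hp.mem_self u⟩
  refine (card_le_card h2).trans (card_biUnion_le.trans ?_)
  rw [sum_const_nat (m := (c.1 : ℕ)), mul_comm]
  intro S hS
  obtain ⟨hS', rfl⟩ := mem_filter.1 hS
  obtain ⟨u, -, rfl⟩ := mem_image.1 (mem_sdiff.1 hS').1
  exact (card_code A (hK u)).symm

/-- Databases with partitions into small classes that cut few tuples, and with nearly the same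
number of classes of each isomorphism type, are close. -/
theorem distPM_le_of_isCells {D E : Database σ} (hE0 : 0 < E.size)
    {p : Fin D.size → Finset (Fin D.size)} {q : Fin E.size → Finset (Fin E.size)} (hp : IsCells p)
    (hq : IsCells q) {K : ℕ} (hpK : ∀ u, (p u).card ≤ K) (hqK : ∀ u, (q u).card ≤ K) :
    (distPM D E : ℝ) ≤
      (D.str.tuples.filter fun x => ¬ ∃ u, ∀ i, x.2 i ∈ p u).card +
      (E.str.tuples.filter fun x => ¬ ∃ u, ∀ i, x.2 i ∈ q u).card +
      2 * ∑ c : Code σ K, |((univ.filter fun u => code K D.str (p u) = c).card : ℝ) -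
        (univ.filter fun u => code K E.str (q u) = c).card| := by
  obtain ⟨s, hs, t, ht, ⟨g, hg⟩, hsc, htc⟩ := exists_matching (univ.image p) (univ.image q)
    (code K D.str) (code K E.str)
  have hsp : ∀ S ∈ s, ∀ u ∈ S, p u = S := by
    intro S hS u hu
    obtain ⟨v, -, rfl⟩ := mem_image.1 (hs hS)
    exact hp.eq_of_mem v u hu
  have htq : ∀ S ∈ t, ∀ u ∈ S, q u = S := by
    intro S hS u hu
    obtain ⟨v, -, rfl⟩ := mem_image.1 (ht hS)
    exact hq.eq_of_mem v u hu
  have hiso : ∀ S : s, ∃ h : Fin D.size → Fin E.size,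
      LocalIso D.str E.str h (S : Finset (Fin D.size)) (g S : Finset (Fin E.size)) := by
    intro S
    obtain ⟨v, -, hv⟩ := mem_image.1 (hs S.2)
    obtain ⟨w, -, hw⟩ := mem_image.1 (ht (g S).2)
    obtain ⟨h, hh, -⟩ := setIso_of_code_eq (A := D.str) (B := E.str) (K := K)
      (S := (S : Finset (Fin D.size))) (T := (g S : Finset (Fin E.size)))
      (hv ▸ ⟨v, hp.mem_self v⟩) (hv ▸ hpK v) (hw ▸ hqK w) (hg S).symm
    rw [nbhd_zero, nbhd_zero] at hh
    exact ⟨h, hh⟩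
  choose h hh using hiso
  let f : Fin D.size → Fin E.size := fun u => if hu : p u ∈ s then h ⟨p u, hu⟩ u else ⟨0, hE0⟩
  have hf : ∀ (S : s) (u), u ∈ (S : Finset (Fin D.size)) → f u = h S u := by
    intro S u hu
    have h1 := hsp S S.2 u hu
    have h2 : p u ∈ s := h1 ▸ S.2
    have h3 : (⟨p u, h2⟩ : s) = S := Subtype.ext h1
    simp only [f, dif_pos h2, h3]
  have hmaps : ∀ (S : s) (u), u ∈ (S : Finset (Fin D.size)) →
      f u ∈ (g S : Finset (Fin E.size)) := by
    intro S u hu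
    rw [hf S u hu]
    exact (hh S).1.mapsTo hu
  -- elements with images in the same class lie in the same class
  have hcls : ∀ (S : s) (u), p u ∈ s → f u ∈ (g S : Finset (Fin E.size)) →
      u ∈ (S : Finset (Fin D.size)) := by
    intro S u hu hfu
    have h1 := hmaps ⟨p u, hu⟩ u (hp.mem_self u)
    have h2 : g ⟨p u, hu⟩ = g S := Subtype.ext
      ((htq _ (g _).2 _ h1).symm.trans (htq _ (g _).2 _ hfu))
    rw [← g.injective h2]
    exact hp.mem_self u
  have hbij : Set.BijOn f (univ.filter fun u => p u ∈ s : Finset _)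
      (univ.filter fun u => q u ∈ t : Finset _) := by
    refine ⟨fun u hu => ?_, fun u hu v hv huv => ?_, fun w hw => ?_⟩
    · simp only [coe_filter, mem_univ, true_and, Set.mem_ofPred] at hu ⊢
      have h1 := hmaps ⟨p u, hu⟩ u (hp.mem_self u)
      rw [htq _ (g _).2 _ h1]
      exact (g _).2
    · simp only [coe_filter, mem_univ, true_and, Set.mem_ofPred] at hu hv
      have h1 := hmaps ⟨p u, hu⟩ u (hp.mem_self u)
      have h2 := hcls ⟨p u, hu⟩ v hv (huv ▸ h1)
      rw [hf ⟨p u, hu⟩ u (hp.mem_self u), hf ⟨p u, hu⟩ v h2] at huv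
      exact (hh ⟨p u, hu⟩).1.injOn (hp.mem_self u) h2 huv
    · simp only [coe_filter, mem_univ, true_and, Set.mem_ofPred] at hw
      obtain ⟨S, hS⟩ := g.surjective ⟨q w, hw⟩
      have hw' : w ∈ (g S : Finset (Fin E.size)) := by rw [hS]; exact hq.mem_self w
      obtain ⟨u, hu, rfl⟩ := (hh S).1.surjOn hw'
      refine ⟨u, ?_, hf S u hu⟩
      simp only [coe_filter, mem_univ, true_and, Set.mem_ofPred]
      rw [hsp S S.2 u hu]
      exact S.2
  have hdist := distPM_le hbij
    (X := D.str.tuples.filter fun x => ¬ ∃ u, ∀ i, x.2 i ∈ p u)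
    (Y := E.str.tuples.filter fun x => ¬ ∃ u, ∀ i, x.2 i ∈ q u)
    (filter_subset _ _) (filter_subset _ _) (by
      intro R x hx
      simp only [mem_filter, mem_univ, true_and] at hx
      simp only [eraseTuples, mem_filter, mem_tuples, not_and, not_not, Set.mem_ofPred]
      let i₀ : Fin (σ.arity R) := ⟨0, σ.arity_pos R⟩
      have key : ∀ S : s, (∀ i, x i ∈ (S : Finset (Fin D.size))) →
          (x ∈ D.str.rel R ↔ f ∘ x ∈ E.str.rel R) := by
        intro S hS
        rw [(hh S).2 R x hS]
        exact iff_of_eq (congrArg (· ∈ E.str.rel R) (funext fun i => (hf S _ (hS i)).symm))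
      constructor
      · rintro ⟨h1, h2⟩
        obtain ⟨u, hu⟩ := h2 h1
        have hi : ∀ i, x i ∈ p (x i₀) := fun i => by
          rw [hp.eq_of_mem u _ (hu i₀)]
          exact hu i
        refine ⟨(key ⟨_, hx i₀⟩ hi).1 h1, fun _ => ⟨f (x i₀), fun i => ?_⟩⟩
        have h3 := hmaps ⟨_, hx i₀⟩ _ (hi i)
        have h4 := hmaps ⟨_, hx i₀⟩ _ (hi i₀)
        rw [htq _ (g _).2 _ h4]
        exact h3
      · rintro ⟨h1, h2⟩
        obtain ⟨w, hw⟩ := h2 h1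
        have h4 := hmaps ⟨_, hx i₀⟩ _ (hp.mem_self (x i₀))
        have h5 : q w = g ⟨_, hx i₀⟩ := by
          rw [← htq _ (g _).2 _ h4]
          exact (hq.eq_of_mem w _ (hw i₀)).symm
        have hi : ∀ i, x i ∈ p (x i₀) := fun i =>
          hcls ⟨_, hx i₀⟩ (x i) (hx i) (by rw [← h5]; exact hw i)
        exact ⟨(key ⟨_, hx i₀⟩ hi).2 h1, fun _ => ⟨x i₀, hi⟩⟩)
  have hc1 := hp.card_compl_le D.str hpK (s := s)
  have hc2 := hq.card_compl_le E.str hqK (s := t)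
  -- the elements of unmatched classes
  have hsub : ∀ a b c : ℕ, ((a * (b - c) : ℕ) : ℝ) ≤ |((a * b : ℕ) : ℝ) - (a * c : ℕ)| := by
    intro a b c
    rw [Nat.mul_sub]
    rcases le_total (a * b) (a * c) with h | h
    · rw [Nat.sub_eq_zero_of_le h, Nat.cast_zero]
      exact abs_nonneg _
    · rw [Nat.cast_sub h]
      exact le_abs_self _
  have hb1 : (((univ.filter fun u => p u ∈ s)ᶜ).card : ℝ) ≤
      ∑ c : Code σ K, |((univ.filter fun u => code K D.str (p u) = c).card : ℝ) -
        (univ.filter fun u => code K E.str (q u) = c).card| := by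
    refine (Nat.cast_le.2 hc1).trans ?_
    rw [Nat.cast_sum]
    refine sum_le_sum fun c _ => ?_
    rw [hsc, hp.card_filter_code D.str hpK, hq.card_filter_code E.str hqK]
    exact hsub _ _ _
  have hb2 : (((univ.filter fun u => q u ∈ t)ᶜ).card : ℝ) ≤
      ∑ c : Code σ K, |((univ.filter fun u => code K D.str (p u) = c).card : ℝ) -
        (univ.filter fun u => code K E.str (q u) = c).card| := by
    refine (Nat.cast_le.2 hc2).trans ?_
    rw [Nat.cast_sum]
    refine sum_le_sum fun c _ => ?_
    rw [htc, hp.card_filter_code D.str hpK, hq.card_filter_code E.str hqK, abs_sub_comm]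
    exact hsub _ _ _
  have hdist' : (distPM D E : ℝ) ≤ _ := Nat.cast_le.2 hdist
  push_cast at hdist'
  linarith

/-! ### Closeness of databases with similar histograms -/

/-- The local contribution of an element to the total weight of the boundaries of clusters. -/
noncomputable def boundaryWeight {d k Q M : ℕ} (W : WeightRule σ d k Q M) (D : Database σ)
    (u : Fin D.size) : ℝ :=
  ∑ S ∈ (D.str.clusters k).filter (u ∈ ·), W.weight D.str S * (D.str.boundary S).card / S.card

theorem sum_boundaryWeight {d k Q M : ℕ} (W : WeightRule σ d k Q M) (D : Database σ) :
    ∑ u, boundaryWeight W D u =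
      ∑ S ∈ D.str.clusters k, (W.weight D.str S : ℝ) * (D.str.boundary S).card := by
  unfold boundaryWeight
  rw [sum_sum_clusters_mem univ]
  refine sum_congr rfl fun S hS => ?_
  have hpos : (S.card : ℝ) ≠ 0 := by
    exact_mod_cast (card_pos.2 (mem_clusters.1 hS).1).ne'
  simp [hpos]

theorem boundaryWeight_eq {d k Q M : ℕ} (W : WeightRule σ d k Q M) (hk0 : 0 < k) (hk : k ≤ Q)
    {D E : Database σ} {u : Fin D.size} {u' : Fin E.size}
    (h : SameNbhd (2 * k + Q) D.str u E.str u') : boundaryWeight W D u = boundaryWeight W E u' := by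
  refine sum_clusters_eq_of_sameNbhd (Q := Q) (by omega) hk h (fun S => by positivity)
    (fun S => by positivity) fun S T hST => ?_
  rw [W.weight_eq _ _ S T hST, card_boundary_eq_of_setIso (by omega) hST, card_eq_of_setIso hST]

theorem abs_boundaryWeight_le {d k Q M : ℕ} (W : WeightRule σ d k Q M) {D : Database σ}
    (hD : D.degree ≤ d) (u : Fin D.size) :
    |boundaryWeight W D u| ≤ 2 ^ σ.ballBound d k * (M * d) := by
  have hdeg := Database.elementDegree_le hD
  rw [abs_of_nonneg (sum_nonneg fun S _ => by positivity)]
  have h1 : ∀ S ∈ (D.str.clusters k).filter (u ∈ ·),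
      (W.weight D.str S * (D.str.boundary S).card / S.card : ℝ) ≤ M * d := by
    intro S hS
    have hpos : (0 : ℝ) < S.card := by
      exact_mod_cast card_pos.2 (mem_clusters.1 (mem_filter.1 hS).1).1
    rw [div_le_iff₀ hpos, mul_assoc]
    have h2 : (W.weight D.str S : ℝ) ≤ M := by exact_mod_cast W.weight_le _ S
    have h3 : ((D.str.boundary S).card : ℝ) ≤ d * S.card := by
      exact_mod_cast card_boundary_le hdeg S
    gcongr
  refine (sum_le_card_nsmul _ _ _ h1).trans ?_
  rw [nsmul_eq_mul]
  refine mul_le_mul_of_nonneg_right ?_ (by positivity)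
  exact_mod_cast card_clusters_mem_le hdeg u

/-- The bound for the distance from the partitions into cells for given labels. -/
theorem distPM_le_of_labels {d k Q M N K : ℕ} (W : WeightRule σ d k Q M) {D E : Database σ}
    (hE0 : 0 < E.size) (ω : Copies (Fin D.size) M → Fin N) (ω' : Copies (Fin E.size) M → Fin N)
    (hD : ∀ u, (cell (W.weight D.str) ω u).card ≤ K)
    (hE : ∀ u, (cell (W.weight E.str) ω' u).card ≤ K) :
    (distPM D E : ℝ) ≤ (cutTuples D.str (W.weight D.str) ω).card +
      (cutTuples E.str (W.weight E.str) ω').card +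
      2 * ∑ c : Code σ K, |(cellCount W c D ω : ℝ) - cellCount W c E ω'| := by
  have h := distPM_le_of_isCells hE0 (isCells_cell ω) (isCells_cell ω') hD hE
  have h1 : ∀ {F : Database σ} (ω : Copies (Fin F.size) M → Fin N),
      (F.str.tuples.filter fun x => ¬ ∃ u, ∀ i, x.2 i ∈ cell (W.weight F.str) ω u) =
        cutTuples F.str (W.weight F.str) ω := by
    intro F ω
    ext x
    rw [mem_cutTuples, mem_filter]
  rw [h1, h1] at h
  exact h

/-- Two databases with similar histograms are close if a common local rule is cheap on one of
them: the rule is rounded on both, and the resulting cells have similar statistics. -/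
theorem distPM_le_of_weightRule (σ : Schema) (d : ℕ) {k Q M : ℕ} (hk0 : 0 < k) (hk : k ≤ Q)
    (hM : 0 < M) {ε : ℝ} (hε : 0 < ε) : ∃ δ : ℝ, 0 < δ ∧ δ ≤ 1 / 2 ∧ ∃ n₀ : ℕ, 0 < n₀ ∧
      ∀ W : WeightRule σ d k Q M, ∀ D E : Database σ,
      D.degree ≤ d → E.degree ≤ d → n₀ ≤ D.size → histDist d (2 * k + Q) D E ≤ δ * D.size →
      ∑ S ∈ E.str.clusters k, (W.weight E.str S : ℝ) * (E.str.boundary S).card ≤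
        ε * M * E.size →
      (distPM D E : ℝ) ≤ 34 * ε * D.size := by
  set K := σ.ballBound d k with hK
  set Λ : ℝ := 2 ^ σ.ballBound d k with hΛ
  set T : ℝ := ((Fintype.card (Code σ K) : ℕ) : ℝ) with hT
  set b : ℝ := ((σ.ballBound d (3 * k) : ℕ) : ℝ) with hb
  have hT0 : 0 < T := by
    rw [hT]
    exact_mod_cast Fintype.card_pos
  have hb0 : 0 < b := by
    rw [hb]
    unfold Schema.ballBound
    positivity
  have hΛ0 : 0 < Λ := by positivity
  have hM0 : (0 : ℝ) < M := by exact_mod_cast hM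
  obtain ⟨N, hN⟩ := exists_nat_gt ((d * (σ.maxArity * (Λ * M)) ^ 2) / ε)
  have hN0 : (0 : ℝ) < N := lt_of_le_of_lt (by positivity) hN
  have hNpos : 0 < N := by exact_mod_cast hN0
  have hτ : d * (σ.maxArity * (Λ * M)) ^ 2 / N ≤ ε := by
    rw [div_le_iff₀ hN0]
    rw [div_lt_iff₀ hε] at hN
    linarith
  obtain ⟨n₀, hn₀⟩ := exists_nat_ge (4 * T ^ 2 * b / ε ^ 2)
  set δ : ℝ := min (1 / 2) (min (ε * M / (Λ * (M * d) + 1)) (ε / T)) with hδ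
  have hδ0 : 0 < δ := by
    refine lt_min (by norm_num) (lt_min (by positivity) (by positivity))
  have hδ1 : δ ≤ 1 / 2 := min_le_left _ _
  have hδ2 : Λ * (M * d) * δ ≤ ε * M := by
    have h1 : δ ≤ ε * M / (Λ * (M * d) + 1) := (min_le_right _ _).trans (min_le_left _ _)
    rw [le_div_iff₀ (by positivity)] at h1
    linarith
  have hδ3 : T * δ ≤ ε := by
    have h1 : δ ≤ ε / T := (min_le_right _ _).trans (min_le_right _ _)
    rw [le_div_iff₀ hT0] at h1
    linarith
  -- The total is `34 * ε * n`: in each database the expected number of cut tuples is at most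
  -- at most `3 * ε * n`, which counts twice.
  refine ⟨δ, hδ0, hδ1, n₀ + 1, by omega, fun W D E hD hE hn hdist hcost => ?_⟩
  have hdegD := Database.elementDegree_le hD
  have hdegE := Database.elementDegree_le hE
  have hDpos : 0 < D.size := by omega
  set n : ℝ := ((D.size : ℕ) : ℝ) with hndef
  set n' : ℝ := ((E.size : ℕ) : ℝ) with hndef'
  have hn0 : 0 < n := by
    rw [hndef]
    exact_mod_cast hDpos
  have hnn := abs_le.1 ((abs_size_sub_size_le (r := 2 * k + Q) hD hE).trans hdist)
  have hδn : δ * n ≤ 1 / 2 * n := mul_le_mul_of_nonneg_right hδ1 hn0.le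
  have hn'1 : n' ≤ 2 * n := by linarith [hnn.1]
  have hn'0 : 0 < n' := by linarith [hnn.2]
  have hEpos : 0 < E.size := Nat.cast_pos.1 hn'0
  -- the expected numbers of cut tuples
  have hcutE : 𝔼 ω : Copies (Fin E.size) M → Fin N,
      ((cutTuples E.str (W.weight E.str) ω).card : ℝ) ≤ 7 * ε * n := by
    refine (expect_card_cut_le hdegE hM (W.weight_le _) (W.isCluster _)
      (W.le_sum _ hdegE) hNpos).trans ?_
    rw [Fintype.card_fin]
    calc 2 / M * ∑ S ∈ E.str.clusters k, (W.weight E.str S : ℝ) * (E.str.boundary S).card +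
          n' * (d * (σ.maxArity * (Λ * M)) ^ 2 / N)
        ≤ 2 / M * (ε * M * n') + n' * ε := by gcongr
      _ = 3 * ε * n' := by field_simp; ring
      _ ≤ 3 * ε * (2 * n) := by gcongr
      _ ≤ 7 * ε * n := by nlinarith [mul_pos hε hn0]
  have hcostD : ∑ S ∈ D.str.clusters k, (W.weight D.str S : ℝ) * (D.str.boundary S).card ≤
      ε * M * n' + ε * M * n := by
    have h1 := abs_sum_sub_sum_le (r := 2 * k + Q) hD hE (fun F u => boundaryWeight W F u)
      (fun F F' _ _ a b h => boundaryWeight_eq W hk0 hk h)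
      (fun F hF u => abs_boundaryWeight_le W hF u)
    rw [sum_boundaryWeight, sum_boundaryWeight] at h1
    have h2 := (abs_le.1 h1).2
    have h3 : Λ * (M * d) * histDist d (2 * k + Q) D E ≤ ε * M * n :=
      calc Λ * (M * d) * histDist d (2 * k + Q) D E ≤ Λ * (M * d) * (δ * n) := by gcongr
        _ = Λ * (M * d) * δ * n := by ring
        _ ≤ ε * M * n := by gcongr
    linarith
  have hcutD : 𝔼 ω : Copies (Fin D.size) M → Fin N,
      ((cutTuples D.str (W.weight D.str) ω).card : ℝ) ≤ 7 * ε * n := by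
    refine (expect_card_cut_le hdegD hM (W.weight_le _) (W.isCluster _)
      (W.le_sum _ hdegD) hNpos).trans ?_
    rw [Fintype.card_fin]
    calc 2 / M * ∑ S ∈ D.str.clusters k, (W.weight D.str S : ℝ) * (D.str.boundary S).card +
          n * (d * (σ.maxArity * (Λ * M)) ^ 2 / N)
        ≤ 2 / M * (ε * M * n' + ε * M * n) + n * ε := by gcongr
      _ = 2 * ε * n' + 3 * ε * n := by field_simp; ring
      _ ≤ 2 * ε * (2 * n) + 3 * ε * n := by gcongr
      _ = 7 * ε * n := by ring
  obtain ⟨ω, hω1, hω2⟩ := exists_labels W (K := K) hNpos hD hDpos (by positivity) hcutD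
  obtain ⟨ω', hω'1, hω'2⟩ := exists_labels W (K := K) hNpos hE hEpos (by positivity) hcutE
  have hKD : ∀ u, (cell (W.weight D.str) ω u).card ≤ K := fun u =>
    (isCluster_cell (W.isCluster D.str)).card_le hdegD
  have hKE : ∀ u, (cell (W.weight E.str) ω' u).card ≤ K := fun u =>
    (isCluster_cell (W.isCluster E.str)).card_le hdegE
  have hfinal := distPM_le_of_labels W hEpos ω ω' hKD hKE
  have hlarge : 4 * T ^ 2 * b * n ≤ (ε * n) ^ 2 := by
    have h1 : 4 * T ^ 2 * b / ε ^ 2 ≤ n := by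
      refine hn₀.trans ?_
      rw [hndef]
      exact_mod_cast (Nat.le_succ n₀).trans hn
    rw [div_le_iff₀ (by positivity)] at h1
    nlinarith [mul_le_mul_of_nonneg_right h1 hn0.le]
  have he1 : ∑ c : Code σ K, |(cellCount W c D ω : ℝ) - ∑ u, cellProb W N K c D u| ≤ ε * n := by
    refine (abs_le_of_sq_le_sq' (hω2.trans ?_) (by positivity)).2
    have : 0 ≤ T ^ 2 * b * n := by positivity
    linarith
  have he2 : ∑ c : Code σ K, |(cellCount W c E ω' : ℝ) - ∑ u, cellProb W N K c E u| ≤ ε * n := by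
    refine (abs_le_of_sq_le_sq' (hω'2.trans ?_) (by positivity)).2
    have : 2 * T ^ 2 * b * n' ≤ 2 * T ^ 2 * b * (2 * n) := by gcongr
    linarith
  have he3 : ∀ c : Code σ K, |∑ u, cellProb W N K c D u - ∑ u, cellProb W N K c E u| ≤ δ * n := by
    intro c
    have h1 := abs_sum_sub_sum_le (r := 2 * k + Q) hD hE (fun F u => cellProb W N K c F u) (c := 1)
      (fun F F' _ _ a b h => cellProb_eq W hNpos hk c h)
      (fun F hF u => by
        have := cellProb_mem W hNpos c F u
        rw [abs_of_nonneg this.1]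
        exact this.2)
    linarith
  have hsum : ∑ c : Code σ K, |(cellCount W c D ω : ℝ) - cellCount W c E ω'| ≤ 3 * (ε * n) := by
    have h1 : ∀ c : Code σ K, |(cellCount W c D ω : ℝ) - cellCount W c E ω'| ≤
        |(cellCount W c D ω : ℝ) - ∑ u, cellProb W N K c D u| +
        |(cellCount W c E ω' : ℝ) - ∑ u, cellProb W N K c E u| + δ * n := by
      intro c
      have h2 := abs_le.1 (he3 c)
      have h3 := abs_le.1 (le_refl |(cellCount W c D ω : ℝ) - ∑ u, cellProb W N K c D u|)
      have h4 := abs_le.1 (le_refl |(cellCount W c E ω' : ℝ) - ∑ u, cellProb W N K c E u|)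
      rw [abs_le]
      constructor <;> linarith [h2.1, h2.2, h3.1, h3.2, h4.1, h4.2]
    refine (sum_le_sum fun c _ => h1 c).trans ?_
    rw [sum_add_distrib, sum_add_distrib, sum_const, card_univ, nsmul_eq_mul]
    have h5 : T * (δ * n) ≤ ε * n := by
      rw [← mul_assoc]
      gcongr
    linarith
  linarith

/-- Databases of degree at most `d` whose histograms are close to the histogram of a hyperfinite
database are close to this database. -/
theorem exists_isClose_of_histDist_le (σ : Schema) {d : ℕ} (hd : 0 < d) (ρ : ℝ → ℕ) {ε : ℝ}
    (hε : 0 < ε) : ∃ r : ℕ, ∃ δ : ℝ, 0 < δ ∧ ∃ n₀ : ℕ, ∀ D E : Database σ,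
      D.degree ≤ d → E.degree ≤ d → n₀ ≤ D.size →
      (∀ ε ∈ Set.Ioc (0 : ℝ) 1, ∃ B, IsPartition ε (ρ ε) E B) →
      histDist d r D E ≤ δ * D.size → IsClose d ε D E := by
  -- `34 * (ε / 68) = ε / 2`, since the smaller database has at least half the size of `D`
  obtain ⟨k, Q, M, hk0, hk, hM, hW⟩ := exists_weightRule σ d ρ (show 0 < ε / 68 by positivity)
  obtain ⟨δ, hδ, hδ1, n₀, hn₀, hclose⟩ := distPM_le_of_weightRule σ d hk0 hk hM
    (show 0 < ε / 68 by positivity)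
  refine ⟨2 * k + Q, δ, hδ, n₀, fun D E hD hE hn hyp hdist => ?_⟩
  obtain ⟨W, hcost⟩ := hW E hE hyp
  have h := hclose W D E hD hE hn hdist hcost
  have hnn := abs_le.1 ((abs_size_sub_size_le hD hE).trans hdist)
  have hδn : δ * D.size ≤ 1 / 2 * D.size :=
    mul_le_mul_of_nonneg_right hδ1 (Nat.cast_nonneg _)
  have hd1 : (1 : ℝ) ≤ d := by exact_mod_cast hd
  unfold IsClose
  rw [Nat.cast_min]
  have hmin : (D.size : ℝ) / 2 ≤ min (D.size : ℝ) E.size := by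
    refine le_min ?_ ?_
    · have : (0 : ℝ) ≤ D.size := Nat.cast_nonneg _
      linarith
    · linarith [hnn.2]
  calc (distPM D E : ℝ) ≤ 34 * (ε / 68) * D.size := h
    _ = ε * 1 * (D.size / 2) := by ring
    _ ≤ ε * d * min (D.size : ℝ) E.size := by gcongr

end Matching

/-! ### Loop-free programs and their machines -/

/-- Loop-free programs, in the form of decision trees: every node is an instruction of the machine,
and its children are the possible continuations. -/
inductive Prog (σ : Schema) : Type
  | halt (b : Bool)
  | const (dst c : ℕ) (next : Prog σ)
  | sample (dst a : ℕ) (next : Prog σ)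
  | query (R : Fin σ.numRel) (i j dst : ℕ) (next : Prog σ)
  | branch (a b : ℕ) (yes no : Prog σ)

namespace Prog

variable {σ : Schema}

/-- The largest number of steps before the program halts. -/
def height : Prog σ → ℕ
  | halt _ => 0
  | const _ _ p => p.height + 1
  | sample _ _ p => p.height + 1
  | query _ _ _ _ p => p.height + 1
  | branch _ _ p q => max p.height q.height + 1

/-- The subprograms of a program; they serve as the labels of the machine. -/
def subs : Prog σ → Set (Prog σ)
  | halt b => {halt b}
  | const dst c p => insert (const dst c p) p.subs
  | sample dst a p => insert (sample dst a p) p.subs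
  | query R i j dst p => insert (query R i j dst p) p.subs
  | branch a b p q => insert (branch a b p q) (p.subs ∪ q.subs)

theorem finite_subs : ∀ p : Prog σ, p.subs.Finite
  | halt _ => Set.finite_singleton _
  | const _ _ p => p.finite_subs.insert _
  | sample _ _ p => p.finite_subs.insert _
  | query _ _ _ _ p => p.finite_subs.insert _
  | branch _ _ p q => (p.finite_subs.union q.finite_subs).insert _

theorem self_mem_subs (p : Prog σ) : p ∈ p.subs := by
  cases p <;> simp [subs]

theorem subs_subset {p q : Prog σ} (h : p ∈ q.subs) : p.subs ⊆ q.subs := by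
  induction q with
  | halt b =>
    obtain rfl : p = halt b := h
    exact subset_rfl
  | const dst c q ih =>
    rcases h with rfl | h
    · exact subset_rfl
    · exact (ih h).trans (Set.subset_insert _ _)
  | sample dst a q ih =>
    rcases h with rfl | h
    · exact subset_rfl
    · exact (ih h).trans (Set.subset_insert _ _)
  | query R i j dst q ih =>
    rcases h with rfl | h
    · exact subset_rfl
    · exact (ih h).trans (Set.subset_insert _ _)
  | branch a b q q' ih ih' =>
    rcases h with rfl | h | h
    · exact subset_rfl
    · exact (ih h).trans (Set.subset_union_left.trans (Set.subset_insert _ _))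
    · exact (ih' h).trans (Set.subset_union_right.trans (Set.subset_insert _ _))

/-- The instruction at the root of a program, with labels given by `f`. -/
def toInstr {L : Type} (f : Prog σ → L) : Prog σ → Instr σ L
  | halt true => .accept
  | halt false => .reject
  | const dst c p => .const dst c (f p)
  | sample dst a p => .sample dst a (f p)
  | query R i j dst p => .query R i j dst (f p)
  | branch a b p q => .branch a b (f p) (f q)

/-- The label of a subprogram `q` of `p` (a dummy if `q` is not a subprogram). -/
noncomputable def label (p q : Prog σ) : p.subs :=
  if h : q ∈ p.subs then ⟨q, h⟩ else ⟨p, p.self_mem_subs⟩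

theorem label_val {p q : Prog σ} (h : q ∈ p.subs) : (p.label q : Prog σ) = q := by
  simp [label, h]

/-- The machine that executes a loop-free program. -/
noncomputable def toRAM (p : Prog σ) : RAM σ where
  Label := p.subs
  finite_label := p.finite_subs
  start := ⟨p, p.self_mem_subs⟩
  code q := q.1.toInstr p.label

/-- The distribution of the answer of a program that is started with the given register contents. -/
noncomputable def run (D : Database σ) : Prog σ → (ℕ → ℕ) → PMF Bool
  | halt b, _ => PMF.pure b
  | const dst c p, reg => p.run D (Function.update reg dst c)
  | sample dst a p, reg =>
      (RAM.uniformBelow (reg a)).bind fun x => p.run D (Function.update reg dst x)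
  | query R i j dst p, reg => p.run D (RAM.writeAnswer reg dst (D.answer R (reg i) (reg j)))
  | branch a b p q, reg => if reg a ≤ reg b then p.run D reg else q.run D reg

end Prog

namespace RAM

variable {σ : Schema}

/-- The distribution of the configuration after `k` steps from the configuration `c`. -/
noncomputable def runFrom (M : RAM σ) (D : Database σ) : ℕ → M.Config → PMF M.Config
  | 0, c => PMF.pure c
  | k + 1, c => (M.step D c).bind (M.runFrom D k)

theorem run_bind_runFrom (M : RAM σ) (D : Database σ) (k l : ℕ) :
    (M.run D k).bind (M.runFrom D l) = M.run D (k + l) := by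
  induction l generalizing k with
  | zero => exact PMF.bind_pure _
  | succ l ih =>
    rw [show k + (l + 1) = k + 1 + l by ring, ← ih (k + 1), RAM.run, PMF.bind_bind]
    rfl

theorem run_eq_runFrom (M : RAM σ) (D : Database σ) (k : ℕ) :
    M.run D k = M.runFrom D k (M.init D) := by
  have := run_bind_runFrom M D 0 k
  rw [Nat.zero_add, RAM.run, PMF.pure_bind] at this
  exact this.symm

/-- The answer given in a configuration, if the machine has halted. -/
def outcome (M : RAM σ) (c : M.Config) : Option Bool :=
  match M.code c.label with
  | .accept => some true
  | .reject => some false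
  | _ => none

theorem outcome_eq_true {M : RAM σ} {c : M.Config} : M.outcome c = some true ↔ c ∈ M.accepting := by
  unfold outcome accepting
  rw [Set.mem_ofPred]
  cases M.code c.label <;> simp

theorem outcome_eq_false {M : RAM σ} {c : M.Config} :
    M.outcome c = some false ↔ c ∈ M.rejecting := by
  unfold outcome rejecting
  rw [Set.mem_ofPred]
  cases M.code c.label <;> simp

end RAM

namespace Prog

variable {σ : Schema}

/-- At the label of a subprogram, the machine executes the instruction at the root of this
subprogram. -/
theorem step_toRAM {p : Prog σ} (D : Database σ) {q : Prog σ} (hq : q ∈ p.subs) (reg : ℕ → ℕ)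
    (n : ℕ) : p.toRAM.step D ⟨p.label q, reg, n⟩ =
      match q with
      | halt _ => PMF.pure ⟨p.label q, reg, n⟩
      | const dst x next => PMF.pure ⟨p.label next, Function.update reg dst x, n⟩
      | sample dst a next =>
        (RAM.uniformBelow (reg a)).map fun x => ⟨p.label next, Function.update reg dst x, n⟩
      | query R i j dst next =>
        PMF.pure ⟨p.label next, RAM.writeAnswer reg dst (D.answer R (reg i) (reg j)), n + 1⟩
      | branch a b yes no =>
        PMF.pure (if reg a ≤ reg b then ⟨p.label yes, reg, n⟩ else ⟨p.label no, reg, n⟩) := by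
  have h : p.toRAM.code (p.label q) = q.toInstr p.label := by
    change (p.label q : Prog σ).toInstr p.label = _
    rw [label_val hq]
  unfold RAM.step
  simp only
  rw [h]
  rcases q with (_ | _) | _ | _ | _ | ⟨a, b, yes, no⟩
  iterate 5 rfl
  refine congrArg PMF.pure ?_
  have hc := apply_ite (fun l => (⟨l, reg, n⟩ : p.toRAM.Config)) (reg a ≤ reg b) (p.label yes)
    (p.label no)
  exact hc

/-- The machine that starts at the label of a subprogram halts with the answer of the subprogram. -/
theorem map_outcome_runFrom {p : Prog σ} (D : Database σ) (q : Prog σ) (hq : q ∈ p.subs) (k : ℕ)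
    (hk : q.height ≤ k) (reg : ℕ → ℕ) (n : ℕ) :
    (p.toRAM.runFrom D k ⟨p.label q, reg, n⟩).map p.toRAM.outcome = (q.run D reg).map some := by
  induction q generalizing k reg n with
  | halt b =>
    have h : ∀ k, p.toRAM.runFrom D k ⟨p.label (halt b), reg, n⟩ =
        PMF.pure ⟨p.label (halt b), reg, n⟩ := by
      intro k
      induction k with
      | zero => rfl
      | succ k ih => rw [RAM.runFrom, step_toRAM D hq, PMF.pure_bind, ih]
    rw [h, run, PMF.pure_map, PMF.pure_map]
    congr 1
    have h : p.toRAM.code (p.label (halt b)) = (halt b).toInstr p.label := by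
      change (p.label (halt b) : Prog σ).toInstr p.label = _
      rw [label_val hq]
    unfold RAM.outcome
    simp only [h]
    cases b <;> rfl
  | const dst c q ih =>
    obtain ⟨k, rfl⟩ : ∃ k', k = k' + 1 := ⟨k - 1, by simp only [height] at hk; omega⟩
    have hsub : q ∈ p.subs := subs_subset hq (Set.mem_insert_of_mem _ q.self_mem_subs)
    rw [RAM.runFrom, step_toRAM D hq, PMF.pure_bind, run]
    exact ih hsub k (by simpa [height] using hk) _ _
  | sample dst a q ih =>
    obtain ⟨k, rfl⟩ : ∃ k', k = k' + 1 := ⟨k - 1, by simp only [height] at hk; omega⟩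
    have hsub : q ∈ p.subs := subs_subset hq (Set.mem_insert_of_mem _ q.self_mem_subs)
    rw [RAM.runFrom, step_toRAM D hq, run]
    simp only [PMF.bind_map, PMF.map_bind]
    congr 1
    funext x
    exact ih hsub k (by simpa [height] using hk) _ _
  | query R i j dst q ih =>
    obtain ⟨k, rfl⟩ : ∃ k', k = k' + 1 := ⟨k - 1, by simp only [height] at hk; omega⟩
    have hsub : q ∈ p.subs := subs_subset hq (Set.mem_insert_of_mem _ q.self_mem_subs)
    rw [RAM.runFrom, step_toRAM D hq, PMF.pure_bind, run]
    exact ih hsub k (by simpa [height] using hk) _ _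
  | branch a b q q' ih ih' =>
    obtain ⟨k, rfl⟩ : ∃ k', k = k' + 1 := ⟨k - 1, by simp only [height] at hk; omega⟩
    have hsub : q ∈ p.subs := subs_subset hq
      (Set.mem_insert_of_mem _ (Or.inl q.self_mem_subs))
    have hsub' : q' ∈ p.subs := subs_subset hq
      (Set.mem_insert_of_mem _ (Or.inr q'.self_mem_subs))
    simp only [height] at hk
    rw [RAM.runFrom, step_toRAM D hq, PMF.pure_bind, run]
    by_cases h : reg a ≤ reg b
    · simp only [if_pos h]
      exact ih hsub k (by omega) _ _
    · simp only [if_neg h]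
      exact ih' hsub' k (by omega) _ _

theorem queries_le_of_mem_support {p : Prog σ} (D : Database σ) (k : ℕ) (q : Prog σ)
    (hq : q ∈ p.subs) (reg : ℕ → ℕ) (n : ℕ) :
    ∀ c ∈ (p.toRAM.runFrom D k ⟨p.label q, reg, n⟩).support, c.queries ≤ n + q.height := by
  induction k generalizing q reg n with
  | zero =>
    intro c hc
    rw [RAM.runFrom, PMF.support_pure, Set.mem_singleton_iff] at hc
    rw [hc]
    exact Nat.le_add_right _ _
  | succ k ih =>
    intro c hc
    rw [RAM.runFrom, step_toRAM D hq] at hc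
    cases q with
    | halt b =>
      rw [PMF.pure_bind] at hc
      exact ih _ hq _ _ c hc
    | const dst x q =>
      rw [PMF.pure_bind] at hc
      have := ih q (subs_subset hq (Set.mem_insert_of_mem _ q.self_mem_subs)) _ _ c hc
      simp only [height]
      omega
    | sample dst a q =>
      simp only [PMF.bind_map, PMF.mem_support_bind_iff] at hc
      obtain ⟨x, -, hc⟩ := hc
      have := ih q (subs_subset hq (Set.mem_insert_of_mem _ q.self_mem_subs)) _ _ c hc
      simp only [height]
      omega
    | query R i j dst q =>
      rw [PMF.pure_bind] at hc
      have := ih q (subs_subset hq (Set.mem_insert_of_mem _ q.self_mem_subs)) _ _ c hc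
      simp only [height]
      omega
    | branch a b q q' =>
      rw [PMF.pure_bind] at hc
      simp only [height]
      split_ifs at hc
      · have := ih q (subs_subset hq (Set.mem_insert_of_mem _ (Or.inl q.self_mem_subs))) _ _ c hc
        omega
      · have := ih q' (subs_subset hq (Set.mem_insert_of_mem _ (Or.inr q'.self_mem_subs))) _ _ c hc
        omega

/-- The initial contents of the registers. -/
def initReg (n : ℕ) : ℕ → ℕ := Function.update (fun _ => 0) 0 n

theorem init_toRAM (p : Prog σ) (D : Database σ) :
    p.toRAM.init D = ⟨p.label p, initReg D.size, 0⟩ := by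
  have : p.label p = ⟨p, p.self_mem_subs⟩ := Subtype.ext (label_val p.self_mem_subs)
  rw [this]
  rfl

theorem map_outcome_run (p : Prog σ) (D : Database σ) :
    (p.toRAM.run D p.height).map p.toRAM.outcome = (p.run D (initReg D.size)).map some := by
  rw [RAM.run_eq_runFrom, init_toRAM]
  exact map_outcome_runFrom D p p.self_mem_subs _ le_rfl _ _

theorem runsInTime_toRAM (p : Prog σ) (C : Set (Database σ)) :
    p.toRAM.RunsInTime C fun _ => p.height := by
  intro D _ c hc
  have h : p.toRAM.outcome c ∈ ((p.toRAM.run D p.height).map p.toRAM.outcome).support := by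
    rw [PMF.support_map]
    exact Set.mem_image_of_mem _ hc
  rw [map_outcome_run, PMF.support_map] at h
  obtain ⟨b, -, hb⟩ := h
  cases b
  · exact Or.inr (RAM.outcome_eq_false.1 hb.symm)
  · exact Or.inl (RAM.outcome_eq_true.1 hb.symm)

theorem queryComplexityLE_toRAM (p : Prog σ) (C : Set (Database σ)) :
    p.toRAM.QueryComplexityLE C p.height := by
  intro D _ k c hc
  rw [RAM.run_eq_runFrom, init_toRAM] at hc
  simpa using queries_le_of_mem_support D k p p.self_mem_subs _ _ c hc

theorem toOuterMeasure_outcome (p : Prog σ) (D : Database σ) (b : Bool) :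
    (p.toRAM.run D p.height).toOuterMeasure {c | p.toRAM.outcome c = some b} =
      p.run D (initReg D.size) b := by
  have h1 := PMF.toOuterMeasure_map_apply p.toRAM.outcome (p.toRAM.run D p.height) {some b}
  have h2 := PMF.toOuterMeasure_map_apply some (p.run D (initReg D.size)) {some b}
  rw [map_outcome_run] at h1
  rw [h1] at h2
  refine h2.trans ?_
  have : some ⁻¹' {some b} = ({b} : Set Bool) := by ext; simp
  rw [this, PMF.toOuterMeasure_apply_singleton]

theorem le_acceptProb (p : Prog σ) (D : Database σ) :
    p.run D (initReg D.size) true ≤ p.toRAM.acceptProb D := by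
  rw [← toOuterMeasure_outcome]
  refine le_trans (le_of_eq ?_) (le_iSup _ p.height)
  congr 1
  ext c
  exact RAM.outcome_eq_true

theorem le_rejectProb (p : Prog σ) (D : Database σ) :
    p.run D (initReg D.size) false ≤ p.toRAM.rejectProb D := by
  rw [← toOuterMeasure_outcome]
  refine le_trans (le_of_eq ?_) (le_iSup _ p.height)
  congr 1
  ext c
  exact RAM.outcome_eq_false

/-! ### Program blocks -/

/-- Compare the pairs of registers in a list, and answer depending on the results. -/
def compare : List (ℕ × ℕ) → (List Bool → Bool) → Prog σ
  | [], F => halt (F [])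
  | (a, b) :: l, F =>
    branch a b (compare l fun r => F (true :: r)) (compare l fun r => F (false :: r))

theorem run_compare (D : Database σ) (l : List (ℕ × ℕ)) (F : List Bool → Bool) (reg : ℕ → ℕ) :
    (compare l F).run D reg = PMF.pure (F (l.map fun x => decide (reg x.1 ≤ reg x.2))) := by
  induction l generalizing F with
  | nil => rfl
  | cons x l ih =>
    obtain ⟨a, b⟩ := x
    rw [compare, run, ih, ih]
    by_cases h : reg a ≤ reg b <;> simp [h]

/-- Write the constants `0, …, m - 1` to the registers `1, …, m`. -/
def constants : ℕ → Prog σ → Prog σ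
  | 0, p => p
  | m + 1, p => constants m (const (1 + m) m p)

/-- The register contents after `constants m`. -/
def putConstants (m : ℕ) (reg : ℕ → ℕ) (x : ℕ) : ℕ := if 1 ≤ x ∧ x ≤ m then x - 1 else reg x

theorem run_constants (D : Database σ) (m : ℕ) (p : Prog σ) (reg : ℕ → ℕ) :
    (constants m p).run D reg = p.run D (putConstants m reg) := by
  induction m generalizing p with
  | zero =>
    congr 1
    funext x
    simp only [putConstants]
    rw [if_neg (by omega)]
  | succ m ih =>
    rw [constants, ih, run]
    congr 1
    funext x
    simp only [putConstants, Function.update_apply]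
    split_ifs <;> omega

/-- Sample `s` elements and write them to the registers `t, …, t + s - 1`. -/
def samples : ℕ → ℕ → Prog σ → Prog σ
  | _, 0, p => p
  | t, s + 1, p => sample t 0 (samples (t + 1) s p)

/-- The register contents after the elements `a` were sampled. -/
def putSamples (t : ℕ) {s : ℕ} (a : Fin s → ℕ) (reg : ℕ → ℕ) (x : ℕ) : ℕ :=
  if h : t ≤ x ∧ x - t < s then a ⟨x - t, h.2⟩ else reg x

theorem putSamples_cons (t : ℕ) {s : ℕ} (y : ℕ) (a : Fin s → ℕ) (reg : ℕ → ℕ) :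
    putSamples t (Fin.cons y a : Fin (s + 1) → ℕ) reg =
      putSamples (t + 1) a (Function.update reg t y) := by
  funext x
  simp only [putSamples, Function.update_apply]
  by_cases hx : x = t
  · subst hx
    simp
  · by_cases h : t ≤ x ∧ x - t < s + 1
    · have h' : t + 1 ≤ x ∧ x - (t + 1) < s := by omega
      rw [dif_pos h, dif_pos h']
      have : (⟨x - t, h.2⟩ : Fin (s + 1)) = Fin.succ ⟨x - (t + 1), h'.2⟩ := by
        ext
        simp only [Fin.val_succ]
        omega
      rw [this, Fin.cons_succ]
    · have h' : ¬ (t + 1 ≤ x ∧ x - (t + 1) < s) := by omega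
      rw [dif_neg h, dif_neg h', if_neg hx]

/-- The probability of an answer is the fraction of the samples that lead to it. -/
theorem run_samples (D : Database σ) {p : Prog σ} {G : (ℕ → ℕ) → Bool}
    (hp : ∀ reg, p.run D reg = PMF.pure (G reg)) (b : Bool) {n : ℕ} (hn : 0 < n) (s t : ℕ)
    (ht : 0 < t) (reg : ℕ → ℕ) (hreg : reg 0 = n) :
    (samples t s p).run D reg b =
      ((Finset.univ.filter fun a : Fin s → Fin n =>
        G (putSamples t (fun i => (a i : ℕ)) reg) = b).card : ℝ≥0∞) / (n : ℝ≥0∞) ^ s := by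
  induction s generalizing t reg with
  | zero =>
    have : putSamples t (fun i : Fin 0 => (0 : ℕ)) reg = reg := by
      funext x
      simp [putSamples]
    have h0 : ∀ a : Fin 0 → Fin n, putSamples t (fun i => (a i : ℕ)) reg = reg := by
      intro a
      funext x
      simp [putSamples]
    simp only [samples, h0, hp, PMF.pure_apply, pow_zero, div_one]
    by_cases h : G reg = b
    · simp [h]
    · simp [h, Ne.symm h]
  | succ s ih =>
    have hstep : ∀ x, (samples (t + 1) s p).run D (Function.update reg t x) b =
        ((Finset.univ.filter fun a : Fin s → Fin n =>
          G (putSamples (t + 1) (fun i => (a i : ℕ)) (Function.update reg t x)) = b).card :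
            ℝ≥0∞) / (n : ℝ≥0∞) ^ s := fun x => ih (t + 1) (Nat.succ_pos t) _ (by
      rw [Function.update_of_ne ht.ne]
      exact hreg)
    have hcard : (Finset.univ.filter fun a : Fin (s + 1) → Fin n =>
        G (putSamples t (fun i => (a i : ℕ)) reg) = b).card =
        ∑ x : Fin n, (Finset.univ.filter fun a : Fin s → Fin n =>
          G (putSamples (t + 1) (fun i => (a i : ℕ)) (Function.update reg t x)) = b).card := by
      simp only [Finset.card_filter]
      rw [← Fintype.sum_equiv (Fin.consEquiv fun _ : Fin (s + 1) => Fin n) (fun xa => if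
        G (putSamples (t + 1) (fun i => (xa.2 i : ℕ)) (Function.update reg t xa.1)) = b then 1
        else 0) _ fun xa => ?_, Fintype.sum_prod_type]
      rw [← putSamples_cons]
      have : (fun i => ((Fin.consEquiv fun _ : Fin (s + 1) => Fin n) xa i : ℕ)) =
          Fin.cons (xa.1 : ℕ) fun i => (xa.2 i : ℕ) := by
        funext i
        refine Fin.cases ?_ (fun i => ?_) i <;> simp [Fin.consEquiv]
      rw [this]
    have hu : ∀ x, RAM.uniformBelow n x = if x < n then (n : ℝ≥0∞)⁻¹ else 0 := by
      intro x
      rw [RAM.uniformBelow, dif_pos hn]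
      refine (PMF.uniformOfFinset_apply _ x).trans ?_
      simp
    rw [samples, run, hreg, PMF.bind_apply]
    simp only [hstep, hu]
    rw [tsum_eq_sum (s := Finset.range n) fun x hx => by
      rw [if_neg (by simpa using hx), zero_mul]]
    rw [Finset.sum_congr rfl fun x hx => by rw [if_pos (Finset.mem_range.1 hx)]]
    rw [hcard, ← Finset.mul_sum, Finset.sum_range fun x => ((Finset.univ.filter
      fun a : Fin s → Fin n => G (putSamples (t + 1) (fun i => (a i : ℕ))
        (Function.update reg t x)) = b).card : ℝ≥0∞) / (n : ℝ≥0∞) ^ s]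
    simp only [div_eq_mul_inv]
    rw [← Finset.sum_mul, pow_succ,
      ENNReal.mul_inv (Or.inr (by simp)) (Or.inr (by simpa using hn.ne')), Nat.cast_sum]
    ring

/-- If the samples do not influence the answer, then the answer is deterministic. -/
theorem run_samples_of_forall (D : Database σ) {p : Prog σ} {G : (ℕ → ℕ) → Bool}
    (hp : ∀ reg, p.run D reg = PMF.pure (G reg)) (b : Bool) (s t : ℕ) (reg : ℕ → ℕ)
    (h : ∀ a : Fin s → ℕ, G (putSamples t a reg) = b) :
    (samples t s p).run D reg = PMF.pure b := by
  induction s generalizing t reg with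
  | zero =>
    have : putSamples t (fun i : Fin 0 => (0 : ℕ)) reg = reg := by
      funext x
      simp [putSamples]
    rw [samples, hp, ← h fun _ => 0, this]
  | succ s ih =>
    have : ∀ x, (samples (t + 1) s p).run D (Function.update reg t x) = PMF.pure b := by
      intro x
      refine ih _ _ fun a => ?_
      rw [← putSamples_cons]
      exact h _
    rw [samples, run]
    simp only [this]
    exact PMF.bind_const _ _

end Prog

/-! ### Exploration of a database by queries -/

namespace Database

variable {σ : Schema}

theorem mem_tuplesAt {D : Database σ} {R : Fin σ.numRel} {i : ℕ}
    {t : Lex (Fin (σ.arity R) → Fin D.size)} :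
    t ∈ D.tuplesAt R i ↔ ofLex t ∈ D.str.rel R ∧ ∃ k, (ofLex t k : ℕ) = i := by
  simp [tuplesAt]

theorem length_tuplesAt_le {d : ℕ} {D : Database σ} (hD : D.degree ≤ d) (R : Fin σ.numRel)
    (a : Fin D.size) : (D.tuplesAt R a).length ≤ d := by
  refine le_trans ?_ (elementDegree_le hD a)
  rw [tuplesAt, Finset.length_sort, ← Set.ncard_eq_toFinset_card]
  have h : {t : Lex (Fin (σ.arity R) → Fin D.size) |
      ofLex t ∈ D.str.rel R ∧ ∃ k, (ofLex t k : ℕ) = a} =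
      toLex '' {t : Fin (σ.arity R) → Fin D.size | t ∈ D.str.rel R ∧ a ∈ Set.range t} := by
    ext t
    constructor
    · rintro ⟨h, k, hk⟩
      exact ⟨ofLex t, ⟨h, k, Fin.ext hk⟩, rfl⟩
    · rintro ⟨t, ⟨h, k, hk⟩, rfl⟩
      exact ⟨h, k, congrArg Fin.val hk⟩
  rw [h, Set.ncard_image_of_injective _ toLex.injective, RelStr.elementDegree]
  exact Finset.single_le_sum (f := fun R => {t ∈ D.str.rel R | a ∈ Set.range t}.ncard)
    (fun _ _ => Nat.zero_le _) (Finset.mem_univ R)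

theorem exists_answer_eq {d : ℕ} {D : Database σ} (hD : D.degree ≤ d) {R : Fin σ.numRel}
    {t : Fin (σ.arity R) → Fin D.size} (ht : t ∈ D.str.rel R) (k : Fin (σ.arity R)) :
    ∃ j : Fin d, D.answer R (t k) j = some (toLex t) := by
  have h : toLex t ∈ D.tuplesAt R (t k) := mem_tuplesAt.2 ⟨ht, k, rfl⟩
  obtain ⟨j, hj, hjt⟩ := List.getElem_of_mem h
  refine ⟨⟨j, hj.trans_le (length_tuplesAt_le hD R (t k))⟩, ?_⟩
  rw [answer, List.getElem?_eq_getElem hj, hjt]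

theorem of_answer_eq {D : Database σ} {R : Fin σ.numRel} {i j : ℕ}
    {t : Lex (Fin (σ.arity R) → Fin D.size)} (h : D.answer R i j = some t) :
    ofLex t ∈ D.str.rel R ∧ ∃ k, (ofLex t k : ℕ) = i :=
  mem_tuplesAt.1 (List.mem_of_getElem? h)

end Database

/-- The first register for the answer to the query for the `j`-th tuple of `R` that contains the
element in the register `x`. -/
def Schema.addr (σ : Schema) (d N x : ℕ) (R : Fin σ.numRel) (j : Fin d) : ℕ :=
  N + (σ.maxArity + 1) * (σ.numRel * d * x + finProdFinEquiv (R, j))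

theorem Schema.addr_lt (σ : Schema) {d N x X : ℕ} (hx : x < X) (R : Fin σ.numRel) (j : Fin d)
    (k : ℕ) (hk : k < σ.arity R) :
    σ.addr d N x R j + 1 + k < N + (σ.maxArity + 1) * (σ.numRel * d * X) := by
  have h1 : σ.numRel * d * x + finProdFinEquiv (R, j) + 1 ≤ σ.numRel * d * X := by
    have := (finProdFinEquiv (R, j)).2
    calc _ ≤ σ.numRel * d * x + σ.numRel * d := by omega
      _ = σ.numRel * d * (x + 1) := by ring
      _ ≤ _ := Nat.mul_le_mul_left _ hx
  have h2 := Nat.mul_le_mul_left (σ.maxArity + 1) h1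
  have h3 := hk.trans_le (σ.arity_le R)
  rw [Schema.addr]
  rw [mul_add, mul_one] at h2
  omega

variable {σ : Schema} {d : ℕ}

/-- The registers `F` contain the answers to all queries about the elements in the registers
below `X`. -/
def IsExploration (D : Database σ) (d N X : ℕ) (F : ℕ → ℕ) : Prop :=
  ∀ x < X, ∀ R, ∀ j : Fin d,
    (D.answer R (F x) j = none → F (σ.addr d N x R j) = 0) ∧
    ∀ t, D.answer R (F x) j = some t → F (σ.addr d N x R j) = 1 ∧
      ∀ k : Fin (σ.arity R), F (σ.addr d N x R j + 1 + k) = ofLex t k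

/-- The registers that contain the elements at distance at most `l` from the element in the
register `w`. -/
def Reaches (σ : Schema) (d N : ℕ) (F : ℕ → ℕ) (w : ℕ) : ℕ → ℕ → Prop
  | 0, x => x = w
  | l + 1, x => Reaches σ d N F w l x ∨ ∃ x₀ R, ∃ j : Fin d, ∃ k : Fin (σ.arity R),
      Reaches σ d N F w l x₀ ∧ F (σ.addr d N x₀ R j) = 1 ∧ x = σ.addr d N x₀ R j + 1 + k

/-- A bound for the registers that contain elements at distance at most `l` from the element in a
register below `X`. -/
def reachBound (σ : Schema) (d N X : ℕ) : ℕ → ℕ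
  | 0 => X
  | l + 1 => reachBound σ d N X l + (N + (σ.maxArity + 1) * (σ.numRel * d * reachBound σ d N X l))

/-- The first `Y` registers have the same order pattern. -/
def SamePattern (Y : ℕ) (F G : ℕ → ℕ) : Prop := ∀ x < Y, ∀ y < Y, F x ≤ F y ↔ G x ≤ G y

theorem SamePattern.eq_iff {Y : ℕ} {F G : ℕ → ℕ} (h : SamePattern Y F G) {x y : ℕ} (hx : x < Y)
    (hy : y < Y) : F x = F y ↔ G x = G y := by
  rw [le_antisymm_iff, le_antisymm_iff, h x hx y hy, h y hy x hx]

theorem SamePattern.symm {Y : ℕ} {F G : ℕ → ℕ} (h : SamePattern Y F G) : SamePattern Y G F :=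
  fun x hx y hy => (h x hx y hy).symm

theorem reachBound_mono (σ : Schema) (d N X : ℕ) : Monotone (reachBound σ d N X) :=
  monotone_nat_of_le_succ fun _ => Nat.le_add_right _ _

theorem Reaches.lt_reachBound {N X : ℕ} {F : ℕ → ℕ} {w : ℕ} (hw : w < X) {l x : ℕ}
    (h : Reaches σ d N F w l x) : x < reachBound σ d N X l := by
  induction l generalizing x with
  | zero =>
    rw [show x = w from h]
    exact hw
  | succ l ih =>
    rcases h with h | ⟨x₀, R, j, k, h, -, rfl⟩
    · exact (ih h).trans_le (Nat.le_add_right _ _)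
    · exact (σ.addr_lt (ih h) R j k k.2).trans_le (Nat.le_add_left _ _)

theorem reaches_iff {N X Y r : ℕ} {F G : ℕ → ℕ} {w z : ℕ} (hw : w < X) (hz : z < Y)
    (hY : reachBound σ d N X r ≤ Y) (h : SamePattern Y F G) (hF : F z = 1) (hG : G z = 1) {l : ℕ}
    (hl : l ≤ r) {x : ℕ} : Reaches σ d N F w l x ↔ Reaches σ d N G w l x := by
  induction l generalizing x with
  | zero => exact Iff.rfl
  | succ l ih =>
    have ih' := fun {x} => ih (by omega) (x := x)
    refine or_congr ih' (exists_congr fun x₀ => exists_congr fun R => exists_congr fun j =>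
      exists_congr fun k => ?_)
    rw [ih']
    refine and_congr_right fun h₀ => and_congr_left fun _ => ?_
    have h1 := (σ.addr_lt (d := d) (N := N) (h₀.lt_reachBound hw) R j k k.2).trans_le
      (((Nat.le_add_left _ _).trans (reachBound_mono σ d N X hl)).trans hY)
    have h2 := h.eq_iff (show σ.addr d N x₀ R j < Y by omega) hz
    rwa [hF, hG] at h2

section

variable {D : Database σ} {N X Y r : ℕ} {F G : ℕ → ℕ}

theorem IsExploration.answer_eq (hF : IsExploration D d N X F) {x : ℕ} (hx : x < X)
    {R : Fin σ.numRel} {j : Fin d} (h : F (σ.addr d N x R j) = 1) :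
    ∃ t, D.answer R (F x) j = some t ∧
      ∀ k : Fin (σ.arity R), F (σ.addr d N x R j + 1 + k) = ofLex t k := by
  cases hA : D.answer R (F x) j with
  | none =>
    rw [(hF x hx R j).1 hA] at h
    exact absurd h zero_ne_one
  | some t => exact ⟨t, rfl, ((hF x hx R j).2 t hA).2⟩

theorem IsExploration.mem_ball (hF : IsExploration D d N (reachBound σ d N X r) F) {w : ℕ}
    (hw : w < X) {a : Fin D.size} (ha : F w = a) {l : ℕ} (hl : l ≤ r) {x : ℕ}
    (h : Reaches σ d N F w l x) : ∃ b : Fin D.size, F x = b ∧ b ∈ D.str.ball l a := by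
  induction l generalizing x with
  | zero => exact ⟨a, by rw [← ha, show x = w from h], RelStr.mem_ball_self _ _ _⟩
  | succ l ih =>
    rcases h with h | ⟨x₀, R, j, k, h, h1, rfl⟩
    · obtain ⟨b, hb, hba⟩ := ih (by omega) h
      exact ⟨b, hb, RelStr.ball_mono (Nat.le_succ l) _ hba⟩
    · obtain ⟨b, hb, hba⟩ := ih (by omega) h
      obtain ⟨t, ht, htk⟩ := hF.answer_eq ((h.lt_reachBound hw).trans_le
        (reachBound_mono σ d N X (by omega))) h1
      obtain ⟨htR, k', hk'⟩ := Database.of_answer_eq ht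
      refine ⟨ofLex t k, htk k, RelStr.mem_ball_trans hba ?_⟩
      rw [show b = ofLex t k' from Fin.ext (by rw [hk', hb])]
      exact RelStr.mem_ball_one_of_mem_rel htR k' k

theorem IsExploration.exists_reaches (hD : D.degree ≤ d)
    (hF : IsExploration D d N (reachBound σ d N X r) F) {w : ℕ} (hw : w < X) {a : Fin D.size}
    (ha : F w = a) {l : ℕ} (hl : l ≤ r) {b : Fin D.size} (hb : b ∈ D.str.ball l a) :
    ∃ x, Reaches σ d N F w l x ∧ F x = b := by
  induction l generalizing b with
  | zero =>
    rw [RelStr.mem_ball_zero] at hb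
    exact ⟨w, rfl, by rw [ha, hb]⟩
  | succ l ih =>
    obtain ⟨c, hc, rfl | ⟨-, R, t, ht, ⟨k, rfl⟩, ⟨k', rfl⟩⟩⟩ := RelStr.mem_ball_succ.1 hb
    · obtain ⟨x, hx, hxb⟩ := ih (by omega) hc
      exact ⟨x, Or.inl hx, hxb⟩
    · obtain ⟨x, hx, hxb⟩ := ih (by omega) hc
      obtain ⟨j, hj⟩ := Database.exists_answer_eq hD ht k
      rw [← hxb] at hj
      have h := (hF x ((hx.lt_reachBound hw).trans_le (reachBound_mono σ d N X (by omega)))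
        R j).2 _ hj
      exact ⟨_, Or.inr ⟨x, R, j, k', hx, h.1, rfl⟩, h.2 k'⟩

/-- The tuples of a relation can be read off from the order pattern of the registers. -/
theorem IsExploration.mem_rel {E : Database σ} (hD : D.degree ≤ d) (hF : IsExploration D d N X F)
    (hG : IsExploration E d N X G) (hY : X + (N + (σ.maxArity + 1) * (σ.numRel * d * X)) ≤ Y)
    (h : SamePattern Y F G) {z : ℕ} (hz : z < Y) (hFz : F z = 1) (hGz : G z = 1)
    {R : Fin σ.numRel} {x : Fin (σ.arity R) → ℕ} (hx : ∀ k, x k < X)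
    {u : Fin (σ.arity R) → Fin D.size} (hu : ∀ k, F (x k) = u k)
    {v : Fin (σ.arity R) → Fin E.size} (hv : ∀ k, G (x k) = v k) (hR : u ∈ D.str.rel R) :
    v ∈ E.str.rel R := by
  let k₀ : Fin (σ.arity R) := ⟨0, σ.arity_pos R⟩
  obtain ⟨j, hj⟩ := Database.exists_answer_eq hD hR k₀
  rw [← hu] at hj
  obtain ⟨h1, h2⟩ := (hF _ (hx k₀) R j).2 _ hj
  have hlt : ∀ k : Fin (σ.arity R), σ.addr d N (x k₀) R j + 1 + k < Y := fun k =>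
    (σ.addr_lt (d := d) (N := N) (hx k₀) R j k k.2).trans_le (by omega)
  have h3 : G (σ.addr d N (x k₀) R j) = 1 := by
    have := h.eq_iff (show σ.addr d N (x k₀) R j < Y by have := hlt k₀; omega) hz
    rw [hFz, hGz] at this
    exact this.1 h1
  obtain ⟨t, ht, htk⟩ := hG.answer_eq (hx k₀) h3
  have : v = ofLex t := by
    funext k
    refine Fin.ext ?_
    rw [← htk k, ← hv k, ← h.eq_iff ((hx k).trans_le (by omega)) (hlt k), h2 k, hu k]
    rfl
  rw [this]
  exact (Database.of_answer_eq ht).1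

/-- Sampled elements whose explorations have the same order pattern have isomorphic
neighbourhoods. -/
theorem SamePattern.sameNbhd {E : Database σ} (hD : D.degree ≤ d) (hE : E.degree ≤ d)
    (hF : IsExploration D d N (reachBound σ d N X r) F)
    (hG : IsExploration E d N (reachBound σ d N X r) G)
    (hY : reachBound σ d N X (r + 1) ≤ Y)
    (h : SamePattern Y F G) {z : ℕ} (hz : z < Y) (hFz : F z = 1) (hGz : G z = 1)
    {w : ℕ} (hw : w < X) {a : Fin D.size} (ha : F w = a) {b : Fin E.size} (hb : G w = b) :
    RelStr.SameNbhd r D.str a E.str b := by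
  have hY' : reachBound σ d N X r ≤ Y := (reachBound_mono σ d N X (Nat.le_succ r)).trans hY
  have hex : ∀ c : Fin D.size, ∃ e : Fin E.size, c ∈ D.str.ball r a →
      ∃ x, Reaches σ d N F w r x ∧ F x = c ∧ G x = e := by
    intro c
    by_cases hc : c ∈ D.str.ball r a
    · obtain ⟨x, hx, hxc⟩ := hF.exists_reaches hD hw ha le_rfl hc
      obtain ⟨e, he, -⟩ := hG.mem_ball hw hb le_rfl ((reaches_iff hw hz hY' h hFz hGz le_rfl).1 hx)
      exact ⟨e, fun _ => ⟨x, hx, hxc, he⟩⟩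
    · exact ⟨b, fun h => absurd h hc⟩
  choose f hf using hex
  have key : ∀ c ∈ D.str.ball r a, ∀ y, Reaches σ d N F w r y → F y = c → G y = f c := by
    intro c hc y hy hyc
    obtain ⟨x, hx, hxc, hxe⟩ := hf c hc
    rw [← hxe, ← h.eq_iff ((hy.lt_reachBound hw).trans_le hY') ((hx.lt_reachBound hw).trans_le hY'),
      hyc, hxc]
  refine RelStr.sameNbhd_iff.2 ⟨f, ⟨⟨fun c hc => ?_, fun c hc e he hce => ?_, fun e he => ?_⟩,
    fun R t ht => ?_⟩, ?_⟩
  · obtain ⟨x, hx, hxc, hxe⟩ := hf c hc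
    obtain ⟨e, hxe', he⟩ := hG.mem_ball hw hb le_rfl
      ((reaches_iff hw hz hY' h hFz hGz le_rfl).1 hx)
    rwa [show f c = e from Fin.ext (by rw [← hxe, hxe'])]
  · obtain ⟨x, hx, hxc, hxe⟩ := hf c hc
    obtain ⟨y, hy, hyc, hye⟩ := hf e he
    refine Fin.ext ?_
    rw [← hxc, ← hyc, h.eq_iff ((hx.lt_reachBound hw).trans_le hY')
      ((hy.lt_reachBound hw).trans_le hY'), hxe, hye, hce]
  · obtain ⟨x, hx, hxe⟩ := hG.exists_reaches hE hw hb le_rfl he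
    have hx' := (reaches_iff hw hz hY' h hFz hGz le_rfl).2 hx
    obtain ⟨c, hxc, hc⟩ := hF.mem_ball hw ha le_rfl hx'
    exact ⟨c, hc, Fin.ext (by rw [← key c hc x hx' hxc, hxe])⟩
  · choose x hx hxc hxe using fun k => hf (t k) (ht k)
    constructor
    · exact hF.mem_rel hD hG hY h hz hFz hGz (fun k => (hx k).lt_reachBound hw) hxc hxe
    · exact hG.mem_rel hE hF hY h.symm hz hGz hFz (fun k => (hx k).lt_reachBound hw) hxe hxc
  · exact Fin.ext (by rw [← key a (RelStr.mem_ball_self _ _ _) w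
      (show Reaches σ d N F w r w by
        clear * -
        induction r with
        | zero => exact rfl
        | succ r ih => exact Or.inl ih) ha, hb])

/-- A small database can be read off from the order pattern of its exploration. -/
theorem SamePattern.eq {E : Database σ} (hD : D.degree ≤ d) (hE : E.degree ≤ d)
    (hF : IsExploration D d N X F) (hG : IsExploration E d N X G)
    (hY : X + (N + (σ.maxArity + 1) * (σ.numRel * d * X)) ≤ Y) (h : SamePattern Y F G)
    {m : ℕ} (hm : 1 < m) (hmX : m < X) (hF0 : F 0 = D.size) (hG0 : G 0 = E.size)
    (hFc : ∀ c < m, F (1 + c) = c) (hGc : ∀ c < m, G (1 + c) = c) (hDm : D.size < m) : D = E := by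
  have hsize : D.size = E.size := by
    have := (h.eq_iff (show 0 < Y by omega) (show 1 + D.size < Y by omega)).1
      (by rw [hF0, hFc _ hDm])
    rw [hG0, hGc _ hDm] at this
    exact this.symm
  obtain ⟨n, A⟩ := D
  obtain ⟨n', B⟩ := E
  obtain rfl : n = n' := hsize
  congr 1
  ext R t
  simp only at hDm
  constructor
  · exact hF.mem_rel hD hG hY h (z := 1 + 1) (by omega) (hFc 1 hm) (hGc 1 hm)
      (x := fun k => 1 + t k) (fun k => by have := (t k).2; omega)
      (fun k => hFc _ ((t k).2.trans hDm)) (fun k => hGc _ ((t k).2.trans hDm))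
  · exact hG.mem_rel hE hF hY h.symm (z := 1 + 1) (by omega) (hGc 1 hm) (hFc 1 hm)
      (x := fun k => 1 + t k) (fun k => by have := (t k).2; omega)
      (fun k => hGc _ ((t k).2.trans hDm)) (fun k => hFc _ ((t k).2.trans hDm))

end

/-! ### The exploring program -/

namespace Prog

variable {σ : Schema}

/-- The query number `m`, for the `j`-th tuple of `R` that contains the element in the register
`x`, where `m` encodes `(x, R, j)`. Register `1 + j` is supposed to hold `j`. -/
def queryStep (σ : Schema) (d N m : ℕ) (p : Prog σ) : Prog σ :=
  if h : 0 < σ.numRel * d then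
    let b := finProdFinEquiv.symm (⟨m % (σ.numRel * d), Nat.mod_lt _ h⟩ : Fin (σ.numRel * d))
    query b.1 (m / (σ.numRel * d)) (1 + b.2) (N + (σ.maxArity + 1) * m) p
  else p

/-- The register contents after `queryStep`. -/
noncomputable def execStep (D : Database σ) (d N m : ℕ) (reg : ℕ → ℕ) : ℕ → ℕ :=
  if h : 0 < σ.numRel * d then
    let b := finProdFinEquiv.symm (⟨m % (σ.numRel * d), Nat.mod_lt _ h⟩ : Fin (σ.numRel * d))
    RAM.writeAnswer reg (N + (σ.maxArity + 1) * m)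
      (D.answer b.1 (reg (m / (σ.numRel * d))) (reg (1 + b.2)))
  else reg

/-- The queries with numbers below `m`. -/
def queries (d N : ℕ) : ℕ → Prog σ → Prog σ
  | 0, p => p
  | m + 1, p => queries d N m (queryStep σ d N m p)

/-- The register contents after `queries`. -/
noncomputable def exec (D : Database σ) (d N : ℕ) : ℕ → (ℕ → ℕ) → ℕ → ℕ
  | 0, reg => reg
  | m + 1, reg => execStep D d N m (exec D d N m reg)

theorem run_queries (D : Database σ) (d N m : ℕ) (p : Prog σ) (reg : ℕ → ℕ) :
    (queries d N m p).run D reg = p.run D (exec D d N m reg) := by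
  induction m generalizing p with
  | zero => rfl
  | succ m ih =>
    rw [queries, ih, exec, queryStep, execStep]
    split_ifs <;> rfl

theorem writeAnswer_of_lt {k n : ℕ} (reg : ℕ → ℕ) (dst : ℕ) (a : Option (Lex (Fin k → Fin n)))
    {y : ℕ} (hy : y < dst) : RAM.writeAnswer reg dst a y = reg y := by
  cases a with
  | none => exact Function.update_of_ne hy.ne _ _
  | some t =>
    simp only [RAM.writeAnswer]
    rw [if_neg hy.ne, dif_neg (by omega)]

theorem exec_of_lt (D : Database σ) (d N : ℕ) (reg : ℕ → ℕ) {m y : ℕ}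
    (hy : y < N + (σ.maxArity + 1) * m) {m' : ℕ} (h : m ≤ m') :
    exec D d N m' reg y = exec D d N m reg y := by
  induction m', h using Nat.le_induction with
  | base => rfl
  | succ m' h ih =>
    rw [exec, execStep, ← ih]
    split_ifs
    · exact writeAnswer_of_lt _ _ _ (hy.trans_le
        (Nat.add_le_add_left (Nat.mul_le_mul_left _ h) N))
    · rfl

theorem isExploration_exec (D : Database σ) {d N : ℕ} (hN : d < N) (reg : ℕ → ℕ)
    (hreg : ∀ j < d, reg (1 + j) = j) (X : ℕ) :
    IsExploration D d N X (exec D d N (σ.numRel * d * X) reg) := by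
  intro x hx R j
  have hB : 0 < σ.numRel * d := Nat.mul_pos R.pos j.pos
  set M := σ.numRel * d * X with hM
  set m := σ.numRel * d * x + finProdFinEquiv (R, j) with hm
  have hlt := (finProdFinEquiv (R, j)).2
  have hmM : m + 1 ≤ M := by
    calc m + 1 ≤ σ.numRel * d * x + σ.numRel * d := by omega
      _ = σ.numRel * d * (x + 1) := by ring
      _ ≤ _ := Nat.mul_le_mul_left _ hx
  have hdiv : m / (σ.numRel * d) = x := by
    rw [hm, Nat.mul_add_div hB, Nat.div_eq_of_lt hlt, add_zero]
  have hmod : m % (σ.numRel * d) = finProdFinEquiv (R, j) := by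
    rw [hm, Nat.mul_add_mod, Nat.mod_eq_of_lt hlt]
  have hxm : x ≤ m := (Nat.le_mul_of_pos_left x hB).trans (Nat.le_add_right _ _)
  have hmK : m ≤ (σ.maxArity + 1) * m := Nat.le_mul_of_pos_left m (Nat.succ_pos _)
  have hx' : exec D d N M reg x = exec D d N m reg x :=
    exec_of_lt D d N reg (by omega) (by omega)
  have hj' : exec D d N m reg (1 + j) = j := by
    rw [exec_of_lt D d N reg (m := 0) (by omega) (Nat.zero_le _)]
    exact hreg j j.2
  have haddr : σ.addr d N x R j = N + (σ.maxArity + 1) * m := rfl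
  have hstep : ∀ y < N + (σ.maxArity + 1) * (m + 1), exec D d N M reg y =
      RAM.writeAnswer (exec D d N m reg) (N + (σ.maxArity + 1) * m)
        (D.answer R (exec D d N m reg x) j) y := by
    intro y hy
    rw [exec_of_lt D d N reg hy hmM, exec, execStep, dif_pos hB]
    have hb : finProdFinEquiv.symm
        (⟨m % (σ.numRel * d), Nat.mod_lt _ hB⟩ : Fin (σ.numRel * d)) = (R, j) := by
      rw [Equiv.symm_apply_eq]
      exact Fin.ext hmod
    have : ∀ b : Fin σ.numRel × Fin d, b = (R, j) →
        RAM.writeAnswer (exec D d N m reg) (N + (σ.maxArity + 1) * m)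
          (D.answer b.1 (exec D d N m reg (m / (σ.numRel * d)))
            (exec D d N m reg (1 + b.2))) y =
        RAM.writeAnswer (exec D d N m reg) (N + (σ.maxArity + 1) * m)
          (D.answer R (exec D d N m reg x) j) y := by
      rintro _ rfl
      rw [hdiv, hj']
    exact this _ hb
  rw [haddr, hx']
  rw [mul_add, mul_one] at hstep
  constructor
  · intro h
    rw [hstep _ (by omega), h]
    exact Function.update_self _ _ _
  · intro t h
    constructor
    · rw [hstep _ (by omega), h]
      simp [RAM.writeAnswer]
    · intro k
      have hk := k.2.trans_le (σ.arity_le R)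
      rw [hstep _ (by omega), h]
      simp only [RAM.writeAnswer]
      rw [if_neg (by omega), dif_pos ⟨by omega, by have := k.2; omega⟩]
      exact congrArg (fun i => (ofLex t i : ℕ)) (Fin.ext (by simp only; omega))

/-- All pairs of numbers below `Y`. -/
def pairs (Y : ℕ) : List (ℕ × ℕ) := List.range Y ×ˢ List.range Y

/-- The results of all comparisons between registers below `Y`. -/
def pattern (Y : ℕ) (F : ℕ → ℕ) : List Bool := (pairs Y).map fun x => decide (F x.1 ≤ F x.2)

theorem samePattern_of_pattern_eq {Y : ℕ} {F G : ℕ → ℕ} (h : pattern Y F = pattern Y G) :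
    SamePattern Y F G := by
  intro x hx y hy
  have := List.map_inj_left.1 h (x, y) (by simp [pairs, hx, hy])
  simpa using this

/-- A constant number of samples and queries suffices to decide every property of samples of
elements that depends only on their neighbourhoods, and every property of small databases. -/
theorem exists_prog (σ : Schema) {d : ℕ} (r s n₁ : ℕ) (hn₁ : 0 < n₁)
    (S : Set (Database σ)) (Q : (D : Database σ) → (Fin s → Fin D.size) → Prop)
    (hQ : ∀ D E : Database σ, D.degree ≤ d → E.degree ≤ d → ∀ a b,
      (∀ i, RelStr.SameNbhd r D.str (a i) E.str (b i)) → Q D a → Q E b) :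
    ∃ p : Prog σ, ∀ D : Database σ, D.degree ≤ d →
      (D.size < n₁ → p.run D (initReg D.size) = PMF.pure (decide (D ∈ S))) ∧
      (n₁ ≤ D.size → ∀ b, p.run D (initReg D.size) b =
        ((Finset.univ.filter fun a : Fin s → Fin D.size => decide (Q D a) = b).card : ℝ≥0∞) /
          (D.size : ℝ≥0∞) ^ s) := by
  -- Register `0` holds the size, registers `1, …, m` hold constants; then come the samples, and
  -- from register `N` on the answers to the queries.
  let m := n₁ + d + 2
  let N := 1 + m + s
  let X := reachBound σ d N N r
  let Y := reachBound σ d N N (r + 1)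
  have hY : X + (N + (σ.maxArity + 1) * (σ.numRel * d * X)) ≤ Y := le_rfl
  have hNX : N ≤ X := reachBound_mono σ d N N (Nat.zero_le r)
  let f : (D : Database σ) → (Fin s → ℕ) → ℕ → ℕ := fun D a =>
    exec D d N (σ.numRel * d * X) (putSamples (1 + m) a (putConstants m (initReg D.size)))
  -- The order patterns that lead to acceptance. Patterns determine small databases completely, and
  -- the neighbourhoods of the samples otherwise; the size `n₁` is among the constants, so small and
  -- large databases have different patterns.
  let good : List Bool → Prop := fun l =>
    (∃ D ∈ S, D.degree ≤ d ∧ D.size < n₁ ∧ ∃ a, pattern Y (f D a) = l) ∨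
    ∃ D : Database σ, D.degree ≤ d ∧ n₁ ≤ D.size ∧ ∃ a : Fin s → Fin D.size, Q D a ∧
      pattern Y (f D fun i => a i) = l
  have hexp : ∀ D a, IsExploration D d N X (f D a) := by
    intro D a
    refine isExploration_exec D (by omega) _ (fun j hj => ?_) X
    rw [putSamples, dif_neg (by omega), putConstants, if_pos (by omega)]
    omega
  have hlow : ∀ D a y, y < N → f D a y =
      putSamples (1 + m) a (putConstants m (initReg D.size)) y := fun D a y hy =>
    exec_of_lt D d N _ (m := 0) (by omega) (Nat.zero_le _)
  have hzero : ∀ D a, f D a 0 = D.size := by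
    intro D a
    rw [hlow D a 0 (by omega), putSamples, dif_neg (by omega), putConstants, if_neg (by omega)]
    exact Function.update_self _ _ _
  have hconst : ∀ D a, ∀ c < m, f D a (1 + c) = c := by
    intro D a c hc
    rw [hlow D a _ (by omega), putSamples, dif_neg (by omega), putConstants, if_pos (by omega)]
    omega
  have hsample : ∀ D a, ∀ i : Fin s, f D a (1 + m + i) = a i := by
    intro D a i
    have := i.2
    rw [hlow D a _ (by omega), putSamples, dif_pos ⟨by omega, by omega⟩]
    congr 1
    ext
    simp
  have heq : ∀ D E a b, D.degree ≤ d → E.degree ≤ d → D.size < n₁ →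
      pattern Y (f D a) = pattern Y (f E b) → D = E := fun D E a b hD hE hDn h =>
    (samePattern_of_pattern_eq h).eq hD hE (hexp D a) (hexp E b) hY (m := m) (by omega) (by omega)
      (hzero D a) (hzero E b) (hconst D a) (hconst E b) (by omega)
  have hgood : ∀ D : Database σ, D.degree ≤ d → n₁ ≤ D.size → ∀ a : Fin s → Fin D.size,
      (good (pattern Y (f D fun i => a i)) ↔ Q D a) := by
    intro D hD hDn a
    constructor
    · rintro (⟨E, -, hE, hEn, b, hb⟩ | ⟨E, hE, hEn, b, hQb, hb⟩)
      · rw [heq E D b _ hE hD hEn hb] at hEn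
        omega
      · refine hQ E D hE hD b a (fun i => ?_) hQb
        have := i.2
        exact (samePattern_of_pattern_eq hb).sameNbhd hE hD (hexp E _) (hexp D _) le_rfl
          (z := 1 + 1) (by omega) (hconst _ _ 1 (by omega)) (hconst _ _ 1 (by omega))
          (w := 1 + m + i) (by omega) (hsample E _ i) (hsample D _ i)
    · exact fun h => Or.inr ⟨D, hD, hDn, a, h, rfl⟩
  have hgood' : ∀ D : Database σ, D.degree ≤ d → D.size < n₁ → ∀ a,
      (good (pattern Y (f D a)) ↔ D ∈ S) := by
    intro D hD hDn a
    constructor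
    · rintro (⟨E, hES, hE, hEn, b, hb⟩ | ⟨E, hE, hEn, b, -, hb⟩)
      · rwa [← heq E D b _ hE hD hEn hb]
      · rw [heq D E a _ hD hE hDn hb.symm] at hDn
        omega
    · exact fun h => Or.inl ⟨D, h, hD, hDn, a, rfl⟩
  let p₀ : Prog σ := queries d N (σ.numRel * d * X) (compare (pairs Y) fun l => decide (good l))
  have hp₀ : ∀ D reg, p₀.run D reg =
      PMF.pure (decide (good (pattern Y (exec D d N (σ.numRel * d * X) reg)))) := by
    intro D reg
    rw [run_queries, run_compare]
    rfl
  refine ⟨constants m (samples (1 + m) s p₀), fun D hD => ⟨fun hDn => ?_, fun hDn b => ?_⟩⟩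
  · rw [run_constants]
    exact run_samples_of_forall D (hp₀ D) _ s _ _ fun a =>
      decide_eq_decide.2 (hgood' D hD hDn a)
  · rw [run_constants, run_samples D (hp₀ D) b (hn₁.trans_le hDn) s _ (by omega) _
      (by rw [putConstants, if_neg (by omega)]; exact Function.update_self _ _ _)]
    congr 3
    ext a
    simp only [Finset.mem_filter, Finset.mem_univ, true_and]
    exact iff_of_eq (congrArg (· = b) (decide_eq_decide.2 (hgood D hD hDn a)))

end Prog

/-! ### Semilinear sets and cones -/

section Semilinear

open scoped Pointwise

variable {ι : Type*} [Fintype ι]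

/-- `X` is a scaling limit of `S`: the dilations of `X` by natural numbers have distance at most `c`
to `S`, and every vector in `S` has distance at most `c` to all dilations of `X`. -/
def ConeApprox (S : Set (ι → ℕ)) (X : Set (ι → ℝ)) (c : ℝ) : Prop :=
  (∀ y ∈ S, ∀ n : ℕ, 0 < n → ∃ x ∈ X, ∑ i, |(y i : ℝ) - n * x i| ≤ c) ∧
    ∀ x ∈ X, ∀ n : ℕ, ∃ y ∈ S, ∑ i, |(y i : ℝ) - n * x i| ≤ c

/-- A linear set is approximated by the convex cone of its periods: real coefficients are rounded
down to natural numbers. -/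
theorem exists_coneApprox_of_isLinearSet {S : Set (ι → ℕ)} (hS : IsLinearSet S) :
    ∃ X c, ConeApprox S X c := by
  obtain ⟨a, t, rfl⟩ := isLinearSet_iff.1 hS
  refine ⟨{x | ∃ α : (ι → ℕ) → ℝ, (∀ v, 0 ≤ α v) ∧ ∀ i, x i = ∑ v ∈ t, α v * v i},
    ∑ i, ((a i : ℝ) + ∑ v ∈ t, (v i : ℝ)), fun y hy n hn => ?_, ?_⟩
  · obtain ⟨z, hz, rfl⟩ := Set.mem_vadd_set.1 hy
    obtain ⟨f, -, rfl⟩ := AddSubmonoid.mem_closure_finset.1 hz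
    have hn' : (n : ℝ) ≠ 0 := by positivity
    refine ⟨fun i => ∑ v ∈ t, (f v / n : ℝ) * v i, ⟨fun v => f v / n, fun v => by positivity,
      fun i => rfl⟩, Finset.sum_le_sum fun i _ => ?_⟩
    have : (((a +ᵥ ∑ v ∈ t, f v • v) i : ℕ) : ℝ) - n * ∑ v ∈ t, (f v / n : ℝ) * v i = a i := by
      rw [Finset.mul_sum]
      simp only [vadd_eq_add, Pi.add_apply, Finset.sum_apply, Pi.smul_apply, smul_eq_mul,
        Nat.cast_add, Nat.cast_sum, Nat.cast_mul]
      rw [add_sub_assoc, ← Finset.sum_sub_distrib, Finset.sum_eq_zero, add_zero]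
      intro v _
      field_simp
      ring
    rw [this, abs_of_nonneg (Nat.cast_nonneg _)]
    exact le_add_of_nonneg_right (Finset.sum_nonneg fun v _ => Nat.cast_nonneg _)
  · rintro x ⟨α, hα, hx⟩ n
    refine ⟨a +ᵥ ∑ v ∈ t, ⌊n * α v⌋₊ • v, Set.vadd_mem_vadd_set (sum_mem fun v hv =>
      nsmul_mem (AddSubmonoid.subset_closure hv) _), Finset.sum_le_sum fun i _ => ?_⟩
    have : (((a +ᵥ ∑ v ∈ t, ⌊n * α v⌋₊ • v) i : ℕ) : ℝ) - n * x i =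
        a i + ∑ v ∈ t, ((⌊n * α v⌋₊ : ℝ) - n * α v) * v i := by
      rw [hx, Finset.mul_sum]
      simp only [vadd_eq_add, Pi.add_apply, Finset.sum_apply, Pi.smul_apply, smul_eq_mul,
        Nat.cast_add, Nat.cast_sum, Nat.cast_mul]
      rw [add_sub_assoc, ← Finset.sum_sub_distrib]
      congr 1
      exact Finset.sum_congr rfl fun v _ => by ring
    rw [this]
    refine (abs_add_le _ _).trans (add_le_add (abs_of_nonneg (Nat.cast_nonneg _)).le
      ((Finset.abs_sum_le_sum_abs _ _).trans (Finset.sum_le_sum fun v _ => ?_)))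
    rw [abs_mul, Nat.abs_cast]
    refine mul_le_of_le_one_left (Nat.cast_nonneg _) ?_
    rw [abs_le]
    have h0 : 0 ≤ n * α v := mul_nonneg (Nat.cast_nonneg _) (hα v)
    constructor
    · linarith [Nat.lt_floor_add_one (n * α v)]
    · linarith [Nat.floor_le h0]

theorem exists_coneApprox {S : Set (ι → ℕ)} (hS : IsSemilinearSet S) :
    ∃ X c, ConeApprox S X c := by
  obtain ⟨F, hF, rfl⟩ := isSemilinearSet_iff.1 hS
  have h : ∀ T : Set (ι → ℕ), ∃ X c, T ∈ F → ConeApprox T X c := fun T => by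
    by_cases hT : T ∈ F
    · obtain ⟨X, c, h⟩ := exists_coneApprox_of_isLinearSet (hF T hT)
      exact ⟨X, c, fun _ => h⟩
    · exact ⟨∅, 0, fun h => absurd h hT⟩
  choose X c h using h
  have hc : ∀ T ∈ F, c T ≤ ∑ T ∈ F, |c T| := fun T hT =>
    (le_abs_self _).trans (Finset.single_le_sum (f := fun T => |c T|) (fun _ _ => abs_nonneg _) hT)
  refine ⟨⋃ T ∈ F, X T, ∑ T ∈ F, |c T|, fun y hy n hn => ?_, fun x hx n => ?_⟩
  · obtain ⟨T, hT, hy⟩ := hy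
    obtain ⟨x, hx, hle⟩ := (h T hT).1 y hy n hn
    exact ⟨x, Set.mem_biUnion (s := {T | T ∈ F}) hT hx, hle.trans (hc T hT)⟩
  · obtain ⟨T, hT, hx⟩ := Set.mem_iUnion₂.1 hx
    obtain ⟨y, hy, hle⟩ := (h T hT).2 x hx n
    exact ⟨y, ⟨T, hT, hy⟩, hle.trans (hc T hT)⟩

end Semilinear

/-! ### Estimating frequencies by sampling -/

section Sampling

open Finset

theorem expect_eval {s : ℕ} {V : Type} [Fintype V] [Nonempty V] (i : Fin s) (g : V → ℝ) :
    𝔼 a : Fin s → V, g (a i) = 𝔼 v, g v := by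
  rw [← Fintype.expect_equiv (Equiv.funUnique Unit V) (fun ω : Unit → V => g (ω ())) g fun _ => rfl]
  exact expect_comp_injective (ι := fun _ : Unit => i) (fun _ _ _ => rfl)
    fun ω : Unit → V => g (ω ())

/-- The distance between the frequencies of the values of `f` in a sample and in the whole set. -/
noncomputable def sampleError {V T : Type} [Fintype V] [Fintype T] (f : V → T) {s : ℕ}
    (a : Fin s → V) : ℝ :=
  ∑ τ, |((univ.filter fun i => f (a i) = τ).card : ℝ) / s -
    ((univ.filter fun v => f v = τ).card : ℝ) / Fintype.card V|

/-- The sampled elements are independent, so the variance of each frequency is at most `1 / s`. -/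
theorem expect_sq_sampleError_le {V T : Type} [Fintype V] [Nonempty V] [Fintype T] (f : V → T)
    {s : ℕ} (hs : 0 < s) :
    𝔼 a : Fin s → V, sampleError f a ^ 2 ≤ (Fintype.card T : ℝ) ^ 2 / s := by
  have hs' : (0 : ℝ) < s := by positivity
  have hvar : ∀ τ, 𝔼 a : Fin s → V, (((univ.filter fun i => f (a i) = τ).card : ℝ) / s -
      ((univ.filter fun v => f v = τ).card : ℝ) / Fintype.card V) ^ 2 ≤ 1 / s := by
    intro τ
    let g : V → ℝ := fun v => if f v = τ then 1 else 0
    have hg : 𝔼 v, g v = ((univ.filter fun v => f v = τ).card : ℝ) / Fintype.card V := by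
      rw [Fintype.expect_eq_sum_div_card, card_filter, Nat.cast_sum]
      simp [g]
    have h := expect_sq_sub_le (fun (i : Fin s) (a : Fin s → V) => g (a i)) (· = ·)
      (fun i a => by simp only [g]; split_ifs <;> norm_num)
      (fun i a => by simp only [g]; split_ifs <;> norm_num)
      (fun i j hij => expect_mul_of_disjoint (L := {i}) (L' := {j})
        (Set.disjoint_singleton.2 hij)
        (fun a b hab => by simp only [hab i rfl]) (fun a b hab => by simp only [hab j rfl]))
    simp only [expect_eval, hg] at h
    replace h := h.trans_eq ((sum_congr rfl (g := fun _ => (1 : ℝ)) fun i _ => by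
      rw [card_eq_one.2 ⟨i, by ext j; simp [eq_comm]⟩, Nat.cast_one]).trans (by simp :
        ∑ _i : Fin s, (1 : ℝ) = s))
    have h2 : ∀ a : Fin s → V, (((univ.filter fun i => f (a i) = τ).card : ℝ) / s -
        ((univ.filter fun v => f v = τ).card : ℝ) / Fintype.card V) ^ 2 =
        (∑ i, g (a i) - ∑ i : Fin s,
          ((univ.filter fun v => f v = τ).card : ℝ) / Fintype.card V) ^ 2 / s ^ 2 := by
      intro a
      have : ∑ i, g (a i) = ((univ.filter fun i => f (a i) = τ).card : ℝ) := by
        rw [card_filter, Nat.cast_sum]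
        simp [g]
      rw [this, sum_const, card_univ, Fintype.card_fin, nsmul_eq_mul, ← div_pow, sub_div,
        mul_div_cancel_left₀ _ hs'.ne']
    simp only [h2]
    rw [← expect_div]
    rw [div_le_div_iff₀ (by positivity) hs']
    calc _ ≤ (s : ℝ) * s := mul_le_mul_of_nonneg_right h hs'.le
      _ = _ := by ring
  calc 𝔼 a : Fin s → V, sampleError f a ^ 2
      ≤ 𝔼 a : Fin s → V, (Fintype.card T : ℝ) * ∑ τ,
          (((univ.filter fun i => f (a i) = τ).card : ℝ) / s -
            ((univ.filter fun v => f v = τ).card : ℝ) / Fintype.card V) ^ 2 := by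
        refine expect_le_expect fun a _ => ?_
        refine (sq_sum_le_card_mul_sum_sq (s := univ)).trans ?_
        simp only [sq_abs, card_univ]
        exact le_rfl
    _ = (Fintype.card T : ℝ) * ∑ τ, 𝔼 a : Fin s → V,
          (((univ.filter fun i => f (a i) = τ).card : ℝ) / s -
            ((univ.filter fun v => f v = τ).card : ℝ) / Fintype.card V) ^ 2 := by
        rw [← mul_expect, expect_sum_comm]
    _ ≤ (Fintype.card T : ℝ) * ∑ _τ : T, (1 / s : ℝ) :=
        mul_le_mul_of_nonneg_left (sum_le_sum fun τ _ => hvar τ) (Nat.cast_nonneg _)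
    _ = _ := by
        rw [sum_const, card_univ, nsmul_eq_mul]
        ring

/-- Most samples of sufficiently large constant size estimate all frequencies accurately. -/
theorem three_mul_card_sampleError_lt_le {V T : Type} [Fintype V] [Nonempty V] [Fintype T]
    (f : V → T) {s : ℕ} (hs : 0 < s) {η : ℝ} (hη : 0 < η)
    (h : 3 * (Fintype.card T : ℝ) ^ 2 ≤ η ^ 2 * s) :
    3 * (univ.filter fun a : Fin s → V => η < sampleError f a).card ≤ Fintype.card V ^ s := by
  have h1 := expect_sq_sampleError_le f (V := V) hs
  have hs' : (0 : ℝ) < s := by positivity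
  have h2 : 𝔼 a : Fin s → V, η ^ 2 * (if η < sampleError f a then 1 else 0) ≤
      𝔼 a : Fin s → V, sampleError f a ^ 2 := by
    refine expect_le_expect fun a _ => ?_
    split_ifs with ha
    · rw [mul_one]
      exact pow_le_pow_left₀ hη.le ha.le 2
    · rw [mul_zero]
      positivity
  rw [← mul_expect, Fintype.expect_eq_sum_div_card, Fintype.card_fun, Fintype.card_fin] at h2
  have h3 : (∑ a : Fin s → V, if η < sampleError f a then (1 : ℝ) else 0) =
      ((univ.filter fun a : Fin s → V => η < sampleError f a).card : ℝ) := by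
    simp
  have hV : (0 : ℝ) < (Fintype.card V : ℝ) ^ s := by
    have := Fintype.card_pos (α := V)
    positivity
  rw [h3] at h2
  have h4 : (Fintype.card T : ℝ) ^ 2 / s ≤ η ^ 2 / 3 := by
    rw [div_le_div_iff₀ hs' (by norm_num)]
    linarith
  have h5 := h2.trans (h1.trans h4)
  push_cast at h5
  rw [← mul_div_assoc, div_le_div_iff₀ hV (by norm_num), mul_assoc] at h5
  have h6 := le_of_mul_le_mul_left h5 (by positivity)
  have h7 : (3 * (univ.filter fun a : Fin s → V => η < sampleError f a).card : ℝ) ≤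
      (Fintype.card V : ℝ) ^ s := by linarith
  exact_mod_cast h7

end Sampling

/-! ### The tester -/

section Tester

open Finset

variable {σ : Schema} {d : ℕ}

theorem isClose_self (d : ℕ) {ε : ℝ} (hε : 0 ≤ ε) (D : Database σ) : IsClose d ε D D := by
  have h : distPM D D ≤ 0 :=
    Nat.sInf_le ⟨0, 0, rfl, D, D, rfl, rfl, Equiv.refl _, fun _ _ => Iff.rfl⟩
  rw [IsClose, Nat.le_zero.1 h, Nat.cast_zero]
  positivity

/-- The type frequencies of the sample `a` are close to a vector in `X`. -/
def AcceptsSample (d r : ℕ) (X : Set (NbhdType σ d r → ℝ)) (η : ℝ) {s : ℕ} (D : Database σ)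
    (a : Fin s → Fin D.size) : Prop :=
  ∃ hD : D.degree ≤ d, ∃ x ∈ X, ∑ τ : NbhdType σ d r,
    |((univ.filter fun i => D.typeOf r hD (a i) = τ).card : ℝ) / s - x τ| ≤ η

theorem AcceptsSample.congr {r : ℕ} {X : Set (NbhdType σ d r → ℝ)} {η : ℝ} {s : ℕ}
    {D E : Database σ} (hE : E.degree ≤ d) {a : Fin s → Fin D.size} {b : Fin s → Fin E.size}
    (hab : ∀ i, RelStr.SameNbhd r D.str (a i) E.str (b i)) (h : AcceptsSample d r X η D a) :
    AcceptsSample d r X η E b := by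
  obtain ⟨hD, x, hx, hle⟩ := h
  have : ∀ i, D.typeOf r hD (a i) = E.typeOf r hE (b i) := fun i =>
    (Database.typeOf_eq_iff hD hE).2 (hab i)
  simp only [this] at hle
  exact ⟨hE, x, hx, hle⟩

theorem sampleError_typeOf {r : ℕ} {D : Database σ} (hD : D.degree ≤ d) {s : ℕ}
    (a : Fin s → Fin D.size) : sampleError (D.typeOf r hD) a = ∑ τ : NbhdType σ d r,
      |((univ.filter fun i => D.typeOf r hD (a i) = τ).card : ℝ) / s -
        (histogram d r D τ : ℝ) / D.size| := by
  simp only [sampleError, histogram_eq hD, Fintype.card_fin]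

theorem sum_abs_div_sub {ι : Type*} [Fintype ι] {n : ℕ} (hn : 0 < n) (y x : ι → ℝ) :
    ∑ i, |y i / n - x i| = (∑ i, |y i - n * x i|) / n := by
  rw [Finset.sum_div]
  refine Finset.sum_congr rfl fun i _ => ?_
  have hn' : (0 : ℝ) < n := by positivity
  rw [← abs_of_pos hn', ← abs_div, abs_of_pos hn', sub_div, mul_div_cancel_left₀ _ hn'.ne']

/-- If the database has the property, then all samples with a small error are accepted. -/
theorem acceptsSample_of_mem {r : ℕ} {P : Set (Database σ)} {X : Set (NbhdType σ d r → ℝ)}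
    {c η : ℝ} (hX : ConeApprox (histogram d r '' P) X c) {D : Database σ} (hD : D.degree ≤ d)
    (hDP : D ∈ P) (hn : 0 < D.size) (hc : c ≤ η * D.size) {s : ℕ} {a : Fin s → Fin D.size}
    (ha : sampleError (D.typeOf r hD) a ≤ η) : AcceptsSample d r X (2 * η) D a := by
  obtain ⟨x, hx, hle⟩ := hX.1 _ ⟨D, hDP, rfl⟩ D.size hn
  refine ⟨hD, x, hx, ?_⟩
  have h1 : ∑ τ, |(histogram d r D τ : ℝ) / D.size - x τ| ≤ η := by
    rw [sum_abs_div_sub hn, div_le_iff₀ (by positivity)]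
    exact hle.trans hc
  rw [sampleError_typeOf] at ha
  calc _ ≤ ∑ τ : NbhdType σ d r, (|((univ.filter fun i => D.typeOf r hD (a i) = τ).card : ℝ) / s -
        (histogram d r D τ : ℝ) / D.size| + |(histogram d r D τ : ℝ) / D.size - x τ|) :=
        sum_le_sum fun τ _ => abs_sub_le _ _ _
    _ ≤ 2 * η := by
        rw [sum_add_distrib]
        linarith

/-- If a sample with a small error is accepted, then the histogram of the database is close to the
histogram of a database with the property. -/
theorem exists_histDist_le_of_acceptsSample {r : ℕ} {P : Set (Database σ)}
    {X : Set (NbhdType σ d r → ℝ)} {c η : ℝ} (hX : ConeApprox (histogram d r '' P) X c)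
    {D : Database σ} (hD : D.degree ≤ d) (hn : 0 < D.size) (hc : c ≤ η * D.size) {s : ℕ}
    {a : Fin s → Fin D.size} (ha : sampleError (D.typeOf r hD) a ≤ η)
    (h : AcceptsSample d r X (2 * η) D a) : ∃ E ∈ P, histDist d r D E ≤ 4 * η * D.size := by
  obtain ⟨_, x, hx, hle⟩ := h
  obtain ⟨_, ⟨E, hE, rfl⟩, hEx⟩ := hX.2 x hx D.size
  refine ⟨E, hE, ?_⟩
  rw [sampleError_typeOf] at ha
  have h1 : ∑ τ, |(histogram d r D τ : ℝ) / D.size - x τ| ≤ 3 * η := by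
    calc _ ≤ ∑ τ : NbhdType σ d r, (|((univ.filter fun i => D.typeOf r hD (a i) = τ).card : ℝ) / s -
          (histogram d r D τ : ℝ) / D.size| +
          |((univ.filter fun i => D.typeOf r hD (a i) = τ).card : ℝ) / s - x τ|) := by
          refine sum_le_sum fun τ _ => ?_
          rw [abs_sub_comm (((univ.filter fun i => D.typeOf r hD (a i) = τ).card : ℝ) / s)
            ((histogram d r D τ : ℝ) / D.size)]
          exact abs_sub_le _ _ _
      _ ≤ 3 * η := by
          rw [sum_add_distrib]
          linarith
  rw [sum_abs_div_sub hn, div_le_iff₀ (by positivity)] at h1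
  calc histDist d r D E ≤ ∑ τ : NbhdType σ d r, (|(histogram d r D τ : ℝ) - D.size * x τ| +
        |(histogram d r E τ : ℝ) - D.size * x τ|) := by
        refine sum_le_sum fun τ _ => ?_
        rw [abs_sub_comm (histogram d r E τ : ℝ)]
        exact abs_sub_le _ _ _
    _ ≤ 4 * η * D.size := by
        rw [sum_add_distrib]
        linarith

/-- If the samples without the answer `b` are among the inaccurate ones, then the answer `b` has
probability at least `2 / 3`. -/
theorem two_thirds_le_of_imp {V : Type} [Fintype V] [Nonempty V] {s : ℕ}
    {B : (Fin s → V) → Prop} (hB : 3 * (univ.filter B).card ≤ Fintype.card V ^ s)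
    {Q : (Fin s → V) → Prop} (hQ : ∀ a, ¬ B a → Q a) :
    (2 / 3 : ℝ≥0∞) ≤ ((univ.filter Q).card : ℝ≥0∞) / (Fintype.card V : ℝ≥0∞) ^ s := by
  have h1 : (univ.filter B).card + (univ.filter fun a => ¬ B a).card = Fintype.card V ^ s := by
    rw [card_filter_add_card_filter_not]
    simp
  have h2 : (univ.filter fun a => ¬ B a).card ≤ (univ.filter Q).card :=
    card_le_card fun a ha => by
      rw [mem_filter] at ha ⊢
      exact ⟨ha.1, hQ a ha.2⟩
  have h3 : 2 * Fintype.card V ^ s ≤ (univ.filter Q).card * 3 := by omega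
  have hV : Fintype.card V ≠ 0 := Fintype.card_ne_zero
  rw [ENNReal.le_div_iff_mul_le (Or.inl (by simp [hV])) (Or.inl (by finiteness)),
    ENNReal.mul_comm_div, ← mul_div_assoc, ENNReal.div_le_iff (by norm_num) (by norm_num)]
  exact_mod_cast h3

/-- A property is testable if, up to a small distance, it can be recognised by the histogram, and
its histograms are approximated by a cone. -/
theorem exists_isTester {P : Set (Database σ)} {r : ℕ} {δ ε : ℝ} (hδ : 0 < δ) (hε : 0 ≤ ε)
    {n₀ : ℕ}
    (hclose : ∀ D : Database σ, D.degree ≤ d → n₀ ≤ D.size → ∀ E ∈ P,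
      histDist d r D E ≤ δ * D.size → IsClose d ε D E)
    (hP : IsSemilinearSet (histogram d r '' P)) :
    ∃ p : Prog σ, IsTester d ε P (boundedDegree σ d) p.toRAM := by
  obtain ⟨X, c, hX⟩ := exists_coneApprox hP
  -- An accepted sample of error `δ / 4` leads to a histogram distance of at most `4 * (δ / 4)`: the
  -- error of the sample, the tolerance `2 * (δ / 4)`, and `c ≤ δ / 4 * D.size` for the cone.
  have hη : 0 < δ / 4 := by positivity
  obtain ⟨s, hs⟩ := exists_nat_ge (3 * (Fintype.card (NbhdType σ d r) : ℝ) ^ 2 / (δ / 4) ^ 2 + 1)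
  obtain ⟨n₁, hn₁⟩ := exists_nat_ge (c / (δ / 4))
  have hs0 : 0 < s := by
    have : (0 : ℝ) < s := lt_of_lt_of_le (by positivity) hs
    exact_mod_cast this
  have hs3 : 3 * (Fintype.card (NbhdType σ d r) : ℝ) ^ 2 ≤ (δ / 4) ^ 2 * s := by
    rw [← div_le_iff₀' (by positivity)]
    linarith
  obtain ⟨p, hp⟩ := Prog.exists_prog σ (d := d) r s (n₀ + n₁ + 1) (Nat.succ_pos _) P
    (AcceptsSample d r X (2 * (δ / 4))) fun D E _ hE a b hab h => h.congr hE hab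
  refine ⟨p, fun D hD => ?_⟩
  obtain ⟨hsmall, hlarge⟩ := hp D hD
  have h23 : (2 / 3 : ℝ≥0∞) ≤ 1 := ENNReal.div_le_of_le_mul (by norm_num)
  -- small databases are decided exactly, since a database is close to itself
  rcases lt_or_ge D.size (n₀ + n₁ + 1) with hn | hn
  · refine ⟨fun hDP => ?_, fun hfar => ?_⟩
    · refine le_trans ?_ (p.le_acceptProb D)
      rw [hsmall hn, decide_eq_true hDP]
      simpa using h23
    · have hDP : D ∉ P := fun h => hfar ⟨D, h, isClose_self d hε D⟩
      refine le_trans ?_ (p.le_rejectProb D)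
      rw [hsmall hn, decide_eq_false hDP]
      simpa using h23
  · have hn0 : 0 < D.size := by omega
    have : Nonempty (Fin D.size) := ⟨⟨0, hn0⟩⟩
    have hc : c ≤ δ / 4 * D.size := by
      rw [div_le_iff₀' hη] at hn₁
      refine hn₁.trans (mul_le_mul_of_nonneg_left ?_ hη.le)
      exact_mod_cast (by omega : n₁ ≤ D.size)
    have hbad := three_mul_card_sampleError_lt_le (D.typeOf r hD) hs0 hη hs3
    refine ⟨fun hDP => ?_, fun hfar => ?_⟩
    · refine le_trans ?_ (p.le_acceptProb D)
      rw [hlarge hn]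
      have := two_thirds_le_of_imp hbad
        (Q := fun a => decide (AcceptsSample d r X (2 * (δ / 4)) D a) = true) fun a ha =>
          decide_eq_true (acceptsSample_of_mem hX hD hDP hn0 hc (not_lt.1 ha))
      rw [Fintype.card_fin] at this
      exact this.trans (le_of_eq (by congr!))
    · refine le_trans ?_ (p.le_rejectProb D)
      rw [hlarge hn]
      have := two_thirds_le_of_imp hbad
        (Q := fun a => decide (AcceptsSample d r X (2 * (δ / 4)) D a) = false) fun a ha =>
          decide_eq_false fun h => by
            obtain ⟨E, hE, hDE⟩ :=
              exists_histDist_le_of_acceptsSample hX hD hn0 hc (not_lt.1 ha) h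
            exact hfar ⟨E, hE, hclose D hD (by omega) E hE (hDE.trans_eq (by ring))⟩
      rw [Fintype.card_fin] at this
      exact this.trans (le_of_eq (by congr!))

end Tester

end

theorem mainTheorem2 (σ : Schema) (d : ℕ) (hd : 2 ≤ d) (C P : Set (Database σ))
    (hC_iso : IsoClosed C) (hC_deg : C ⊆ boundedDegree σ d)
    (hC_remove : ClosedUnderRemovingTuples C)
    (hP_iso : IsoClosed P) (hPC : P ⊆ C)
    (hP_hyperfinite : IsHyperfiniteOn P C)
    (hP_semilinear : ∀ r : ℕ, IsSemilinearSet (histogram d r '' P)) :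
    UniformlyTestableInConstantTime d P C := by
  obtain ⟨ρ, hρ⟩ := hP_hyperfinite
  intro ε hε
  obtain ⟨r, δ, hδ, n₀, hclose⟩ :=
    exists_isClose_of_histDist_le σ (show 0 < d by omega) ρ hε.1
  obtain ⟨p, hp⟩ := exists_isTester hδ hε.1.le (fun D hD hn E hE hDE =>
    hclose D E hD (hC_deg (hPC hE)) hn
      (fun ε' hε' => (hρ ε' hε' E hE).imp fun _ h => h.1) hDE) (hP_semilinear r)
  exact ⟨p.toRAM, fun D hD => hp D (hC_deg hD), ⟨_, p.queryComplexityLE_toRAM C⟩, _,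
    p.runsInTime_toRAM C⟩
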